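/- Let $P=(P_1,\dots,P_n)$ with $P_i\in\mathbb C[x_1,\dots,x_n]$, and consider the polynomial system $\dot x=P(x)$ on $\mathbb C^n$. Let $(\mathbb C(x),\partial_1,\dots,\partial_n)$ be the differential field of rational functions with its partial derivatives, and call an element of a differential field extension $M$ of it (commuting derivations extending the $\partial_i$, again denoted $\partial_i$) *Liouvillian* if it lies in an intermediate field $L$ that is the top of a finite tower of differential fields $\mathbb C(x)=K_0\subset K_1\subset\dots\subset K_r=L$ in which, for every $k$, either $K_{k+1}/K_k$ is a finite algebraic extension, or $K_{k+1}=K_k(t)$ with $t$ transcendental over $K_k$ and $\partial_i t/t\in K_k$ for all $i$, or $K_{k+1}=K_k(t)$ with $t$ transcendental over $K_k$ and $\partial_i t\in K_k$ for all $i$. **Theorem.** Suppose that the system is Liouvillian integrable, i.e. in some differential field extension $M$ of $\mathbb C(x)$ (for instance a field of meromorphic functions on a connected domain) there are $n-1$ Liouvillian elements $H_1,\dots,H_{n-1}$ that are first integrals, $\sum_{i=1}^n P_i\,\partial_iH_j=0$, and functionally independent, i.e. the gradients $(\partial_1H_j,\dots,\partial_nH_j)$, $1\le j\le n-1$, are linearly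 independent over $M$. Then the system has a Darboux Jacobian multiplier: there are relatively prime polynomials $g,h\in\mathbb C[x]$ with $h\neq0$, finitely many irreducible, pairwise non-associated polynomials $f_1,\dots,f_r\in\mathbb C[x]$ and exponents $l_1,\dots,l_r\in\mathbb C$ such that, on some open set $U\subset\mathbb C^n$ whose complement has Lebesgue measure zero, on which $h$ and the $f_i$ do not vanish and the $\log f_i$ have continuous branches, the function $$J=\exp\Big(\frac gh\Big)\,f_1^{l_1}\cdots f_r^{l_r},\qquad f_i^{l_i}=\exp(l_i\log f_i),$$ is smooth and satisfies $$\partial_1(JP_1)+\dots+\partial_n(JP_n)=0 .$$ -/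

import Mathlib

/-!
# Liouvillian integrability and Darboux Jacobian multipliers

A polynomial system `ẋ = P(x)` on `ℂⁿ` is given by `P : Fin n → MvPolynomial (Fin n) ℂ`.
-/

universe u

namespace LiouvilleDarboux

open MeasureTheory

open scoped ContDiff IntermediateField

/-- The field `ℂ(x)` of rational functions in `x = (x₁, …, xₙ)`. -/
abbrev RatField (n : ℕ) : Type := FractionRing (MvPolynomial (Fin n) ℂ)

/-- The structure of a differential field extension of `(ℂ(x), ∂₁, …, ∂ₙ)` on a field extension `M`
of `ℂ(x)`: commuting derivations `δ₁, …, δₙ` of `M`, that is, additive maps with the Leibniz rule, which extend the partial derivatives. (A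
derivation of `ℂ(x)` is determined by its values on polynomials, through the quotient rule; it
vanishes on `ℂ` because the partial derivatives do.) -/
structure DiffExtension (n : ℕ) (M : Type*) [Field M] [Algebra (RatField n) M] where
  /-- The derivations `δᵢ`. -/
  δ : Fin n → M →+ M
  leibniz : ∀ (i : Fin n) (a b : M), δ i (a * b) = a * δ i b + b * δ i a
  commute : ∀ (i j : Fin n) (a : M), δ i (δ j a) = δ j (δ i a)
  extend : ∀ (i : Fin n) (p : MvPolynomial (Fin n) ℂ),
    δ i (algebraMap (RatField n) M (algebraMap _ (RatField n) p)) =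
      algebraMap (RatField n) M (algebraMap _ (RatField n) (MvPolynomial.pderiv i p))

section Extension

variable {n : ℕ} {M : Type*} [Field M] [Algebra (RatField n) M]

/-- One step `E ⊆ F` of a Liouvillian tower: `F` is a finite extension of `E`, or `F = E(t)` with
`t` transcendental over `E` and either all `δᵢ t / t ∈ E`, or all `δᵢ t ∈ E`. -/
def IsLiouvillianStep (𝒟 : DiffExtension n M) (E F : IntermediateField (RatField n) M) : Prop :=
  ∃ h : E ≤ F,
    FiniteDimensional E (IntermediateField.extendScalars h) ∨
    (∃ t : M, Transcendental E t ∧ IntermediateField.extendScalars h = E⟮t⟯ ∧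
      ∀ i, 𝒟.δ i t / t ∈ E) ∨
    (∃ t : M, Transcendental E t ∧ IntermediateField.extendScalars h = E⟮t⟯ ∧
      ∀ i, 𝒟.δ i t ∈ E)

/-- An intermediate field `L` of `M / ℂ(x)` is a Liouvillian extension of `ℂ(x)` if there is a tower
`ℂ(x) = K₀ ⊆ K₁ ⊆ … ⊆ K_r = L` of differential fields with Liouvillian steps. -/
def IsLiouvillianExtension (𝒟 : DiffExtension n M) (L : IntermediateField (RatField n) M) : Prop :=
  ∃ (r : ℕ) (K : ℕ → IntermediateField (RatField n) M),
    K 0 = ⊥ ∧ K r = L ∧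
    (∀ k ≤ r, ∀ i, ∀ a ∈ K k, 𝒟.δ i a ∈ K k) ∧
    ∀ k < r, IsLiouvillianStep 𝒟 (K k) (K (k + 1))

/-- `a` is Liouvillian if it lies in a Liouvillian extension of `ℂ(x)`. -/
def IsLiouvillian (𝒟 : DiffExtension n M) (a : M) : Prop :=
  ∃ L : IntermediateField (RatField n) M, IsLiouvillianExtension 𝒟 L ∧ a ∈ L

/-- `H` is a first integral of `ẋ = P(x)`: `P₁ ∂₁H + … + Pₙ ∂ₙH = 0`. -/
def IsFirstIntegral (𝒟 : DiffExtension n M) (P : Fin n → MvPolynomial (Fin n) ℂ) (H : M) : Prop :=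
  ∑ i, algebraMap (RatField n) M (algebraMap _ (RatField n) (P i)) * 𝒟.δ i H = 0

/-- Functional independence: the gradients are linearly independent. -/
def FunctionallyIndependent (𝒟 : DiffExtension n M) {m : ℕ} (H : Fin m → M) : Prop :=
  LinearIndependent M (fun j : Fin m => fun i : Fin n => 𝒟.δ i (H j))

end Extension

/-- `ẋ = P(x)` is Liouvillian integrable: in some differential field extension of `ℂ(x)` there are
`n - 1` functionally independent Liouvillian first integrals. -/
def IsLiouvillianIntegrable {n : ℕ} (P : Fin n → MvPolynomial (Fin n) ℂ) : Prop :=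
  ∃ (M : Type u) (_ : Field M) (_ : Algebra (RatField n) M) (𝒟 : DiffExtension n M)
    (H : Fin (n - 1) → M),
    (∀ j, IsLiouvillian 𝒟 (H j) ∧ IsFirstIntegral 𝒟 P (H j)) ∧ FunctionallyIndependent 𝒟 H

/-- `J` is, on the set `U`, a (single-valued) Darboux function
`exp (g / h) * f₁ ^ l₁ * ⋯ * f_r ^ l_r`, with `g`, `h` relatively prime and the `fᵢ` irreducible and
pairwise distinct (up to constant factors); the complex power `fᵢ ^ lᵢ` is `exp (lᵢ * log fᵢ)` for
a continuous branch `ℓᵢ` on `U` of the logarithm of `fᵢ`. -/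
def IsDarbouxFunctionOn {n : ℕ} (J : (Fin n → ℂ) → ℂ) (U : Set (Fin n → ℂ)) : Prop :=
  ∃ (r : ℕ) (g h : MvPolynomial (Fin n) ℂ) (f : Fin r → MvPolynomial (Fin n) ℂ) (l : Fin r → ℂ)
    (ℓ : Fin r → (Fin n → ℂ) → ℂ),
    h ≠ 0 ∧ IsRelPrime g h ∧ (∀ i, Irreducible (f i)) ∧
    (∀ i j, i ≠ j → ¬ Associated (f i) (f j)) ∧
    (∀ x ∈ U, MvPolynomial.eval x h ≠ 0) ∧
    (∀ i, ContinuousOn (ℓ i) U ∧ ∀ x ∈ U, Complex.exp (ℓ i x) = MvPolynomial.eval x (f i)) ∧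
    ∀ x ∈ U, J x = Complex.exp (MvPolynomial.eval x g / MvPolynomial.eval x h) *
      ∏ i, Complex.exp (l i * ℓ i x)

/-- `J` is, on the open set `U`, a Jacobian multiplier of `ẋ = P(x)`: it is smooth and
`∂₁(J P₁) + … + ∂ₙ(J Pₙ) = 0`. -/
def IsJacobianMultiplierOn {n : ℕ} (P : Fin n → MvPolynomial (Fin n) ℂ)
    (J : (Fin n → ℂ) → ℂ) (U : Set (Fin n → ℂ)) : Prop :=
  ContDiffOn ℂ ∞ J U ∧
  ∀ x ∈ U, ∑ i, fderiv ℂ (fun y => J y * MvPolynomial.eval y (P i)) x (Pi.single i 1) = 0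

/-- `ẋ = P(x)` has a Darboux Jacobian multiplier, defined on an open subset of `ℂⁿ` of full
Lebesgue measure. -/
def HasDarbouxJacobianMultiplier {n : ℕ} (P : Fin n → MvPolynomial (Fin n) ℂ) : Prop :=
  ∃ (U : Set (Fin n → ℂ)) (J : (Fin n → ℂ) → ℂ), IsOpen U ∧ volume Uᶜ = 0 ∧
    IsDarbouxFunctionOn J U ∧ IsJacobianMultiplierOn P J U

end LiouvilleDarboux

/-! A multiplier `J` is a primitive of a closed form: with `α = dJ / J`, the equation reads `∑ Pᵢ αᵢ
= -div P`, and `J` is a Darboux function when `α = d(g/h) + ∑ lᵢ dfᵢ / fᵢ`. So it suffices to find a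
closed rational form with this contraction, since closed rational forms are automatically
logarithmic (`mem_logForms_of_closed`).

The first integrals do produce such a form, through a maximal minor of their Jacobian matrix, but
only over the top of a Liouvillian tower. What can be carried down the tower is a weaker object,
`IsTri`: a flat connection `∇ⱼ = dⱼ + Bⱼ` with triangular matrices and a vector `h` such that `∑ Pⱼ
∇ⱼ h = 0` and the `∇ⱼ h` with `j ≠ k₀` are independent. Here `P k₀ ≠ 0`, and omitting `k₀` accounts
for the one relation given by `P`. Independent first integrals are the case `B = 0`
(`isTri_of_linearIndependent`). Conversely any such object yields a closed `α` over the same field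
(`IsTri.exists_form`): a nonzero minor of `(∇ⱼ h)`, chosen of maximal rank weight, satisfies a
scalar equation along `P` in which only diagonal entries of `B` occur, and these are closed forms.

The heart is the descent from the algebraic closure of `S(t)` to the algebraically closed
differential field `S`, where `t` is a primitive or an exponential (`HasTri.descend`). The finitely
many entries are expanded as Puiseux series at a pole of a primitive or at the zero of an
exponential (`exists_laurent_embedding`). Over Laurent series, entries joining diagonal places with
different irregular parts are gauged away (`IsTri.exists_split`); each remaining block is twisted by
a closed form read off from `h`, which makes the diagonal regular (`IsTri.exists_regular`). The
connection then preserves a lattice, and a sufficiently deep truncation of that lattice is a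
finite-dimensional connection over the coefficient field (`IsTri.truncate`).

At the bottom the form is algebraic over the rational functions. Averaging over conjugates
(`exists_average`) makes it rational without changing closedness or the contraction with `P`.
Integrating it one variable at a time, with constant residues forced by closedness, gives the
logarithmic normal form. Finally, rotating each `fᵢ` so that it avoids the branch cut almost
everywhere turns the form into a function on an open set of full measure
(`hasDarbouxJacobianMultiplier_of_form`). -/

namespace LiouvilleDarboux

/-! ### Derivations and algebraic extensions. -/

section Derivations

/-- The derivations of a field. -/
abbrev Der (K : Type*) [Field K] : Type _ := Derivation ℤ K K

/-- The derivation with a given underlying additive map. -/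
def Der.ofAddMonoidHom {K : Type*} [Field K] (f : K →+ K)
    (h : ∀ a b, f (a * b) = a * f b + b * f a) : Der K :=
  Derivation.mk' f.toIntLinearMap h

theorem Der.ofAddMonoidHom_apply {K : Type*} [Field K] (f : K →+ K)
    (h : ∀ a b, f (a * b) = a * f b + b * f a) (x : K) : Der.ofAddMonoidHom f h x = f x := rfl

theorem Der.leibniz {K : Type*} [Field K] (D : Der K) (a b : K) :
    D (a * b) = a * D b + b * D a := Derivation.leibniz D a b

/-- Two derivations which are compatible on a subfield along a homomorphism of fields are compatible
at the elements which are algebraic over the subfield. -/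
theorem map_derivation_of_isAlgebraic {A T E : Type*} [Field A] [Field T] [Field E] [Algebra A T]
    [CharZero A] (ψ : T →+* E) (d : Der T) (d' : Der E)
    (h : ∀ a : A, d' (ψ (algebraMap A T a)) = ψ (d (algebraMap A T a)))
    {x : T} (hx : IsAlgebraic A x) : d' (ψ x) = ψ (d x) := by
  let _ : Algebra T E := ψ.toAlgebra
  let _ : Algebra A E := (ψ.comp (algebraMap A T)).toAlgebra
  have _ : IsScalarTower A T E := IsScalarTower.of_algebraMap_eq fun _ => rfl
  have hψ : ∀ y, algebraMap T E y = ψ y := fun _ => rfl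
  -- The defect `d' ∘ ψ - ψ ∘ d` vanishes on `A`, hence is an `A`-linear derivation; applied to the
  -- separable minimal polynomial of `x`, it must vanish at `x`.
  let δ : Derivation A T E := Derivation.mk'
    { toFun := fun y => d' (ψ y) - ψ (d y)
      map_add' := fun y z => by simp only [map_add]; ring
      map_smul' := fun a y => by
        simp only [Algebra.smul_def, map_mul, Derivation.leibniz, map_add, h,
          RingHom.id_apply, IsScalarTower.algebraMap_apply A T E, hψ, Algebra.algebraMap_self,
              RingHom.id_apply]
        ring }
    (fun y z => by
      simp only [LinearMap.coe_mk, AddHom.coe_mk, Algebra.smul_def, map_mul, Derivation.leibniz,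
        map_add, hψ, Algebra.algebraMap_self, RingHom.id_apply]
      ring)
  have hx' : IsIntegral A x := hx.isIntegral
  have h0 : δ (Polynomial.aeval x (minpoly A x)) = 0 := by rw [minpoly.aeval, map_zero]
  rw [Derivation.map_aeval, Algebra.smul_def, hψ] at h0
  have hsep : Polynomial.aeval x (Polynomial.derivative (minpoly A x)) ≠ 0 :=
    (minpoly.irreducible hx').separable.aeval_derivative_ne_zero (minpoly.aeval A x)
  have h1 : δ x = 0 :=
    (mul_eq_zero.mp h0).resolve_left fun h2 => hsep (ψ.injective (by rw [h2, map_zero]))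
  exact sub_eq_zero.mp h1

/-- In characteristic zero an algebraic extension is formally étale, so its Kähler differentials are
the base change of those of `M`, and a derivation extends linearly. -/
theorem exists_derivation_extension (M Ω : Type*) [Field M] [Field Ω] [Algebra M Ω] [CharZero M]
    [Algebra.IsAlgebraic M Ω] (d : Der M) :
    ∃ d' : Der Ω, ∀ a, d' (algebraMap M Ω a) = algebraMap M Ω (d a) := by
  have _ : Algebra.FormallyEtale M Ω := Algebra.FormallyEtale.of_isSeparable M Ω
  let δ : Derivation ℤ M Ω := (Algebra.linearMap M Ω).compDer d
  let L : KaehlerDifferential ℤ Ω →ₗ[Ω] Ω :=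
    (KaehlerDifferential.isBaseChange_of_formallyEtale ℤ M Ω).lift δ.liftKaehlerDifferential
  refine ⟨L.compDer (KaehlerDifferential.D ℤ Ω), fun a => ?_⟩
  have := (KaehlerDifferential.isBaseChange_of_formallyEtale ℤ M Ω).lift_eq
    δ.liftKaehlerDifferential (KaehlerDifferential.D ℤ M a)
  rw [KaehlerDifferential.map_D, Derivation.liftKaehlerDifferential_comp_D] at this
  exact this

/-- The algebraic closure of a subfield, as a subfield. -/
noncomputable def algClosure {Ω : Type u} [Field Ω] (S : Subfield Ω) : Subfield Ω :=
  (algebraicClosure S Ω).toSubfield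

theorem mem_algClosure {Ω : Type u} [Field Ω] {S : Subfield Ω} {x : Ω} :
    x ∈ algClosure S ↔ IsAlgebraic S x := by
  rw [algClosure, IntermediateField.mem_toSubfield, mem_algebraicClosure_iff]

theorem le_algClosure {Ω : Type u} [Field Ω] (S : Subfield Ω) : S ≤ algClosure S := fun x hx =>
  mem_algClosure.2 (isAlgebraic_algebraMap (⟨x, hx⟩ : S))

theorem IsAlgebraic.of_subfield_le {Ω : Type u} [Field Ω] {S T : Subfield Ω} (h : S ≤ T) {x : Ω}
    (hx : IsAlgebraic S x) : IsAlgebraic T x := by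
  let _ : Algebra S T := (Subfield.inclusion h).toAlgebra
  have _ : IsScalarTower S T Ω := IsScalarTower.of_algebraMap_eq fun _ => rfl
  exact hx.tower_top (L := T)

theorem algClosure_mono {Ω : Type u} [Field Ω] {S T : Subfield Ω} (h : S ≤ T) :
    algClosure S ≤ algClosure T := fun _ hx =>
  mem_algClosure.2 (IsAlgebraic.of_subfield_le h (mem_algClosure.1 hx))

theorem algClosure_idem {Ω : Type u} [Field Ω] {S : Subfield Ω} {x : Ω}
    (hx : IsAlgebraic (algClosure S) x) : x ∈ algClosure S := by
  have h : x ∈ algebraicClosure (algebraicClosure S Ω) Ω :=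
    mem_algebraicClosure_iff.2 hx
  rw [algebraicClosure.algebraicClosure_eq_bot, IntermediateField.mem_bot] at h
  obtain ⟨y, rfl⟩ := h
  exact y.2

/-- A subfield is stable under a family of derivations. -/
def IsStable {Ω : Type u} [Field Ω] {n : ℕ} (d : Fin n → Der Ω) (S : Subfield Ω) : Prop :=
  ∀ i, ∀ x ∈ S, d i x ∈ S

/-- The chain rule: `q` is `p` with `D` applied to its coefficients. -/
theorem exists_derivation_aeval_eq {Ω : Type u} [Field Ω] {S : Subfield Ω} (D : Der Ω) (hS : ∀ x ∈
    S, D x ∈ S)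
    (x : Ω) (p : Polynomial S) : ∃ q : Polynomial S,
      D (Polynomial.aeval x p) =
        Polynomial.aeval x q + Polynomial.aeval x (Polynomial.derivative p) * D x := by
  induction p using Polynomial.induction_on' with
  | add p q hp hq =>
    obtain ⟨p', hp⟩ := hp
    obtain ⟨q', hq⟩ := hq
    refine ⟨p' + q', ?_⟩
    simp only [map_add, hp, hq]
    ring
  | monomial k a =>
    refine ⟨Polynomial.monomial k ⟨D a, hS a a.2⟩, ?_⟩
    have h1 : ∀ b : S, algebraMap S Ω b = b := fun _ => rfl
    simp only [Polynomial.aeval_monomial, Polynomial.derivative_monomial, Derivation.leibniz,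
      Derivation.leibniz_pow, smul_eq_mul, nsmul_eq_mul, h1]
    push_cast
    ring

/-- Differentiating the minimal polynomial gives a linear equation for `D x`, whose leading
coefficient is nonzero by separability. -/
theorem derivation_mem_of_isAlgebraic {Ω : Type u} [Field Ω] [CharZero Ω] {S T : Subfield Ω} (D :
    Der Ω)
    (hS : ∀ x ∈ S, D x ∈ S) (hST : S ≤ T) {x : Ω} (hxT : x ∈ T) (hx : IsAlgebraic S x) :
    D x ∈ T := by
  have hx' : IsIntegral S x := hx.isIntegral
  have hsep : Polynomial.aeval x (Polynomial.derivative (minpoly S x)) ≠ 0 :=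
    (minpoly.irreducible hx').separable.aeval_derivative_ne_zero (minpoly.aeval S x)
  obtain ⟨q, hq⟩ := exists_derivation_aeval_eq D hS x (minpoly S x)
  rw [minpoly.aeval, map_zero] at hq
  have hT : ∀ p : Polynomial S, Polynomial.aeval x p ∈ T := fun p => by
    rw [Polynomial.aeval_eq_sum_range]
    exact sum_mem fun i _ => by
      rw [Algebra.smul_def]
      exact mul_mem (hST (p.coeff i).2) (pow_mem hxT i)
  have : D x = -Polynomial.aeval x q /
      Polynomial.aeval x (Polynomial.derivative (minpoly S x)) := by
    rw [eq_div_iff hsep]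
    linear_combination -hq
  rw [this]
  exact div_mem (neg_mem (hT _)) (hT _)

theorem IsStable.algClosure {Ω : Type u} [Field Ω] [CharZero Ω] {n : ℕ}
    {d : Fin n → Der Ω} {S : Subfield Ω} (hS : IsStable d S) : IsStable d (algClosure S) :=
  fun i _ hx => derivation_mem_of_isAlgebraic (d i) (hS i) (le_algClosure S) hx
    (mem_algClosure.1 hx)

end Derivations

/-! ### Derivations of Laurent series and irregular rank one connections. -/

section Laurent

open HahnSeries

open scoped LaurentSeries

variable {F : Type u} [Field F]

/-- The map `∑ aₖ sᵏ ↦ ∑ (d aₖ + k c aₖ) sᵏ` of the field of Laurent series. -/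
noncomputable def coeffDeriv (d : Der F) (c : F) : F⸨X⸩ →+ F⸨X⸩ where
  toFun := fun x =>
    { coeff := fun k => d (x.coeff k) + k * c * x.coeff k
      isPWO_support' := x.isPWO_support.mono fun k hk hx => hk (by
        show d _ + _ = 0
        rw [hx, map_zero, mul_zero, add_zero]) }
  map_zero' := by
    ext k
    simp only [coeff_zero, map_zero, mul_zero, add_zero]
  map_add' := fun x y => by
    ext k
    simp only [coeff_add, map_add]
    ring

theorem coeff_coeffDeriv (d : Der F) (c : F) (x : F⸨X⸩) (k : ℤ) :
    (coeffDeriv d c x).coeff k = d (x.coeff k) + k * c * x.coeff k := rfl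

theorem coeffDeriv_mul (d : Der F) (c : F) (x y : F⸨X⸩) :
    coeffDeriv d c (x * y) = x * coeffDeriv d c y + y * coeffDeriv d c x := by
  ext k
  have hx : ∀ z : F⸨X⸩, (coeffDeriv d c z).support ⊆ z.support := fun z k hk hx => hk (by
    rw [coeff_coeffDeriv, hx, map_zero, mul_zero, add_zero])
  rw [coeff_add, coeff_mul_right' y.isPWO_support (hx y),
    mul_comm y, coeff_mul_left' x.isPWO_support (hx x)]
  simp only [coeff_coeffDeriv, coeff_mul, map_sum, Finset.mul_sum, ← Finset.sum_add_distrib]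
  refine Finset.sum_congr rfl fun ij hij => ?_
  rw [Finset.mem_antidiagonal] at hij
  rw [← hij.2.2, Derivation.leibniz, smul_eq_mul, smul_eq_mul]
  push_cast
  ring

/-- The derivation `∑ aₖ sᵏ ↦ ∑ (d aₖ) sᵏ + k γ aₖ s ^ (k + e)` of the field of Laurent series. -/
noncomputable def laurentDeriv (d : Der F) (γ : F) (e : ℕ) : Der F⸨X⸩ :=
  Der.ofAddMonoidHom
    ((coeffDeriv d 0) + (AddMonoidHom.mulLeft (single (e : ℤ) γ)).comp (coeffDeriv 0 1))
    (fun x y => by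
      simp only [AddMonoidHom.add_apply, AddMonoidHom.comp_apply, AddMonoidHom.coe_mulLeft,
        coeffDeriv_mul]
      ring)

theorem coeff_laurentDeriv (d : Der F) (γ : F) (e : ℕ) (x : F⸨X⸩) (k : ℤ) :
    (laurentDeriv d γ e x).coeff k = d (x.coeff k) + (k - e : ℤ) * γ * x.coeff (k - e) := by
  simp only [laurentDeriv, Der.ofAddMonoidHom_apply, AddMonoidHom.add_apply,
    AddMonoidHom.comp_apply, AddMonoidHom.coe_mulLeft, coeff_add,
    coeff_coeffDeriv, coeff_single_mul, Derivation.zero_apply]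
  ring

theorem laurentDeriv_C (d : Der F) (γ : F) (e : ℕ) (a : F) :
    laurentDeriv d γ e (C a) = C (d a) := by
  ext k
  rw [coeff_laurentDeriv, C_apply, C_apply, coeff_single, coeff_single, coeff_single]
  rcases eq_or_ne (k - e) 0 with h | h
  · rw [h]; split_ifs <;> simp
  · rw [if_neg h]; split_ifs <;> simp

/-- With `θ = s d/ds`, the operators are `dᵢ + γᵢ s ^ e θ`. The parts in `s ^ e θ` commute with each
other, so the commutator reduces to `[d₁, d₂]` and `(d₁ γ₂ - d₂ γ₁) s ^ e θ`. -/
theorem laurentDeriv_comm {d₁ d₂ : Der F} {γ₁ γ₂ : F} (e : ℕ)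
    (hd : ∀ a, d₁ (d₂ a) = d₂ (d₁ a)) (hγ : d₁ γ₂ = d₂ γ₁) (x : F⸨X⸩) :
    laurentDeriv d₁ γ₁ e (laurentDeriv d₂ γ₂ e x) =
      laurentDeriv d₂ γ₂ e (laurentDeriv d₁ γ₁ e x) := by
  ext k
  simp only [coeff_laurentDeriv, map_add, Derivation.leibniz, smul_eq_mul, Derivation.map_intCast,
    hd, hγ]
  ring

/-- The Laurent series all of whose terms have degree at least `k`. -/
def OrdGE (k : ℤ) (x : F⸨X⸩) : Prop := ∀ j < k, x.coeff j = 0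

theorem OrdGE.mono {k l : ℤ} {x : F⸨X⸩} (h : OrdGE k x) (hl : l ≤ k) : OrdGE l x :=
  fun j hj => h j (hj.trans_le hl)

theorem ordGE_zero (k : ℤ) : OrdGE k (0 : F⸨X⸩) := fun _ _ => rfl

theorem OrdGE.add {k : ℤ} {x y : F⸨X⸩} (hx : OrdGE k x) (hy : OrdGE k y) : OrdGE k (x + y) :=
  fun j hj => by rw [coeff_add, hx j hj, hy j hj, add_zero]

theorem OrdGE.neg {k : ℤ} {x : F⸨X⸩} (hx : OrdGE k x) : OrdGE k (-x) :=
  fun j hj => by rw [coeff_neg, hx j hj, neg_zero]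

theorem OrdGE.sub {k : ℤ} {x y : F⸨X⸩} (hx : OrdGE k x) (hy : OrdGE k y) : OrdGE k (x - y) :=
  fun j hj => by rw [coeff_sub, hx j hj, hy j hj, sub_zero]

theorem OrdGE.sum {ι : Type*} {k : ℤ} {s : Finset ι} {f : ι → F⸨X⸩} (h : ∀ i ∈ s, OrdGE k (f i)) :
    OrdGE k (∑ i ∈ s, f i) := fun j hj => by
  rw [coeff_sum]
  exact Finset.sum_eq_zero fun i hi => h i hi j hj

theorem OrdGE.mul {k l : ℤ} {x y : F⸨X⸩} (hx : OrdGE k x) (hy : OrdGE l y) :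
    OrdGE (k + l) (x * y) := fun j hj => by
  rw [coeff_mul]
  refine Finset.sum_eq_zero fun ij hij => ?_
  rw [Finset.mem_antidiagonal] at hij
  rcases lt_or_ge ij.1 k with h | h
  · rw [hx _ h, zero_mul]
  · rw [hy _ (by linarith [hij.2.2]), mul_zero]

theorem OrdGE.laurentDeriv {d : Der F} {γ : F} {e : ℕ} {k : ℤ} {x : F⸨X⸩}
    (hx : OrdGE k x) : OrdGE k (laurentDeriv d γ e x) := fun j hj => by
  rw [coeff_laurentDeriv, hx j hj, hx (j - e) (by omega), map_zero, mul_zero, add_zero]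

theorem ordGE_C (a : F) : OrdGE 0 (C a : F⸨X⸩) := fun j hj => by
  rw [C_apply, coeff_single_of_ne hj.ne]

theorem ordGE_single (k : ℤ) (a : F) : OrdGE k (single k a : F⸨X⸩) := fun j hj => by
  rw [coeff_single_of_ne hj.ne]

theorem exists_ordGE (x : F⸨X⸩) : ∃ k, OrdGE k x :=
  ⟨x.order, fun _ hj => coeff_eq_zero_of_lt_order hj⟩

theorem ordGE_order (x : F⸨X⸩) : OrdGE x.order x := fun _ hj => coeff_eq_zero_of_lt_order hj

theorem exists_ordGE_forall {ι : Type*} [Finite ι] (f : ι → F⸨X⸩) :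
    ∃ k ≤ 0, ∀ i, OrdGE k (f i) := by
  cases nonempty_fintype ι
  choose k hk using fun i => exists_ordGE (f i)
  refine ⟨-∑ i, |k i|, neg_nonpos.2 (Finset.sum_nonneg fun i _ => abs_nonneg _), fun i =>
    (hk i).mono ?_⟩
  have := Finset.single_le_sum (f := fun i => |k i|) (fun i _ => abs_nonneg _) (Finset.mem_univ i)
  linarith [neg_abs_le (k i)]

theorem ordGE_inv {x : F⸨X⸩} (hx : x ≠ 0) : OrdGE (-x.order) x⁻¹ := by
  have h : x⁻¹.order = -x.order := by
    have := order_mul hx (inv_ne_zero hx)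
    rw [mul_inv_cancel₀ hx, order_one] at this
    linarith
  rw [← h]
  exact ordGE_order _

/-- The logarithmic derivative of a Laurent series is regular. -/
theorem ordGE_logDeriv (d : Der F) (γ : F) (e : ℕ) {x : F⸨X⸩} (hx : x ≠ 0) :
    OrdGE 0 (LiouvilleDarboux.laurentDeriv d γ e x / x) := by
  have := (ordGE_order x).laurentDeriv (d := d) (γ := γ) (e := e) |>.mul (ordGE_inv hx)
  rwa [add_neg_cancel, ← div_eq_mul_inv] at this

theorem order_neg_of_not_ordGE {x : F⸨X⸩} (hx : ¬ OrdGE 0 x) : x ≠ 0 ∧ x.order < 0 := by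
  refine ⟨?_, ?_⟩
  · rintro rfl
    exact hx (ordGE_zero 0)
  · by_contra! h
    exact hx ((ordGE_order x).mono h)

/-- `1 - U` is surjective if the additive operator `U` raises the order. -/
theorem exists_sub_eq_of_raising (U : F⸨X⸩ →+ F⸨X⸩)
    (hU : ∀ k x, OrdGE k x → OrdGE (k + 1) (U x)) (y : F⸨X⸩) : ∃ x, x - U x = y := by
  obtain ⟨c, hc⟩ := exists_ordGE y
  have hpow : ∀ j : ℕ, OrdGE (c + j) ((U^[j]) y) := fun j => by
    induction j with
    | zero => simpa using hc
    | succ j ih =>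
      rw [Function.iterate_succ_apply']
      have := hU _ _ ih
      push_cast
      rwa [← add_assoc]
  -- The solution is the Neumann series `∑ Uʲ y`. Only its first `N k` terms can contribute to the
  -- coefficient of degree `k`, so it is assembled coefficientwise.
  let S : ℕ → F⸨X⸩ := fun N => ∑ j ∈ Finset.range N, (U^[j]) y
  have hS : ∀ N M : ℕ, N ≤ M → OrdGE (c + N) (S M - S N) := fun N M h => by
    rw [← Finset.sum_Ico_eq_sub _ h]
    exact OrdGE.sum fun j hj => (hpow j).mono (by have := (Finset.mem_Ico.1 hj).1; omega)
  let N : ℤ → ℕ := fun k => (k - c + 1).toNat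
  let x : F⸨X⸩ := HahnSeries.ofSuppBddBelow (fun k => (S (N k)).coeff k) ⟨c, fun k hk => by
    by_contra! h
    refine hk ?_
    have : N k = 0 := by simp only [N]; omega
    simp only [this, S, Finset.range_zero, Finset.sum_empty, coeff_zero]⟩
  have hx : ∀ M : ℕ, OrdGE (c + M) (x - S M) := fun M k hk => by
    have h1 : N k ≤ M := by simp only [N]; omega
    have h2 := hS _ _ h1 k (by simp only [N]; omega)
    rw [coeff_sub] at h2 ⊢
    have : x.coeff k = (S (N k)).coeff k := rfl
    rw [this]
    linear_combination -h2
  refine ⟨x, ?_⟩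
  ext k
  have h3 : OrdGE (c + N k) (x - U x - (S (N k) - U (S (N k)))) := by
    have h4 := (hx (N k)).sub ((hU _ _ (hx (N k))).mono (by omega))
    rw [map_sub] at h4
    convert h4 using 1
    ring
  have h5 : S (N k) - U (S (N k)) = y - (U^[N k]) y := by
    simp only [S]
    rw [map_sum, ← Finset.sum_sub_distrib]
    simp only [← Function.iterate_succ_apply' U]
    rw [Finset.sum_range_sub']
    rfl
  have h6 := h3 k (by simp only [N]; omega)
  have h7 := hpow (N k) k (by simp only [N]; omega)
  rw [h5] at h6
  simp only [HahnSeries.coeff_sub] at h6 ⊢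
  rw [h7] at h6
  linear_combination h6

/-- A fixed point of an order-raising map has order larger than every integer. -/
theorem eq_zero_of_sub_eq_zero_of_raising (U : F⸨X⸩ → F⸨X⸩)
    (hU : ∀ k x, OrdGE k x → OrdGE (k + 1) (U x)) {x : F⸨X⸩} (hx : x = U x) : x = 0 := by
  obtain ⟨c, hc⟩ := exists_ordGE x
  have : ∀ j : ℕ, OrdGE (c + j) x := fun j => by
    induction j with
    | zero => simpa using hc
    | succ j ih =>
      rw [hx]
      have := hU _ _ ih
      push_cast
      rwa [← add_assoc]
  ext k
  exact this (k - c + 1).toNat k (by omega)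

variable {n : ℕ} {d : Fin n → Der F} {γ : Fin n → F} {e : ℕ}

/-- Closed forms are exact for a rank one connection with an irregular singularity. -/
theorem exists_primitive_of_irregular
    (hcomm : ∀ i j x, laurentDeriv (d i) (γ i) e (laurentDeriv (d j) (γ j) e x) =
      laurentDeriv (d j) (γ j) e (laurentDeriv (d i) (γ i) e x))
    {η φ : Fin n → F⸨X⸩}
    (hη : ∀ i j, laurentDeriv (d i) (γ i) e (η j) = laurentDeriv (d j) (γ j) e (η i))
    (hirr : ∃ i, ¬ OrdGE 0 (η i))
    (hφ : ∀ i j, laurentDeriv (d i) (γ i) e (φ j) + η i * φ j =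
      laurentDeriv (d j) (γ j) e (φ i) + η j * φ i) :
    ∃ G, ∀ i, φ i = laurentDeriv (d i) (γ i) e G + η i * G := by
  obtain ⟨i, hi⟩ := hirr
  obtain ⟨hi0, hi1⟩ := order_neg_of_not_ordGE hi
  let D : Fin n → Der F⸨X⸩ := fun i => laurentDeriv (d i) (γ i) e
  -- In a direction where `η i` has a pole, division by `η i` raises the order while the derivation
  -- does not lower it. The equation `D G + η G = φ` then has exactly one solution, by iteration.
  let U : F⸨X⸩ →+ F⸨X⸩ :=
    { toFun := fun x => -((η i)⁻¹ * D i x)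
      map_zero' := by simp
      map_add' := fun x y => by simp only [map_add]; ring }
  have hU : ∀ k x, OrdGE k x → OrdGE (k + 1) (U x) := fun k x hx =>
    (((ordGE_inv hi0).mul hx.laurentDeriv).mono (by omega)).neg
  obtain ⟨G, hG⟩ := exists_sub_eq_of_raising U hU ((η i)⁻¹ * φ i)
  have hG' : D i G + η i * G = φ i := by
    have : G - -((η i)⁻¹ * D i G) = (η i)⁻¹ * φ i := hG
    field_simp at this
    linear_combination this
  refine ⟨G, fun j => ?_⟩
  -- The other components follow by uniqueness: by flatness, the error in direction `j` is a
  -- horizontal element in direction `i`.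
  have key : ∀ x, D i x + η i * x = 0 → x = 0 := fun x hx =>
    eq_zero_of_sub_eq_zero_of_raising U hU (by
      show x = -((η i)⁻¹ * D i x)
      field_simp
      linear_combination hx)
  rw [← sub_eq_zero]
  refine key _ ?_
  have h1 := congrArg (D j) hG'
  have h2 : D i (D j G) = D j (D i G) := hcomm i j G
  have h3 : D i (η j) = D j (η i) := hη i j
  have h4 : D i (φ j) + η i * φ j = D j (φ i) + η j * φ i := hφ i j
  change D i (φ j - (D j G + η j * G)) + _ = 0
  simp only [map_sub, map_add, Derivation.leibniz, smul_eq_mul] at h1 ⊢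
  linear_combination h4 - h1 - h2 - G * h3 - η j * hG'

end Laurent

/-! ### Puiseux's theorem by Weierstrass preparation and the Newton polygon. -/

section Puiseux

open HahnSeries

open scoped LaurentSeries

variable {F : Type u} [Field F]

/-- The substitution `s ↦ s ^ m` in Laurent series. -/
noncomputable def expandHom (F : Type u) [Field F] (m : ℕ) (hm : 0 < m) : F⸨X⸩ →+* F⸨X⸩ :=
  embDomainRingHom (AddMonoidHom.mulLeft (m : ℤ))
    (mul_right_injective₀ (by exact_mod_cast hm.ne'))
    (fun _ _ => mul_le_mul_iff_right₀ (by exact_mod_cast hm))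

theorem coeff_expandHom_mul {m : ℕ} (hm : 0 < m) (x : F⸨X⸩) (k : ℤ) :
    (expandHom F m hm x).coeff (m * k) = x.coeff k :=
  embDomain_coeff

theorem coeff_expandHom_of_not_dvd {m : ℕ} (hm : 0 < m) (x : F⸨X⸩) {k : ℤ} (hk : ¬ (m : ℤ) ∣ k) :
    (expandHom F m hm x).coeff k = 0 := by
  refine embDomain_of_notMem_range ?_
  rintro ⟨j, rfl⟩
  exact hk (Dvd.intro _ rfl)

theorem expandHom_single {m : ℕ} (hm : 0 < m) (k : ℤ) (a : F) :
    expandHom F m hm (single k a) = single (m * k) a := embDomain_single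

theorem expandHom_C {m : ℕ} (hm : 0 < m) (a : F) : expandHom F m hm (C a) = C a := by
  have : (C a : F⸨X⸩) = single 0 a := rfl
  rw [this, expandHom_single, mul_zero]

theorem expandHom_expandHom {m l : ℕ} (hm : 0 < m) (hl : 0 < l) (x : F⸨X⸩) :
    expandHom F l hl (expandHom F m hm x) = expandHom F (l * m) (mul_pos hl hm) x := by
  ext k
  by_cases h : ((l * m : ℕ) : ℤ) ∣ k
  · obtain ⟨j, rfl⟩ := h
    rw [coeff_expandHom_mul]
    push_cast
    rw [mul_assoc, coeff_expandHom_mul, coeff_expandHom_mul]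
  · rw [coeff_expandHom_of_not_dvd _ _ h]
    by_cases h' : (l : ℤ) ∣ k
    · obtain ⟨j, rfl⟩ := h'
      rw [coeff_expandHom_mul, coeff_expandHom_of_not_dvd]
      rintro ⟨i, rfl⟩
      exact h ⟨i, by push_cast; ring⟩
    · rw [coeff_expandHom_of_not_dvd _ _ h']

open Polynomial in
/-- A Weierstrass factor of a monic polynomial over a power series ring divides it. -/
theorem exists_dvd_of_coeff {q : Polynomial (PowerSeries F)} {e : ℕ}
    (h0 : ∀ i < e, PowerSeries.constantCoeff (q.coeff i) = 0)
    (he : PowerSeries.constantCoeff (q.coeff e) ≠ 0) :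
    ∃ f g : Polynomial (PowerSeries F), f.Monic ∧ f.natDegree = e ∧ q = f * g := by
  have hI : IsAdicComplete (IsLocalRing.maximalIdeal (PowerSeries F)) (PowerSeries F) := by
    rw [PowerSeries.maximalIdeal_eq_span_X]
    infer_instance
  have hres : ∀ a : PowerSeries F, IsLocalRing.residue _ a = 0 ↔ PowerSeries.constantCoeff a = 0 :=
      by
    intro a
    rw [IsLocalRing.residue_eq_zero_iff, PowerSeries.maximalIdeal_eq_span_X,
      Ideal.mem_span_singleton, PowerSeries.X_dvd_iff]
  have hord : ((q : PowerSeries (PowerSeries F)).map (IsLocalRing.residue _)).order = e := by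
    rw [PowerSeries.order_eq_nat]
    constructor
    · rwa [PowerSeries.coeff_map, Ne, hres, Polynomial.coeff_coe]
    · intro i hi
      rw [PowerSeries.coeff_map, hres, Polynomial.coeff_coe]
      exact h0 i hi
  have hne : (q : PowerSeries (PowerSeries F)).map (IsLocalRing.residue _) ≠ 0 := by
    intro h
    rw [h, PowerSeries.order_zero] at hord
    exact absurd hord (by simp)
  obtain ⟨f, h, H⟩ := PowerSeries.exists_isWeierstrassFactorization hne
  have hmonic := H.isDistinguishedAt.monic
  have hdeg : f.natDegree = e := by
    rw [H.natDegree_eq_toNat_order_map, hord, ENat.toNat_natCast]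
  refine ⟨f, q /ₘ f, hmonic, hdeg, ?_⟩
  -- Dividing `q` by the Weierstrass polynomial `f` within polynomials leaves a remainder which is
  -- also a power series multiple of `f`; uniqueness in Weierstrass division makes it zero.
  have h1 := modByMonic_add_div q f
  have h2 : ((q %ₘ f : Polynomial _) : PowerSeries (PowerSeries F)) =
      (f : PowerSeries (PowerSeries F)) * (h - (q /ₘ f : Polynomial _)) := by
    have := H.eq_mul
    rw [← h1] at this
    push_cast at this
    linear_combination this
  have hD := H.isDistinguishedAt.isWeierstrassDivisorAt'
  have h3 := hD.eq_zero_of_mul_eq (q := h - (q /ₘ f : Polynomial _)) (r := q %ₘ f) ?_ ?_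
  · rw [h3.2, zero_add] at h1
    exact h1.symm
  · have hI' : IsLocalRing.maximalIdeal (PowerSeries F) ≠ ⊤ := Ideal.IsPrime.ne_top inferInstance
    have h4 := congrArg ENat.toNat (a₁ := (f.natDegree : ℕ∞))
      (H.isDistinguishedAt.coe_natDegree_eq_order_map f 1
        (by rwa [PowerSeries.constantCoeff_one, ← Ideal.ne_top_iff_one]) (by simp))
    rw [ENat.toNat_coe] at h4
    rw [← h4, ← Polynomial.degree_eq_natDegree hmonic.ne_zero]
    exact degree_modByMonic_lt _ hmonic
  · exact h2.symm

/-- Roots of polynomials over the Laurent series, as Puiseux series. -/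
def HasPuiseuxRoot (p : Polynomial F⸨X⸩) : Prop :=
  ∃ (m : ℕ) (hm : 0 < m) (y : F⸨X⸩), p.eval₂ (expandHom F m hm) y = 0

/-- Ramification, translation and rescaling are the moves of the Newton polygon algorithm; this
lemma and the next two carry a root back through each of them. -/
theorem HasPuiseuxRoot.of_expand {p : Polynomial F⸨X⸩} {m : ℕ} {hm : 0 < m}
    (h : HasPuiseuxRoot (p.map (expandHom F m hm))) : HasPuiseuxRoot p := by
  obtain ⟨l, hl, y, hy⟩ := h
  refine ⟨l * m, mul_pos hl hm, y, ?_⟩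
  rw [Polynomial.eval₂_map] at hy
  rw [← hy]
  congr 1
  ext1 x
  exact (expandHom_expandHom hm hl x).symm

theorem HasPuiseuxRoot.of_taylor {p : Polynomial F⸨X⸩} {c : F⸨X⸩}
    (h : HasPuiseuxRoot (Polynomial.taylor c p)) : HasPuiseuxRoot p := by
  obtain ⟨l, hl, y, hy⟩ := h
  refine ⟨l, hl, y + expandHom F l hl c, ?_⟩
  rw [Polynomial.taylor_apply, Polynomial.eval₂_comp] at hy
  simpa using hy

theorem HasPuiseuxRoot.of_scaleRoots {p : Polynomial F⸨X⸩} {c : F⸨X⸩} (hc : c ≠ 0)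
    (h : HasPuiseuxRoot (p.scaleRoots c)) : HasPuiseuxRoot p := by
  obtain ⟨l, hl, y, hy⟩ := h
  refine ⟨l, hl, y / expandHom F l hl c, ?_⟩
  have hc' : expandHom F l hl c ≠ 0 := (map_ne_zero _).2 hc
  have h1 := Polynomial.scaleRoots_eval₂_mul (p := p) (expandHom F l hl)
    (y / expandHom F l hl c) c
  rw [mul_div_cancel₀ _ hc', hy] at h1
  exact (mul_eq_zero.1 h1.symm).resolve_left (pow_ne_zero _ hc')

theorem HasPuiseuxRoot.of_dvd {p q : Polynomial F⸨X⸩} (h : HasPuiseuxRoot p) (hpq : p ∣ q) :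
    HasPuiseuxRoot q := by
  obtain ⟨l, hl, y, hy⟩ := h
  exact ⟨l, hl, y, Polynomial.eval₂_eq_zero_of_dvd_of_eval₂_eq_zero _ _ hpq hy⟩

/-- This serves both to remove the second coefficient and to show that a pure power `(X - c)ᴺ`
without second coefficient has `c = 0`. -/
theorem coeff_taylor_natDegree_sub_one {R : Type*} [CommRing R] (p : Polynomial R) (hp : p.Monic)
    (h : 0 < p.natDegree) (c : R) : (Polynomial.taylor c p).coeff (p.natDegree - 1) =
      p.coeff (p.natDegree - 1) + p.natDegree * c := by
  rw [Polynomial.taylor_coeff, Polynomial.eval_eq_sum_range' (n := 2)]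
  · simp only [Finset.sum_range_succ, Finset.sum_range_zero, Polynomial.hasseDeriv_coeff]
    have h1 : 1 + (p.natDegree - 1) = p.natDegree := by omega
    rw [h1, hp.coeff_natDegree]
    have h2 : (p.natDegree).choose (p.natDegree - 1) = p.natDegree := by
      rw [Nat.choose_symm_of_eq_add (b := 1) (by omega), Nat.choose_one_right]
    rw [h2]
    simp
  · exact (Polynomial.natDegree_hasseDeriv_le _ _).trans_lt (by omega)

/-- The reduction step: a monic polynomial over the power series ring whose reduction is not a
power of a linear polynomial has a factor of smaller degree, up to translation. -/
theorem exists_dvd_taylor [IsAlgClosed F] [CharZero F] {q : Polynomial (PowerSeries F)}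
    (hq : q.Monic) (hd : 0 < q.natDegree)
    (h1 : PowerSeries.constantCoeff (q.coeff (q.natDegree - 1)) = 0)
    {i : ℕ} (hi : i < q.natDegree) (h2 : PowerSeries.constantCoeff (q.coeff i) ≠ 0) :
    ∃ (c : F) (f : Polynomial (PowerSeries F)), f.Monic ∧ 0 < f.natDegree ∧
      f.natDegree < q.natDegree ∧ f ∣ Polynomial.taylor (PowerSeries.C c) q := by
  set r := q.map (PowerSeries.constantCoeff (R := F)) with hr
  have hrm : r.Monic := hq.map _
  have hrd : r.natDegree = q.natDegree := hq.natDegree_map _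
  obtain ⟨c, hc⟩ := IsAlgClosed.exists_root r (by
    rw [Polynomial.degree_eq_natDegree hrm.ne_zero, hrd]
    exact_mod_cast hd.ne')
  have hT : (Polynomial.taylor (PowerSeries.C c) q).map (PowerSeries.constantCoeff (R := F)) =
      Polynomial.taylor c r := by
    rw [Polynomial.map_taylor, PowerSeries.constantCoeff_C]
  have hTc : ∀ j, PowerSeries.constantCoeff ((Polynomial.taylor (PowerSeries.C c) q).coeff j) =
      (Polynomial.taylor c r).coeff j := fun j => by rw [← hT, Polynomial.coeff_map]
  -- Otherwise the reduction is `(X - c) ^ N`; its vanishing second coefficient gives `c = 0`,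
  -- against the nonzero coefficient at `i`.
  have hex : ∃ j, j < q.natDegree ∧ (Polynomial.taylor c r).coeff j ≠ 0 := by
    by_contra! hcon
    have hc0 : c = 0 := by
      have := coeff_taylor_natDegree_sub_one r hrm (hrd ▸ hd) c
      rw [hrd, hcon _ (by omega), hr, Polynomial.coeff_map, h1, zero_add] at this
      exact (mul_eq_zero.1 this.symm).resolve_left (by exact_mod_cast hd.ne')
    have := hcon i hi
    rw [hc0, Polynomial.taylor_zero, hr, Polynomial.coeff_map] at this
    exact h2 this
  have hex' : ∃ j, (Polynomial.taylor c r).coeff j ≠ 0 := hex.imp fun _ h => h.2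
  classical
  -- The degree of the factor is the multiplicity of the root `c` of the reduction, which is
  -- positive and smaller than the full degree.
  obtain ⟨f, g, hf, hfd, hfg⟩ := exists_dvd_of_coeff
    (q := Polynomial.taylor (PowerSeries.C c) q) (e := Nat.find hex')
    (fun j hj => by rw [hTc]; exact not_not.1 (Nat.find_min hex' hj))
    (by rw [hTc]; exact Nat.find_spec hex')
  obtain ⟨j, hj1, hj2⟩ := hex
  refine ⟨c, f, hf, ?_, ?_, Dvd.intro g hfg.symm⟩
  · rw [hfd, Nat.find_pos, Polynomial.taylor_coeff_zero, not_not]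
    exact hc
  · rw [hfd]
    exact (Nat.find_min' hex' hj2).trans_lt hj1

theorem ordGE_expandHom {m : ℕ} (hm : 0 < m) {k : ℤ} {x : F⸨X⸩} (hx : OrdGE k x) :
    OrdGE (m * k) (expandHom F m hm x) := by
  intro j hj
  by_cases h : (m : ℤ) ∣ j
  · obtain ⟨i, rfl⟩ := h
    rw [coeff_expandHom_mul]
    exact hx i (lt_of_mul_lt_mul_left hj (by positivity))
  · exact coeff_expandHom_of_not_dvd hm x h

theorem exists_powerSeries {x : F⸨X⸩} (hx : OrdGE 0 x) :
    ∃ a : PowerSeries F, ofPowerSeries ℤ F a = x := by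
  refine ⟨PowerSeries.mk fun k => x.coeff k, ?_⟩
  ext k
  rcases lt_or_ge k 0 with hk | hk
  · rw [hx k hk, PowerSeries.coeff_coe, if_pos hk]
  · lift k to ℕ using hk
    rw [LaurentSeries.coeff_coe_powerSeries, PowerSeries.coeff_mk]

/-- Puiseux's theorem. -/
theorem hasPuiseuxRoot_of_monic [IsAlgClosed F] [CharZero F] (N : ℕ) :
    ∀ p : Polynomial F⸨X⸩, p.Monic → p.natDegree = N → 0 < N → HasPuiseuxRoot p := by
  induction N using Nat.strong_induction_on with
  | _ N ih =>
  intro p hp hpN hN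
  have hch : CharZero F⸨X⸩ := charZero_of_injective_algebraMap (algebraMap F F⸨X⸩).injective
  -- make the second coefficient vanish
  refine HasPuiseuxRoot.of_taylor (c := -p.coeff (N - 1) / N) ?_
  have h1 := coeff_taylor_natDegree_sub_one p hp (hpN ▸ hN) (-p.coeff (N - 1) / N)
  set p' := Polynomial.taylor (-p.coeff (N - 1) / N) p
  have hp' : p'.Monic := by
    rw [Polynomial.Monic, Polynomial.leadingCoeff_taylor, hp.leadingCoeff]
  have hpN' : p'.natDegree = N := by rw [Polynomial.natDegree_taylor, hpN]
  rw [hpN, mul_div_cancel₀ _ (by exact_mod_cast hN.ne'), add_neg_cancel] at h1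
  by_cases hz : ∀ i < N, p'.coeff i = 0
  · refine ⟨1, one_pos, 0, ?_⟩
    rw [Polynomial.eval₂_at_zero, hz 0 hN, map_zero]
  push Not at hz
  classical
  -- The minimal slope `ord / (N - i)` of the Newton polygon. After `s ↦ s ^ (N - i₀)` and scaling
  -- the roots by `s ^ (-u)`, all coefficients become power series and the one at `i₀` becomes a
  -- unit.
  obtain ⟨i₀, hi₀, hmin⟩ := Finset.exists_min_image
    ((Finset.range N).filter fun i => p'.coeff i ≠ 0)
    (fun i => ((p'.coeff i).order : ℚ) / (N - i : ℕ))
    (by obtain ⟨i, hi⟩ := hz; exact ⟨i, by simpa using hi⟩)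
  rw [Finset.mem_filter, Finset.mem_range] at hi₀
  set u := (p'.coeff i₀).order
  have hw : 0 < N - i₀ := by omega
  have hord : ∀ i < N, OrdGE (u * (N - i : ℕ))
      (expandHom F (N - i₀) hw (p'.coeff i)) := fun i hi => by
    by_cases h : p'.coeff i = 0
    · rw [h, map_zero]; exact ordGE_zero _
    · refine (ordGE_expandHom hw (ordGE_order _)).mono ?_
      have h2 := hmin i (by simp [hi, h])
      rw [div_le_div_iff₀ (by exact_mod_cast hw) (by exact_mod_cast (show 0 < N - i by omega))] at h2
      have h3 : u * (N - i : ℕ) ≤ (p'.coeff i).order * (N - i₀ : ℕ) := by exact_mod_cast h2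
      linarith
  refine HasPuiseuxRoot.of_expand (hm := hw) ?_
  refine HasPuiseuxRoot.of_scaleRoots (c := single (-u) 1) (by simp) ?_
  set b := (p'.map (expandHom F (N - i₀) hw)).scaleRoots (single (-u) 1) with hb
  have hbm : b.Monic := (Polynomial.monic_scaleRoots_iff _).2 (hp'.map _)
  have hbN : b.natDegree = N := by
    rw [hb, Polynomial.natDegree_scaleRoots, hp'.natDegree_map, hpN']
  have hbc : ∀ i, b.coeff i =
      single (-u * (N - i : ℕ)) 1 * expandHom F (N - i₀) hw (p'.coeff i) := fun i => by
    rw [hb, Polynomial.coeff_scaleRoots, Polynomial.coeff_map, hp'.natDegree_map, hpN', mul_comm,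
      single_pow, one_pow, nsmul_eq_mul, mul_comm (-u)]
  have hbO : ∀ i, ∃ a : PowerSeries F, ofPowerSeries ℤ F a = b.coeff i := fun i => by
    refine exists_powerSeries ?_
    rcases lt_trichotomy i N with h | h | h
    · rw [hbc]
      exact ((ordGE_single _ _).mul (hord i h)).mono (by rw [neg_mul, neg_add_cancel])
    · rw [h, ← hbN, hbm.coeff_natDegree]
      exact ordGE_C 1
    · rw [Polynomial.coeff_eq_zero_of_natDegree_lt (by omega)]
      exact ordGE_zero _
  have hlift : b ∈ Polynomial.lifts (ofPowerSeries ℤ F) := by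
    rw [Polynomial.lifts_iff_coeff_lifts]
    exact fun i => hbO i
  obtain ⟨q, hqb, hqd, hqm⟩ := Polynomial.lifts_and_natDegree_eq_and_monic hlift hbm
  have hqc : ∀ i, PowerSeries.constantCoeff (q.coeff i) = (b.coeff i).coeff 0 := fun i => by
    rw [← hqb, Polynomial.coeff_map]
    have := LaurentSeries.coeff_coe_powerSeries (q.coeff i) 0
    rw [PowerSeries.coeff_zero_eq_constantCoeff_apply] at this
    exact this.symm
  have hqN : q.natDegree = N := by rw [hqd, hbN]
  obtain ⟨c, f, hf, hf0, hfN, hfq⟩ := exists_dvd_taylor hqm (hqN ▸ hN)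
    (by rw [hqc, hqN, hbc, h1, map_zero, mul_zero, coeff_zero]) (i := i₀) (hqN ▸ hi₀.1) (by
      rw [hqc, hbc, coeff_single_mul, one_mul, zero_sub]
      have : -(-u * (N - i₀ : ℕ)) = ((N - i₀ : ℕ) : ℤ) * u := by ring
      rw [this, coeff_expandHom_mul]
      exact coeff_order_eq_zero.not.2 hi₀.2)
  have hroot : HasPuiseuxRoot (f.map (ofPowerSeries ℤ F)) :=
    ih f.natDegree (hqN ▸ hfN) _ (hf.map _) (hf.natDegree_map _) hf0
  refine HasPuiseuxRoot.of_taylor (c := ofPowerSeries ℤ F (PowerSeries.C c)) ?_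
  refine hroot.of_dvd ?_
  have := Polynomial.map_dvd (ofPowerSeries ℤ F) hfq
  rwa [Polynomial.map_taylor, hqb] at this

theorem hasPuiseuxRoot [IsAlgClosed F] [CharZero F] {p : Polynomial F⸨X⸩} (hp : 0 < p.natDegree) :
    HasPuiseuxRoot p := by
  have hp0 : p ≠ 0 := by
    rintro rfl
    simp at hp
  have h := hasPuiseuxRoot_of_monic _ (p * Polynomial.C p.leadingCoeff⁻¹)
    (Polynomial.monic_mul_leadingCoeff_inv hp0) rfl (by
      rwa [Polynomial.natDegree_mul_leadingCoeff_self_inv])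
  refine h.of_dvd ⟨Polynomial.C p.leadingCoeff, ?_⟩
  rw [mul_assoc, ← Polynomial.C_mul, inv_mul_cancel₀ (Polynomial.leadingCoeff_ne_zero.2 hp0),
    Polynomial.C_1, mul_one]

end Puiseux

/-! ### Laurent expansions of functions algebraic over `S(t)`. -/

section Embedding

open HahnSeries

open scoped LaurentSeries IntermediateField

/-- The restriction of a derivation to a stable subfield. -/
def Der.restrict {Ω : Type u} [Field Ω] (D : Der Ω) (S : Subfield Ω) (h : ∀ x ∈ S, D x ∈ S) :
    Der S :=
  Der.ofAddMonoidHom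
    { toFun := fun x => ⟨D x, h x x.2⟩
      map_zero' := Subtype.ext (map_zero D)
      map_add' := fun x y => Subtype.ext (map_add D (x : Ω) (y : Ω)) }
    (fun x y => Subtype.ext (Der.leibniz D (x : Ω) (y : Ω)))

theorem Der.coe_restrict {Ω : Type u} [Field Ω] (D : Der Ω) (S : Subfield Ω)
    (h : ∀ x ∈ S, D x ∈ S) (x : S) : (D.restrict S h x : Ω) = D x := rfl

theorem isAlgClosed_of_forall_mem {Ω : Type u} [Field Ω] [IsAlgClosed Ω] {S : Subfield Ω}
    (hS : ∀ x : Ω, IsAlgebraic S x → x ∈ S) : IsAlgClosed S := by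
  refine IsAlgClosed.of_exists_root _ fun p hp hirr => ?_
  obtain ⟨x, hx⟩ := IsAlgClosed.exists_aeval_eq_zero Ω p
    (Polynomial.degree_pos_of_irreducible hirr).ne'
  refine ⟨⟨x, hS x ⟨p, hirr.ne_zero, hx⟩⟩, ?_⟩
  apply (algebraMap S Ω).injective
  rw [map_zero]
  refine Eq.trans ?_ hx
  exact (Polynomial.aeval_algebraMap_apply Ω _ p).symm

theorem exists_algHom_of_transcendental {K Ω E : Type*} [Field K] [Field Ω] [Field E] [Algebra K Ω]
    [Algebra K E] {t : Ω} {y : E} (ht : Transcendental K t) (hy : Transcendental K y) :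
    ∃ ψ : K⟮t⟯ →ₐ[K] E, ψ (IntermediateField.AdjoinSimple.gen K t) = y := by
  refine ⟨(IntermediateField.val _).comp
    ((RatFunc.algEquivOfTranscendental t ht).symm.trans
      (RatFunc.algEquivOfTranscendental y hy)).toAlgHom, ?_⟩
  have h1 : RatFunc.algEquivOfTranscendental t ht RatFunc.X =
    IntermediateField.AdjoinSimple.gen K t :=
    Subtype.ext (RatFunc.algEquivOfTranscendental_X t ht)
  have h2 : (RatFunc.algEquivOfTranscendental t ht).symm (IntermediateField.AdjoinSimple.gen K t) =
    RatFunc.X := by rw [← h1, AlgEquiv.symm_apply_apply]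
  simp [h2]

theorem algebraMap_eq_C {F : Type u} [Field F] (a : F) : algebraMap F F⸨X⸩ a = C a := by
  rw [algebraMap_apply', PowerSeries.algebraMap_apply, Algebra.algebraMap_self, RingHom.id_apply,
    ofPowerSeries_C]

/-- Distinct powers of `s ^ k` have disjoint supports, so the coefficients of a polynomial can be
read off from its value. -/
theorem transcendental_single {F : Type u} [Field F] {k : ℤ} (hk : k ≠ 0) :
    Transcendental F (single k 1 : F⸨X⸩) := by
  rw [transcendental_iff]
  intro p hp
  ext j
  have h := congrArg (fun x : F⸨X⸩ => x.coeff (j * k)) hp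
  simp only [Polynomial.aeval_def, Polynomial.eval₂_eq_sum_range, coeff_sum, single_pow, one_pow,
    algebraMap_eq_C, C_apply, single_mul_single, zero_add, mul_one,
    coeff_zero, coeff_single, nsmul_eq_mul] at h
  rw [Polynomial.coeff_zero, ← h]
  by_cases hj : j ∈ Finset.range (p.natDegree + 1)
  · rw [Finset.sum_eq_single_of_mem j hj, if_pos rfl]
    intro i _ hij
    rw [if_neg]
    intro h
    exact hij (by exact_mod_cast (mul_right_cancel₀ hk h).symm)
  · rw [Finset.sum_eq_zero, Polynomial.coeff_eq_zero_of_natDegree_lt (by simpa using hj)]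
    intro i hi
    rw [if_neg]
    intro h
    have : j = i := by exact_mod_cast (mul_right_cancel₀ hk h)
    exact hj (this ▸ hi)

theorem laurentDeriv_single {F : Type u} [Field F] (d : Der F) (γ : F) (e : ℕ) (k : ℤ) :
    laurentDeriv d γ e (single k 1) = single (k + e) (k * γ) := by
  ext j
  have h1 : d ((single k 1 : F⸨X⸩).coeff j) = 0 := by
    rw [coeff_single]
    split_ifs <;> simp
  rw [coeff_laurentDeriv, h1, zero_add]
  by_cases h : j = k + e
  · subst h
    simp
  · rw [coeff_single_of_ne h, coeff_single_of_ne (by omega), mul_zero]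

/-- Derivations which are compatible with a homomorphism on a field of constants and at an element
`t` are compatible on the field generated by `t`. -/
theorem map_derivation_of_mem_adjoin {K Ω E : Type*} [Field K] [Field Ω] [Field E] [Algebra K Ω]
    {t : Ω} (D : Der Ω) (D' : Der E) (ψ : K⟮t⟯ →+* E) (hst : ∀ x ∈ K⟮t⟯, D x ∈ K⟮t⟯)
    (hK : ∀ a : K, D' (ψ (algebraMap K K⟮t⟯ a)) = ψ ⟨D (algebraMap K Ω a), hst _
        (K⟮t⟯.algebraMap_mem a)⟩)
    (ht : D' (ψ (IntermediateField.AdjoinSimple.gen K t)) =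
      ψ ⟨D t, hst _ (IntermediateField.mem_adjoin_simple_self K t)⟩)
    (x : K⟮t⟯) : D' (ψ x) = ψ ⟨D x, hst x x.2⟩ := by
  let R : Der K⟮t⟯ := D.restrict K⟮t⟯.toSubfield hst
  have hR : ∀ y : K⟮t⟯, R y = ⟨D y, hst y y.2⟩ := fun _ => rfl
  rw [← hR]
  obtain ⟨x, hx⟩ := x
  induction hx using IntermediateField.adjoin_induction with
  | mem x hx =>
    obtain rfl : x = t := hx
    exact ht
  | algebraMap a => exact hK a
  | add x y hx hy h1 h2 =>
    have : (⟨x + y, add_mem hx hy⟩ : K⟮t⟯) = ⟨x, hx⟩ + ⟨y, hy⟩ := rfl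
    rw [this, map_add, map_add, map_add, h1, h2, map_add]
  | inv x hx h1 =>
    have : (⟨x⁻¹, inv_mem hx⟩ : K⟮t⟯) = (⟨x, hx⟩ : K⟮t⟯)⁻¹ := rfl
    rw [this, map_inv₀, Derivation.leibniz_inv, Derivation.leibniz_inv, h1]
    simp only [smul_eq_mul, map_mul, map_neg, map_pow, map_inv₀]
  | mul x y hx hy h1 h2 =>
    have : (⟨x * y, mul_mem hx hy⟩ : K⟮t⟯) = ⟨x, hx⟩ * ⟨y, hy⟩ := rfl
    rw [this, map_mul, Der.leibniz, Der.leibniz, h1, h2]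
    simp

theorem derivation_mem_adjoin {K Ω : Type*} [Field K] [Field Ω] [Algebra K Ω]
    {t : Ω} (D : Der Ω) (hK : ∀ a : K, D (algebraMap K Ω a) ∈ K⟮t⟯) (ht : D t ∈ K⟮t⟯)
    {x : Ω} (hx : x ∈ K⟮t⟯) : D x ∈ K⟮t⟯ := by
  induction hx using IntermediateField.adjoin_induction with
  | mem x hx =>
    obtain rfl : x = t := hx
    exact ht
  | algebraMap a => exact hK a
  | add x y hx hy h1 h2 => rw [map_add]; exact add_mem h1 h2
  | inv x hx h1 =>
    rw [Derivation.leibniz_inv, smul_eq_mul]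
    exact mul_mem (neg_mem (pow_mem (inv_mem hx) 2)) h1
  | mul x y hx hy h1 h2 =>
    rw [Der.leibniz]
    exact add_mem (mul_mem hx h2) (mul_mem hy h1)

/-- Finitely many functions which are algebraic over `S(t)`, where `t` is a primitive or an
exponential over the algebraically closed differential field `S`, can be expanded in Laurent series
over `S`. -/
theorem exists_laurent_embedding {Ω : Type u} [Field Ω] [CharZero Ω] [IsAlgClosed Ω] {n : ℕ}
    {d : Fin n → Der Ω} (hd : ∀ i j a, d i (d j a) = d j (d i a)) {S : Subfield Ω}
    (hS : IsStable d S) (hSc : ∀ x : Ω, IsAlgebraic S x → x ∈ S) {t : Ω} (ht : Transcendental S t)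
    (htS : (∀ i, d i t ∈ S) ∨ (∀ i, d i t / t ∈ S)) (Z : Finset Ω)
    (hZ : ∀ z ∈ Z, IsAlgebraic S⟮t⟯ z) :
    ∃ (γ : Fin n → S) (e : ℕ), (∀ i j, (d i).restrict S (hS i) (γ j) = (d j).restrict S (hS j) (γ
        i)) ∧
      ∃ (T : Subfield Ω) (hST : S ≤ T) (hT : IsStable d T) (ψ : T →+* S⸨X⸩), (∀ z ∈ Z, z ∈ T) ∧
        (∀ a : S, ψ ⟨a, hST a.2⟩ = C a) ∧
        ∀ i (x : T), laurentDeriv ((d i).restrict S (hS i)) (γ i) e (ψ x) =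
          ψ ((d i).restrict T (hT i) x) := by
  have hcl : IsAlgClosed S := isAlgClosed_of_forall_mem hSc
  have ht0 : t ≠ 0 := fun h => ht (h ▸ isAlgebraic_zero)
  have htmem := IntermediateField.mem_adjoin_simple_self S t
  have hSt : ∀ a ∈ S, a ∈ S⟮t⟯ := fun a ha => S⟮t⟯.algebraMap_mem ⟨a, ha⟩
  -- the generator is mapped to `s ^ σ`
  obtain ⟨σ, hσ0, hσ⟩ : ∃ σ : ℤ, σ ≠ 0 ∧ ∀ (m : ℕ), 0 < m → ∃ (γ : Fin n → S) (e : ℕ),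
      (∀ i j, (d i).restrict S (hS i) (γ j) = (d j).restrict S (hS j) (γ i)) ∧
      ∀ i (ψ : S⟮t⟯ →+* S⸨X⸩) (hdt : d i t ∈ S⟮t⟯), (∀ a : S, ψ (algebraMap S S⟮t⟯ a) = C a) →
        ψ (IntermediateField.AdjoinSimple.gen S t) = single (m * σ) 1 →
        laurentDeriv ((d i).restrict S (hS i)) (γ i) e (single (m * σ) 1) = ψ ⟨d i t, hdt⟩ := by
    rcases htS with h | h
    -- A primitive is expanded at infinity, `t = s ^ (-m)`. Since `s ^ (-m)` has derivative `-m γ s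
    -- ^ (e - m)`, the choice `e = m` and `γ = -dt / m` makes this the coefficient `dt`.
    · refine ⟨-1, by norm_num, fun m hm => ⟨fun i => -⟨d i t, h i⟩ / m, m, fun i j => ?_, ?_⟩⟩
      · apply Subtype.ext
        rw [Der.coe_restrict, Der.coe_restrict]
        push_cast
        rw [Derivation.leibniz_div_const _ _ _ (Derivation.map_natCast _ m),
          Derivation.leibniz_div_const _ _ _ (Derivation.map_natCast _ m), map_neg, map_neg, hd]
      · intro i ψ hdt hψ hψt
        have h1 : (⟨d i t, hdt⟩ : S⟮t⟯) = algebraMap S S⟮t⟯ ⟨d i t, h i⟩ := rfl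
        rw [h1, hψ, laurentDeriv_single]
        have hm0 : (m : S) ≠ 0 := by exact_mod_cast hm.ne'
        have h2 : ((m * (-1 : ℤ) : ℤ) : S) * (-⟨d i t, h i⟩ / m) = ⟨d i t, h i⟩ := by
          push_cast
          field_simp
        rw [h2, mul_neg_one, neg_add_cancel]
        rfl
    · have hβ : ∀ i, d i t = d i t / t * t := fun i => by field_simp
      -- An exponential is expanded at zero, `t = s ^ m`; the derivation preserves degrees, so `e =
      -- 0` and `γ = (dt / t) / m`.
      refine ⟨1, by norm_num, fun m hm => ⟨fun i => ⟨d i t / t, h i⟩ / m, 0, fun i j => ?_, ?_⟩⟩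
      · apply Subtype.ext
        rw [Der.coe_restrict, Der.coe_restrict]
        push_cast
        rw [Derivation.leibniz_div_const _ _ _ (Derivation.map_natCast _ m),
          Derivation.leibniz_div_const _ _ _ (Derivation.map_natCast _ m), Derivation.leibniz_div,
          Derivation.leibniz_div, hd i j]
        simp only [smul_eq_mul]
        ring
      · intro i ψ hdt hψ hψt
        have h1 : (⟨d i t, hdt⟩ : S⟮t⟯) = algebraMap S S⟮t⟯ ⟨d i t / t, h i⟩ *
            IntermediateField.AdjoinSimple.gen S t := Subtype.ext (hβ i)
        rw [h1, map_mul, hψ, hψt, laurentDeriv_single]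
        have hm0 : (m : S) ≠ 0 := by exact_mod_cast hm.ne'
        have h2 : ((m * (1 : ℤ) : ℤ) : S) * (⟨d i t / t, h i⟩ / m) = ⟨d i t / t, h i⟩ := by
          push_cast
          field_simp
        rw [h2, C_apply, single_mul_single, mul_one, zero_add, Nat.cast_zero, add_zero, mul_one]
  have hdt : ∀ i, d i t ∈ S⟮t⟯ := fun i => by
    rcases htS with h | h
    · exact hSt _ (h i)
    · have := mul_mem (hSt _ (h i)) htmem
      rwa [div_mul_cancel₀ _ ht0] at this
  have hA : ∀ i, ∀ x ∈ S⟮t⟯, d i x ∈ S⟮t⟯ := fun i x hx =>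
    derivation_mem_adjoin (d i) (fun a => hSt _ (hS i a a.2)) (hdt i) hx
  obtain ⟨ψ₀, hψ₀⟩ := exists_algHom_of_transcendental ht (transcendental_single (F := S) hσ0)
  let T₀ : IntermediateField S⟮t⟯ Ω := IntermediateField.adjoin S⟮t⟯ (Z : Set Ω)
  have hfin : FiniteDimensional S⟮t⟯ T₀ :=
    IntermediateField.finiteDimensional_adjoin fun z hz => (hZ z hz).isIntegral
  -- A single Puiseux root, that of the minimal polynomial of a primitive element, embeds the whole
  -- finite extension. Compatibility with the derivations then only has to be checked on `S⟮t⟯`.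
  let pb := Field.powerBasisOfFiniteOfSeparable S⟮t⟯ T₀
  have hpb : IsIntegral S⟮t⟯ pb.gen := Algebra.IsIntegral.isIntegral _
  obtain ⟨m, hm, y, hy⟩ := hasPuiseuxRoot (p := (minpoly S⟮t⟯ pb.gen).map ψ₀.toRingHom) (by
    rw [Polynomial.natDegree_map]
    exact minpoly.natDegree_pos hpb)
  let ψ₁ : S⟮t⟯ →+* S⸨X⸩ := (expandHom S m hm).comp ψ₀.toRingHom
  rw [Polynomial.eval₂_map] at hy
  let _ : Algebra S⟮t⟯ S⸨X⸩ := ψ₁.toAlgebra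
  let ψ₂ : T₀ →ₐ[S⟮t⟯] S⸨X⸩ := pb.lift y hy
  have hψ₂ : ∀ x : S⟮t⟯, ψ₂ (algebraMap S⟮t⟯ T₀ x) = ψ₁ x := fun x => ψ₂.commutes x
  obtain ⟨γ, e, hγ, hγt⟩ := hσ m hm
  have hψS : ∀ a : S, ψ₁ (algebraMap S S⟮t⟯ a) = C a := fun a => by
    show expandHom S m hm (ψ₀ (algebraMap S S⟮t⟯ a)) = _
    rw [ψ₀.commutes, algebraMap_eq_C]
    exact expandHom_C hm a
  have hψt : ψ₁ (IntermediateField.AdjoinSimple.gen S t) = single (m * σ) 1 := by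
    show expandHom S m hm (ψ₀ _) = _
    rw [hψ₀, expandHom_single]
  have hcomp : ∀ i (x : S⟮t⟯), laurentDeriv ((d i).restrict S (hS i)) (γ i) e (ψ₁ x) =
      ψ₁ ⟨d i x, hA i x x.2⟩ := fun i x => by
    refine map_derivation_of_mem_adjoin (d i) _ ψ₁ (hA i) (fun a => ?_) ?_ x
    · rw [hψS, laurentDeriv_C]
      exact (hψS ((d i).restrict S (hS i) a)).symm
    · rw [hψt]
      exact hγt i ψ₁ (hdt i) hψS hψt
  have hAT : S⟮t⟯.toSubfield ≤ T₀.toSubfield := fun x hx => T₀.algebraMap_mem ⟨x, hx⟩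
  have hTalg : ∀ x : T₀, IsAlgebraic S⟮t⟯ x := fun x => Algebra.IsAlgebraic.isAlgebraic x
  have hT : IsStable d T₀.toSubfield := fun i x hx =>
    derivation_mem_of_isAlgebraic (S := S⟮t⟯.toSubfield) (d i) (hA i) hAT hx
      ((hTalg ⟨x, hx⟩).algebraMap (A := Ω))
  let ψ : T₀.toSubfield →+* S⸨X⸩ := ψ₂.toRingHom
  refine ⟨γ, e, hγ, T₀.toSubfield, fun a ha => hAT (hSt a ha), hT, ψ, fun z hz =>
    IntermediateField.subset_adjoin _ _ hz, fun a => ?_, fun i x => ?_⟩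
  · rw [← hψS, ← hψ₂]
    rfl
  · exact map_derivation_of_isAlgebraic (A := S⟮t⟯) (T := T₀) ψ₂.toRingHom
      ((d i).restrict T₀.toSubfield (hT i)) _ (fun a => by
        have h1 := hcomp i a
        rw [← hψ₂, ← hψ₂] at h1
        exact h1) (hTalg x)

end Embedding

/-! ### Flat triangular connections and their transport. -/

section Connections

variable {K : Type*} [Field K] {n : ℕ} {ι : Type*} [Fintype ι]

/-- The connection `∇ⱼ = dⱼ + Bⱼ` on vectors. -/
def conn (d : Fin n → Der K) (B : Fin n → ι → ι → K) (j : Fin n) : (ι → K) →+ (ι → K) where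
  toFun := fun v a => d j (v a) + ∑ b, B j a b * v b
  map_zero' := by
    ext a
    simp
  map_add' := fun v w => by
    ext a
    simp only [Pi.add_apply, map_add, mul_add, Finset.sum_add_distrib]
    ring

theorem conn_apply (d : Fin n → Der K) (B : Fin n → ι → ι → K) (j : Fin n) (v : ι → K) (a : ι) :
    conn d B j v a = d j (v a) + ∑ b, B j a b * v b := rfl

theorem conn_smul (d : Fin n → Der K) (B : Fin n → ι → ι → K) (j : Fin n) (c : K) (v : ι → K) :
    conn d B j (c • v) = d j c • v + c • conn d B j v := by
  ext a
  simp only [conn_apply, Pi.add_apply, Pi.smul_apply, smul_eq_mul, Der.leibniz, mul_add,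
    Finset.mul_sum]
  simp only [mul_left_comm c]
  ring

theorem conn_single [DecidableEq ι] (d : Fin n → Der K) (B : Fin n → ι → ι → K) (j : Fin n)
    (a b : ι) : conn d B j (Pi.single b 1) a = B j a b := by
  rw [conn_apply, Finset.sum_eq_single b]
  · rw [Pi.single_eq_same, mul_one]
    rcases eq_or_ne a b with h | h
    · subst h
      simp
    · rw [Pi.single_eq_of_ne h, map_zero, zero_add]
  · intro c _ hc
    rw [Pi.single_eq_of_ne hc, mul_zero]
  · simp

/-- Every operator which satisfies the Leibniz rule is a connection. -/
theorem conn_eq_of_smul [DecidableEq ι] {d : Fin n → Der K} {f : Fin n → (ι → K) →+ (ι → K)}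
    (hf : ∀ j (c : K) v, f j (c • v) = d j c • v + c • f j v) (j : Fin n) :
    conn d (fun j a b => f j (Pi.single b 1) a) j = f j := by
  refine AddMonoidHom.ext fun v => funext fun a => ?_
  have hv := (Finset.univ_sum_single v).symm
  conv_rhs => rw [hv]
  rw [map_sum, Finset.sum_apply, conn_apply]
  have h : ∀ b, f j (Pi.single b (v b)) a =
      (if a = b then d j (v b) else 0) + f j (Pi.single b 1) a * v b := fun b => by
    have : (Pi.single b (v b) : ι → K) = v b • Pi.single b 1 := by
      rw [← Pi.single_smul, smul_eq_mul, mul_one]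
    rw [this, hf, Pi.add_apply, Pi.smul_apply, Pi.smul_apply, smul_eq_mul, smul_eq_mul,
      Pi.single_apply, mul_ite, mul_one, mul_zero, mul_comm (v b)]
  simp only [h, Finset.sum_add_distrib, Finset.sum_ite_eq, Finset.mem_univ, if_true]

/-- In `∇ᵢ ∇ⱼ v` all terms containing derivatives of `v` are symmetric in `i` and `j`, so flatness
is the matrix identity `dB + B ∧ B = 0`. -/
theorem conn_comm_iff [DecidableEq ι] {d : Fin n → Der K}
    (hd : ∀ i j a, d i (d j a) = d j (d i a)) {B : Fin n → ι → ι → K} :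
    (∀ i j v, conn d B i (conn d B j v) = conn d B j (conn d B i v)) ↔
      ∀ i j a b, d i (B j a b) + ∑ c, B i a c * B j c b =
        d j (B i a b) + ∑ c, B j a c * B i c b := by
  constructor
  · intro h i j a b
    have h1 : ∀ i j, conn d B i (conn d B j (Pi.single b 1)) a =
        d i (B j a b) + ∑ c, B i a c * B j c b := fun i j => by
      rw [conn_apply]
      simp only [conn_single]
    rw [← h1, h, h1]
  · intro h i j v
    ext a
    have key : ∀ i j, conn d B i (conn d B j v) a = d i (d j (v a)) +
        (∑ b, B j a b * d i (v b) + ∑ b, B i a b * d j (v b)) +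
        ∑ b, (d i (B j a b) + ∑ c, B i a c * B j c b) * v b := by
      intro i j
      simp only [conn_apply, map_add, map_sum, Der.leibniz, mul_add, add_mul,
        Finset.sum_add_distrib, Finset.mul_sum, Finset.sum_mul]
      rw [Finset.sum_comm (f := fun b c => B i a b * (B j b c * v c))]
      simp only [mul_comm (v _), mul_assoc]
      ring
    rw [key, key, hd]
    simp only [h i j]
    ring

/-- A flat triangular connection with a vector `h` which is horizontal along `∑ Pⱼ dⱼ` and all of
whose other derivatives are independent. -/
structure IsTri (d : Fin n → Der K) (P : Fin n → K) (k₀ : Fin n) (ρ : ι → ℕ)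
    (B : Fin n → ι → ι → K) (h : ι → K) : Prop where
  inj : Function.Injective ρ
  tri : ∀ j a b, B j a b ≠ 0 → ρ a ≤ ρ b
  comm : ∀ i j v, conn d B i (conn d B j v) = conn d B j (conn d B i v)
  proj : ∀ a, ∑ j, P j * conn d B j h a = 0
  indep : ∀ c : Fin n → K, c k₀ = 0 → (∀ a, ∑ j, c j * conn d B j h a = 0) → c = 0

theorem IsTri.eq_zero {d : Fin n → Der K} {P : Fin n → K} {k₀ : Fin n} {ρ : ι → ℕ}
    {B : Fin n → ι → ι → K} {h : ι → K} (H : IsTri d P k₀ ρ B h) {a b : ι} (hab : ρ b < ρ a) (j :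
        Fin n) :
    B j a b = 0 := by
  by_contra h0
  exact absurd (H.tri j a b h0) (not_le.2 hab)

theorem conn_congr {d : Fin n → Der K} {B : Fin n → ι → ι → K} {v w : ι → K} {a : ι} {j : Fin n}
    (ha : v a = w a)
    (hvw : ∀ c, B j a c ≠ 0 → v c = w c) : conn d B j v a = conn d B j w a := by
  rw [conn_apply, conn_apply, ha]
  congr 1
  refine Finset.sum_congr rfl fun c _ => ?_
  by_cases hc : B j a c = 0
  · rw [hc, zero_mul, zero_mul]
  · rw [hvw c hc]

/-- A left inverse makes independence an algebraic identity: it survives any homomorphism of fields,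
and its entries give pole bounds in the truncation argument. -/
theorem exists_left_inverse {k₀ : Fin n} {A : Fin n → ι → K}
    (hA : ∀ c : Fin n → K, c k₀ = 0 → (∀ a, ∑ j, c j * A j a = 0) → c = 0) :
    ∃ C : Fin n → ι → K, ∀ j ≠ k₀, ∀ l ≠ k₀, ∑ a, C j a * A l a = if j = l then 1 else 0 := by
  classical
  let f : ({j // j ≠ k₀} → K) →ₗ[K] (ι → K) := Fintype.linearCombination K (fun j => A j)
  have hf : LinearMap.ker f = ⊥ := by
    rw [LinearMap.ker_eq_bot']
    intro c hc
    have hc' := hA (fun j => if h : j = k₀ then 0 else c ⟨j, h⟩) (by simp) (fun a => by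
      have h1 := congrFun hc a
      rw [Fintype.linearCombination_apply, Finset.sum_apply] at h1
      rw [Fintype.sum_eq_add_sum_subtype_ne _ k₀, dif_pos rfl, zero_mul, zero_add]
      refine Eq.trans (Finset.sum_congr rfl fun j _ => ?_) h1
      rw [dif_neg j.2]
      rfl)
    ext j
    have := congrFun hc' j
    simpa [j.2] using this
  obtain ⟨g, hg⟩ := LinearMap.exists_leftInverse_of_injective f hf
  refine ⟨fun j a => if h : j = k₀ then 0 else g (Pi.single a 1) ⟨j, h⟩, fun j hj l hl => ?_⟩
  have h1 := congrFun (LinearMap.congr_fun hg (Pi.single ⟨l, hl⟩ 1)) ⟨j, hj⟩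
  have h2 : f (Pi.single ⟨l, hl⟩ 1) = ∑ a, A l a • Pi.single a (1 : K) := by
    simp only [f, Fintype.linearCombination_apply_single, one_smul]
    ext a
    simp [Pi.single_apply]
  rw [LinearMap.comp_apply, h2, map_sum, Finset.sum_apply, LinearMap.id_apply,
    Pi.single_apply] at h1
  simp only [map_smul, Pi.smul_apply, smul_eq_mul, Subtype.mk.injEq] at h1
  simp only [dif_neg hj]
  rw [← h1]
  exact Finset.sum_congr rfl fun a _ => mul_comm _ _

theorem indep_of_left_inverse {k₀ : Fin n} {A C : Fin n → ι → K}
    (hC : ∀ j ≠ k₀, ∀ l ≠ k₀, ∑ a, C j a * A l a = if j = l then 1 else 0) {c : Fin n → K}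
    (hc : c k₀ = 0) {j : Fin n} (hj : j ≠ k₀) : c j = ∑ a, C j a * ∑ l, c l * A l a := by
  simp only [Finset.mul_sum]
  rw [Finset.sum_comm]
  simp only [mul_left_comm (C j _)]
  simp only [← Finset.mul_sum]
  rw [Finset.sum_eq_single_of_mem j (Finset.mem_univ j), hC j hj j hj, if_pos rfl, mul_one]
  intro l _ hl
  rcases eq_or_ne l k₀ with h | h
  · rw [h, hc, zero_mul]
  · rw [hC j hj l h, if_neg hl.symm, mul_zero]

/-- The coefficients `c` in the independence condition now range over the larger field, so
independence is transported through the image of a left inverse. -/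
theorem IsTri.map [DecidableEq ι] {d : Fin n → Der K} {P : Fin n → K} {k₀ : Fin n} {ρ : ι → ℕ}
    {B : Fin n → ι → ι → K} {h : ι → K} (H : IsTri d P k₀ ρ B h)
    (hd : ∀ i j a, d i (d j a) = d j (d i a)) {E : Type*} [Field E]
    {D : Fin n → Der E} (hD : ∀ i j a, D i (D j a) = D j (D i a)) (ψ : K →+* E)
    (hψ : ∀ i x, D i (ψ x) = ψ (d i x)) :
    IsTri D (fun j => ψ (P j)) k₀ ρ (fun j a b => ψ (B j a b)) (fun a => ψ (h a)) := by
  have hA : ∀ j a, conn D (fun j a b => ψ (B j a b)) j (fun a => ψ (h a)) a =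
      ψ (conn d B j h a) := fun j a => by
    simp only [conn_apply, hψ, map_add, map_sum, map_mul]
  refine ⟨H.inj, fun j a b hb => H.tri j a b fun h0 => hb (by rw [h0, map_zero]), ?_, fun a => ?_,
    fun c hc0 hc => ?_⟩
  · rw [conn_comm_iff hD]
    intro i j a b
    have := congrArg ψ ((conn_comm_iff hd).1 H.comm i j a b)
    simpa only [map_add, map_sum, map_mul, hψ] using this
  · simp only [hA, ← map_mul, ← map_sum, H.proj, map_zero]
  · obtain ⟨C, hC⟩ := exists_left_inverse H.indep
    ext j
    rcases eq_or_ne j k₀ with hj | hj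
    · rw [hj, hc0]
      rfl
    rw [indep_of_left_inverse (C := fun j a => ψ (C j a))
      (A := fun j => conn D (fun j a b => ψ (B j a b)) j (fun a => ψ (h a))) (fun j hj l hl => by
        simp only [hA, ← map_mul, ← map_sum, hC j hj l hl]
        split_ifs <;> simp) hc0 hj]
    simp only [hc, mul_zero, Finset.sum_const_zero, Pi.zero_apply]

/-- The existence of data as in `IsTri` with entries in a subfield. -/
def HasTri {Ω : Type u} [Field Ω] (d : Fin n → Der Ω) (P : Fin n → Ω) (k₀ : Fin n)
    (S : Subfield Ω) : Prop :=
  ∃ (ι : Type) (_ : Fintype ι) (_ : DecidableEq ι) (ρ : ι → ℕ) (B : Fin n → ι → ι → Ω)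
    (h : ι → Ω), (∀ j a b, B j a b ∈ S) ∧ (∀ a, h a ∈ S) ∧ IsTri d P k₀ ρ B h

theorem IsTri.hasTri {Ω : Type u} [Field Ω] {d : Fin n → Der Ω}
    (hd : ∀ i j a, d i (d j a) = d j (d i a)) {k₀ : Fin n} {S : Subfield Ω} (hS : IsStable d S)
    {P : Fin n → S} {ι : Type} [Fintype ι] [DecidableEq ι] {ρ : ι → ℕ} {B : Fin n → ι → ι → S}
    {h : ι → S} (H : IsTri (fun i => (d i).restrict S (hS i)) P k₀ ρ B h) :
    HasTri d (fun j => (P j : Ω)) k₀ S :=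
  ⟨ι, _, ‹_›, ρ, fun j a b => B j a b, fun a => h a, fun j a b => (B j a b).2, fun a => (h a).2,
    H.map (fun i j a => Subtype.ext (hd i j a)) hd S.subtype fun _ _ => rfl⟩

theorem IsTri.restrict {Ω : Type u} [Field Ω] {d : Fin n → Der Ω}
    (hd : ∀ i j a, d i (d j a) = d j (d i a)) {k₀ : Fin n} {S : Subfield Ω} (hS : IsStable d S)
    {P : Fin n → S} {ι : Type} [Fintype ι] [DecidableEq ι] {ρ : ι → ℕ} {B : Fin n → ι → ι → S}
    {h : ι → S} (H : IsTri d (fun j => (P j : Ω)) k₀ ρ (fun j a b => (B j a b : Ω))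
      (fun a => (h a : Ω))) :
    IsTri (fun i => (d i).restrict S (hS i)) P k₀ ρ B h := by
  have hA : ∀ j a, (conn (fun i => (d i).restrict S (hS i)) B j h a : Ω) =
      conn d (fun j a b => (B j a b : Ω)) j (fun a => (h a : Ω)) a := fun j a => by
    simp only [conn_apply]
    push_cast
    rfl
  refine ⟨H.inj, fun j a b hb => H.tri j a b fun h0 => hb (Subtype.ext h0), ?_, fun a => ?_,
    fun c hc0 hc => ?_⟩
  · rw [conn_comm_iff fun i j a => Subtype.ext (hd i j a)]
    intro i j a b
    apply Subtype.ext
    push_cast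
    exact (conn_comm_iff hd).1 H.comm i j a b
  · apply Subtype.ext
    push_cast
    simp only [hA]
    exact H.proj a
  · have := H.indep (fun j => c j) (by simp [hc0]) (fun a => by
      have := congrArg (Subtype.val) (hc a)
      push_cast at this
      simpa only [hA] using this)
    ext j
    exact congrFun this j

end Connections

/-! ### Gauge transformations of triangular connections. -/

section Gauge

variable {K : Type*} [Field K] {n : ℕ} {ι : Type*} [Fintype ι] [DecidableEq ι]
  {d : Fin n → Der K} {P : Fin n → K} {k₀ : Fin n} {ρ : ι → ℕ} {B : Fin n → ι → ι → K} {h : ι → K}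

/-- Conjugation by a linear change of basis respects every condition except triangularity, which is
therefore the only thing assumed of the new matrices. -/
theorem IsTri.gauge (H : IsTri d P k₀ ρ B h) (g g' : (ι → K) →ₗ[K] (ι → K))
    (hgg' : ∀ v, g (g' v) = v) (hg'g : ∀ v, g' (g v) = v)
    (htri : ∀ j a b, g' (conn d B j (g (Pi.single b 1))) a ≠ 0 → ρ a ≤ ρ b) :
    IsTri d P k₀ ρ (fun j a b => g' (conn d B j (g (Pi.single b 1))) a) (g' h) := by
  let f : Fin n → (ι → K) →+ (ι → K) := fun j =>
    g'.toAddMonoidHom.comp ((conn d B j).comp g.toAddMonoidHom)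
  have hf : ∀ j v, f j v = g' (conn d B j (g v)) := fun _ _ => rfl
  have hc : ∀ j, conn d (fun j a b => g' (conn d B j (g (Pi.single b 1))) a) j = f j :=
    conn_eq_of_smul (f := f) fun j c v => by
      simp only [hf, map_smul, conn_smul, map_add, hg'g]
  have hA : ∀ c : Fin n → K, (fun a => ∑ j, c j * f j (g' h) a) =
      g' (fun a => ∑ j, c j * conn d B j h a) := fun c => by
    have h1 : (fun a => ∑ j, c j * conn d B j h a) = ∑ j, c j • conn d B j h := by
      ext a
      simp
    have h2 : (fun a => ∑ j, c j * f j (g' h) a) = ∑ j, c j • f j (g' h) := by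
      ext a
      simp
    rw [h1, h2, map_sum]
    simp only [map_smul, hf, hgg']
  refine ⟨H.inj, htri, fun i j v => ?_, fun a => ?_, fun c hc0 hc1 => H.indep c hc0 fun a => ?_⟩
  · simp only [hc, hf, hgg', H.comm i j]
  · simp only [hc]
    have := congrFun (hA P) a
    rw [this, show (fun a => ∑ j, P j * conn d B j h a) = 0 from funext H.proj, map_zero]
    rfl
  · simp only [hc] at hc1
    have h3 : g' (fun a => ∑ j, c j * conn d B j h a) = 0 := by
      rw [← hA c]
      exact funext hc1
    have h4 := congrArg g h3
    rw [hgg', map_zero] at h4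
    exact congrFun h4 a

/-- The diagonal of a product of triangular matrices is the product of the diagonals, so the
quadratic terms of the flatness identity cancel on the diagonal. -/
theorem IsTri.closed_diag (H : IsTri d P k₀ ρ B h) (hd : ∀ i j a, d i (d j a) = d j (d i a))
    (i j : Fin n) (a : ι) : d i (B j a a) = d j (B i a a) := by
  have h1 := (conn_comm_iff hd).1 H.comm i j a a
  have h2 : ∀ i j, ∑ c, B i a c * B j c a = B i a a * B j a a := fun i j => by
    rw [Fintype.sum_eq_single a]
    intro c hca
    by_contra h0
    rw [← ne_eq, mul_ne_zero_iff] at h0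
    exact hca (H.inj (le_antisymm (H.tri _ _ _ h0.2) (H.tri _ _ _ h0.1)))
  rw [h2, h2] at h1
  linear_combination h1

/-- The change of basis which adds a multiple of a basis vector to a later one. -/
theorem IsTri.transvection (H : IsTri d P k₀ ρ B h) {l i : ι} (hli : ρ l < ρ i) (G : K) :
    ∃ B' h', IsTri d P k₀ ρ B' h' ∧
      (∀ j a b, (b = i → ρ l < ρ a) → (a = l → ρ b < ρ i) → B' j a b = B j a b) ∧
      ∀ j, B' j l i = B j l i + d j G + (B j l l - B j i i) * G := by
  have hne : l ≠ i := fun h0 => by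
    rw [h0] at hli
    exact lt_irrefl _ hli
  let T : K → (ι → K) →ₗ[K] (ι → K) := fun G =>
    { toFun := fun v => v + Pi.single l (G * v i)
      map_add' := fun v w => by
        rw [Pi.add_apply, mul_add, Pi.single_add]
        abel
      map_smul' := fun c v => by
        rw [RingHom.id_apply, smul_add, ← Pi.single_smul, Pi.smul_apply, smul_eq_mul, smul_eq_mul,
          mul_left_comm] }
  have hT : ∀ G v a, T G v a = v a + if a = l then G * v i else 0 := fun G v a => by
    show v a + _ = _
    rw [Pi.single_apply]
  have hTT : ∀ G v, T (-G) (T G v) = v := fun G v => by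
    ext a
    rw [hT, hT, hT, if_neg hne.symm]
    split_ifs <;> ring
  have hTs : ∀ b, T G (Pi.single b 1) = if b = i then Pi.single i 1 + G • Pi.single l 1 else
      Pi.single b 1 := fun b => by
    ext a
    rw [hT]
    split_ifs with h1 h2 h2
    · subst h2
      simp [h1]
    · simp [Pi.single_apply, Ne.symm h2]
    · subst h2
      simp [h1]
    · simp
  let M : Fin n → ι → ι → K := fun j a b => B j a b +
    if b = i then (if a = l then d j G else 0) + G * B j a l else 0
  have hM : ∀ j a b, conn d B j (T G (Pi.single b 1)) a = M j a b := fun j a b => by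
    simp only [M, hTs]
    split_ifs with h1 h2
    · rw [map_add, conn_smul, Pi.add_apply, Pi.add_apply, conn_single, h1, h2]
      simp [conn_single]
    · rw [map_add, conn_smul, Pi.add_apply, Pi.add_apply, conn_single, h1]
      simp [conn_single, h2]
    · rw [conn_single, add_zero]
  -- Conjugation by `1 + G E_{li}` changes only column `i` and row `l`; triangularity leaves only
  -- entries at or above `(l, i)` in that column, and at or beyond it in that row.
  have hB : ∀ j a b, T (-G) (conn d B j (T G (Pi.single b 1))) a =
      M j a b - if a = l then G * B j i b else 0 := fun j a b => by
    rw [hT, hM, hM]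
    have h1 : M j i b = B j i b := by
      simp only [M, if_neg hne.symm, H.eq_zero hli j]
      simp
    rw [h1]
    split_ifs <;> ring
  have hB1 : ∀ j a b, (b = i → ρ l < ρ a) → (a = l → ρ b < ρ i) →
      M j a b - (if a = l then G * B j i b else 0) = B j a b := fun j a b h1 h2 => by
    simp only [M]
    by_cases hb : b = i
    · have h3 := h1 hb
      have h4 : a ≠ l := fun h0 => by
        rw [h0] at h3
        exact lt_irrefl _ h3
      simp [h4, H.eq_zero h3 j]
    · by_cases ha : a = l
      · simp [hb, H.eq_zero (h2 ha) j]
      · simp [hb, ha]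
  refine ⟨_, _, H.gauge (T G) (T (-G)) (fun v => ?_) (hTT G) fun j a b h0 => ?_, fun j a b h1 h2 =>
      ?_,
    fun j => ?_⟩
  · have := hTT (-G) v
    rwa [neg_neg] at this
  · rw [hB] at h0
    by_contra! h1
    have h2 : a ≠ l ∨ ρ b < ρ i := by
      by_contra! h3
      rw [h3.1] at h1
      omega
    rw [hB1 j a b (fun hb => by rw [hb] at h1; omega)
      (fun ha => h2.resolve_left (not_not.2 ha)), H.eq_zero h1] at h0
    exact h0 rfl
  · rw [hB, hB1 j a b h1 h2]
  · rw [hB]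
    simp only [M, if_true]
    ring

end Gauge

/-! ### Splitting by irregular parts and regularization of the diagonal. -/

section Split

open HahnSeries

open scoped LaurentSeries

variable {F : Type u} [Field F] {n : ℕ} {d : Fin n → Der F} {γ : Fin n → F} {e : ℕ}
  {ι : Type} [Fintype ι] [DecidableEq ι] {P : Fin n → F⸨X⸩} {k₀ : Fin n} {ρ : ι → ℕ}
  {B : Fin n → ι → ι → F⸨X⸩} {h : ι → F⸨X⸩}

/-- A flat triangular connection over the field of Laurent series splits according to the
irregular parts of its diagonal entries. -/
theorem IsTri.exists_split
    (hcomm : ∀ i j x, laurentDeriv (d i) (γ i) e (laurentDeriv (d j) (γ j) e x) =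
      laurentDeriv (d j) (γ j) e (laurentDeriv (d i) (γ i) e x))
    (H : IsTri (fun i => laurentDeriv (d i) (γ i) e) P k₀ ρ B h) :
    ∃ B' h', IsTri (fun i => laurentDeriv (d i) (γ i) e) P k₀ ρ B' h' ∧
      ∀ j a b, B' j a b ≠ 0 → ∀ i, OrdGE 0 (B' i a a - B' i b b) := by
  obtain ⟨R, hR⟩ : ∃ R, ∀ a, ρ a ≤ R :=
    ⟨∑ a, ρ a, fun a => Finset.single_le_sum (fun _ _ => Nat.zero_le _) (Finset.mem_univ a)⟩
  -- Two places are related when their diagonal entries have the same polar part in every direction.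
  let rel : ι → ι → Prop := fun a b => ∀ i, OrdGE 0 (B i a a - B i b b)
  have hrel : ∀ {a b c}, rel a b → rel b c → rel a c := fun h1 h2 i => by
    have := (h1 i).add (h2 i)
    rwa [sub_add_sub_cancel] at this
  -- Entries are cleared column by column, and within a column from the diagonal upwards. A
  -- transvection at `(l, i)` disturbs no entry of smaller code.
  let code : ι → ι → ℕ := fun a b => ρ b * (R + 1) + (R - ρ a)
  have hcode₁ : ∀ {a l b : ι}, code a b < code l b → ρ l < ρ a := fun {a l b} h0 => by
    simp only [code] at h0
    omega
  have hcode₂ : ∀ {a b i : ι}, code a b < code a i → ρ b < ρ i := fun {a b i} h0 => by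
    simp only [code] at h0
    exact lt_of_mul_lt_mul_right (Nat.lt_of_add_lt_add_right h0) (Nat.zero_le _)
  have hcode₃ : ∀ {a b l i : ι}, code a b = code l i → a = l ∧ b = i := fun {a b l i} h0 => by
    simp only [code] at h0
    have h1 : ρ b = ρ i := by
      rcases lt_trichotomy (ρ b) (ρ i) with h | h | h
      · have := Nat.mul_le_mul_right (R + 1) h
        rw [Nat.succ_mul] at this
        omega
      · exact h
      · have := Nat.mul_le_mul_right (R + 1) h
        rw [Nat.succ_mul] at this
        omega
    rw [h1] at h0
    have h2 := hR a
    have h3 := hR l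
    exact ⟨H.inj (by omega), H.inj h1⟩
  have key : ∀ m : ℕ, ∃ B' h', IsTri (fun i => laurentDeriv (d i) (γ i) e) P k₀ ρ B' h' ∧
      (∀ j a, B' j a a = B j a a) ∧ ∀ a b, code a b < m → ¬ rel a b → ∀ j, B' j a b = 0 := by
    intro m
    induction m with
    | zero => exact ⟨B, h, H, fun _ _ => rfl, fun a b h0 => absurd h0 (Nat.not_lt_zero _)⟩
    | succ m ih =>
      obtain ⟨B', h', H', hdiag, hz⟩ := ih
      by_cases hex : ∃ l i, code l i = m ∧ ¬ rel l i ∧ ∃ j, B' j l i ≠ 0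
      swap
      · refine ⟨B', h', H', hdiag, fun a b hab hr j => ?_⟩
        rcases Nat.lt_succ_iff_lt_or_eq.1 hab with h1 | h1
        · exact hz a b h1 hr j
        · by_contra h2
          exact hex ⟨a, b, h1, hr, j, h2⟩
      obtain ⟨l, i, hm, hr, j₀, hj₀⟩ := hex
      have hne : l ≠ i := by
        rintro rfl
        exact hr fun i => by
          rw [sub_self]
          exact ordGE_zero 0
      have hlt : ρ l < ρ i := lt_of_le_of_ne (H'.tri _ _ _ hj₀) fun h0 => hne (H'.inj h0)
      -- An intermediate `c` would use the entries `(l, c)` and `(c, i)`, both of smaller code.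
      -- Nonzero ones join related places, which would make `l` and `i` related.
      have hsum : ∀ j k, ∑ c, B' j l c * B' k c i = B' j l l * B' k l i + B' j l i * B' k i i := by
        intro j k
        refine Fintype.sum_eq_add l i hne fun c hc => ?_
        by_contra h0
        rw [← ne_eq, mul_ne_zero_iff] at h0
        have h1 : ρ l < ρ c := lt_of_le_of_ne (H'.tri _ _ _ h0.1) fun h => hc.1 (H'.inj h).symm
        have h2 : ρ c < ρ i := lt_of_le_of_ne (H'.tri _ _ _ h0.2) fun h => hc.2 (H'.inj h)
        refine hr (hrel (b := c) ?_ ?_)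
        · by_contra h3
          refine h0.1 (hz l c ?_ h3 j)
          rw [← hm]
          have := Nat.mul_le_mul_right (R + 1) (Nat.succ_le_of_lt h2)
          rw [Nat.succ_mul] at this
          simp only [code]
          omega
        · by_contra h3
          refine h0.2 (hz c i ?_ h3 k)
          rw [← hm]
          have := hR c
          simp only [code]
          omega
      have hirr : ∃ j, ¬ OrdGE 0 (B' j l l - B' j i i) := by
        by_contra! h0
        exact hr fun j => by
          rw [← hdiag, ← hdiag]
          exact h0 j
      -- The entry at `(l, i)` is thus closed for the rank one connection `B l l - B i i`. That
      -- connection is irregular, so the entry is exact, and a transvection by a primitive removes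
      -- it.
      obtain ⟨G, hG⟩ := exists_primitive_of_irregular hcomm
        (η := fun j => B' j l l - B' j i i) (φ := fun j => -B' j l i) (fun j k => by
          simp only [map_sub]
          rw [H'.closed_diag hcomm j k l, H'.closed_diag hcomm j k i]) hirr (fun j k => by
          have h1 := (conn_comm_iff hcomm).1 H'.comm j k l i
          rw [hsum, hsum] at h1
          simp only [map_neg]
          linear_combination -h1)
      obtain ⟨B₂, h₂, H₂, hB₂, hB₂'⟩ := H'.transvection hlt G
      have hdiag₂ : ∀ j a, B₂ j a a = B' j a a := fun j a =>
        hB₂ j a a (fun h0 => by rw [h0]; exact hlt) (fun h0 => by rw [h0]; exact hlt)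
      refine ⟨B₂, h₂, H₂, fun j a => (hdiag₂ j a).trans (hdiag j a), fun a b hab hr' j => ?_⟩
      rcases Nat.lt_succ_iff_lt_or_eq.1 hab with h1 | h1
      · rw [hB₂ j a b, hz a b h1 hr']
        · rintro rfl
          rw [← hm] at h1
          exact hcode₁ h1
        · rintro rfl
          rw [← hm] at h1
          exact hcode₂ h1
      · rw [← hm] at h1
        obtain ⟨rfl, rfl⟩ := hcode₃ h1
        rw [hB₂']
        linear_combination -hG j
  obtain ⟨B', h', H', hdiag, hz⟩ := key (R * (R + 1) + R + 1)
  refine ⟨B', h', H', fun j a b h0 i => ?_⟩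
  by_contra h1
  refine h0 (hz a b ?_ (fun hr => h1 ?_) j)
  · have := Nat.mul_le_mul_right (R + 1) (hR b)
    simp only [code]
    omega
  · rw [hdiag, hdiag]
    exact hr i

/-- A flat triangular connection over the field of Laurent series can be replaced by one with
regular diagonal entries. -/
theorem IsTri.exists_regular
    (hcomm : ∀ i j x, laurentDeriv (d i) (γ i) e (laurentDeriv (d j) (γ j) e x) =
      laurentDeriv (d j) (γ j) e (laurentDeriv (d i) (γ i) e x))
    (H : IsTri (fun i => laurentDeriv (d i) (γ i) e) P k₀ ρ B h) :
    ∃ (κ : Type) (_ : Fintype κ) (_ : DecidableEq κ) (ρ' : κ → ℕ) (B' : Fin n → κ → κ → F⸨X⸩)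
      (h' : κ → F⸨X⸩), IsTri (fun i => laurentDeriv (d i) (γ i) e) P k₀ ρ' B' h' ∧
        ∀ j a, OrdGE 0 (B' j a a) := by
  obtain ⟨B, h, H, hB⟩ := H.exists_split hcomm
  obtain ⟨R, hR⟩ : ∃ R, ∀ a, ρ a ≤ R :=
    ⟨∑ a, ρ a, fun a => Finset.single_le_sum (fun _ _ => Nat.zero_le _) (Finset.mem_univ a)⟩
  set D : Fin n → Der F⸨X⸩ := fun i => laurentDeriv (d i) (γ i) e with hD
  let rel : ι → ι → Prop := fun a b => ∀ i, OrdGE 0 (B i a a - B i b b)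
  have hrefl : ∀ a, rel a a := fun a i => by
    rw [sub_self]
    exact ordGE_zero 0
  have hsymm : ∀ {a b}, rel a b → rel b a := fun h1 i => by
    have := (h1 i).neg
    rwa [neg_sub] at this
  have hrel : ∀ {a b c}, rel a b → rel b c → rel a c := fun h1 h2 i => by
    have := (h1 i).add (h2 i)
    rwa [sub_add_sub_cancel] at this
  -- On a class where `h` vanishes, `∇ h` vanishes too, so its block may be replaced by the trivial
  -- connection.
  let good : ι → Prop := fun a => ∃ l, rel l a ∧ h l ≠ 0
  have hgood : ∀ {a b}, rel a b → (good a ↔ good b) := fun hab =>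
    ⟨fun ⟨l, h1, h2⟩ => ⟨l, hrel h1 hab, h2⟩, fun ⟨l, h1, h2⟩ => ⟨l, hrel h1 (hsymm hab), h2⟩⟩
  -- The last nonzero component of `h` in its class: there `∇ⱼ h` involves only the diagonal entry
  -- of `B`.
  have hpivot : ∀ a, ∃ p, good a → rel p a ∧ h p ≠ 0 ∧ ∀ l, rel l a → h l ≠ 0 → ρ l ≤ ρ p := by
    classical
    intro a
    by_cases ha : good a
    · obtain ⟨l, h1, h2⟩ := ha
      obtain ⟨p, hp, hmax⟩ := Finset.exists_max_image
        (Finset.univ.filter fun l => rel l a ∧ h l ≠ 0) ρ ⟨l, by simp [h1, h2]⟩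
      rw [Finset.mem_filter] at hp
      exact ⟨p, fun _ => ⟨hp.2.1, hp.2.2, fun l h3 h4 => hmax l (by simp [h3, h4])⟩⟩
    · exact ⟨a, fun h0 => absurd h0 ha⟩
  choose p hp using hpivot
  classical
  -- Minus the covariant logarithmic derivative of `h` at the pivot. It is closed, contracts to zero
  -- with `P`, and cancels the polar part of the diagonal because logarithmic derivatives of Laurent
  -- series are regular.
  let τ : ι → Fin n → F⸨X⸩ := fun a j =>
    if good a then -(B j (p a) (p a) + D j (h (p a)) / h (p a)) else 0
  have hτ : ∀ {a b}, rel a b → τ a = τ b := fun {a b} hab => by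
    by_cases ha : good a
    · have hb := (hgood hab).1 ha
      obtain ⟨a1, a2, a3⟩ := hp a ha
      obtain ⟨b1, b2, b3⟩ := hp b hb
      have : p a = p b := H.inj (le_antisymm (b3 _ (hrel a1 hab) a2)
        (a3 _ (hrel b1 (hsymm hab)) b2))
      simp only [τ, if_pos ha, if_pos hb, this]
    · have hb := mt (hgood hab).2 ha
      simp only [τ, if_neg ha, if_neg hb]
  have hclosed : ∀ i j a, D i (τ a j) = D j (τ a i) := fun i j a => by
    by_cases ha : good a
    · simp only [τ, if_pos ha, map_neg, map_add, Derivation.leibniz_div,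
        H.closed_diag hcomm i j, smul_eq_mul]
      rw [hcomm i j]
      ring
    · simp only [τ, if_neg ha, map_zero]
  have hPτ : ∀ a, ∑ j, P j * τ a j = 0 := fun a => by
    by_cases ha : good a
    · obtain ⟨a1, a2, a3⟩ := hp a ha
      have h1 : ∀ j, conn D B j h (p a) = -(h (p a)) * τ a j := fun j => by
        rw [conn_apply, Fintype.sum_eq_single (p a)]
        · simp only [τ, if_pos ha]
          field_simp
          ring
        · intro c hc
          by_contra h0
          rw [← ne_eq, mul_ne_zero_iff] at h0
          exact hc (H.inj (le_antisymm (a3 c (hrel (hsymm (hB j _ _ h0.1)) a1) h0.2)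
            (H.tri _ _ _ h0.1)))
      have h2 := H.proj (p a)
      simp only [h1, mul_left_comm (P _)] at h2
      rw [← Finset.mul_sum] at h2
      exact (mul_eq_zero.1 h2).resolve_left (neg_ne_zero.2 a2)
    · simp only [τ, if_neg ha, mul_zero, Finset.sum_const_zero]
  -- Twisting by `τ` could destroy independence. The extra coordinate `none` carries the constant
  -- `1`, and `some a` receives `τ a` from it. A combination which kills the enlarged vector kills
  -- all `τ a`, and then the twist has no effect on it.
  let v₁ : (ι ⊕ Option ι → F⸨X⸩) → ι → F⸨X⸩ := fun v a => v (Sum.inl a)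
  let f : Fin n → (ι ⊕ Option ι → F⸨X⸩) →+ (ι ⊕ Option ι → F⸨X⸩) := fun j =>
    { toFun := fun v => Sum.elim
        (fun a => if good a then conn D B j (v₁ v) a + τ a j * v (Sum.inl a)
          else D j (v (Sum.inl a)))
        (fun o => D j (v (Sum.inr o)) + o.elim 0 fun a => τ a j * v (Sum.inr none))
      map_zero' := by
        ext a
        rcases a with a | _ | a
        · have : v₁ 0 = 0 := rfl
          simp [this]
        · simp
        · simp
      map_add' := fun v w => by
        ext a
        rcases a with a | _ | a
        · have : v₁ (v + w) = v₁ v + v₁ w := rfl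
          simp only [this, map_add, Sum.elim_inl, Pi.add_apply]
          split_ifs <;> ring_nf
        · simp
        · simp only [Sum.elim_inr, Pi.add_apply, map_add, Option.elim_some]
          ring_nf }
  have f₁ : ∀ j v a, f j v (Sum.inl a) = if good a then
    conn D B j (v₁ v) a + τ a j * v (Sum.inl a) else D j (v (Sum.inl a)) := fun _ _ _ => rfl
  have f₂ : ∀ j v, f j v (Sum.inr none) = D j (v (Sum.inr none)) := fun _ _ => add_zero _
  have f₃ : ∀ j v a, f j v (Sum.inr (some a)) = D j (v (Sum.inr (some a))) +
    τ a j * v (Sum.inr none) := fun _ _ _ => rfl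
  have hf : ∀ j (c : F⸨X⸩) v, f j (c • v) = D j c • v + c • f j v := fun j c v => by
    ext1 a
    have h1 : v₁ (c • v) = c • v₁ v := rfl
    rcases a with a | _ | a
    · simp only [f₁, h1, conn_smul, Pi.add_apply, Pi.smul_apply, smul_eq_mul, Der.leibniz]
      split_ifs
      · have : v₁ v a = v (Sum.inl a) := rfl
        rw [this]
        ring
      · ring
    · simp only [f₂, Pi.add_apply, Pi.smul_apply, smul_eq_mul, Der.leibniz]
      ring
    · simp only [f₃, Pi.add_apply, Pi.smul_apply, smul_eq_mul, Der.leibniz]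
      ring
  have hfcomm : ∀ i j v, f i (f j v) = f j (f i v) := fun i j v => by
    ext1 a
    rcases a with a | _ | a
    · by_cases ha : good a
      · have h1 : ∀ i j, f i (f j v) (Sum.inl a) = conn D B i (conn D B j (v₁ v)) a +
            D i (τ a j) * v (Sum.inl a) + τ a j * conn D B i (v₁ v) a + τ a i *
              (conn D B j (v₁ v) a + τ a j * v (Sum.inl a)) := fun i j => by
          have h2 : conn D B i (v₁ (f j v)) a =
              conn D B i (conn D B j (v₁ v) + τ a j • v₁ v) a := by
            refine conn_congr ?_ fun c hc => ?_
            · exact (f₁ j v a).trans (if_pos ha)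
            · have hac : rel a c := hB i a c hc
              refine (f₁ j v c).trans ((if_pos ((hgood hac).1 ha)).trans ?_)
              rw [hτ hac]
              rfl
          rw [f₁, if_pos ha, h2, map_add, conn_smul, f₁, if_pos ha]
          simp only [Pi.add_apply, Pi.smul_apply, smul_eq_mul]
          have : v₁ v a = v (Sum.inl a) := rfl
          rw [this]
          ring
        rw [h1, h1, H.comm i j, hclosed i j]
        ring
      · simp only [f₁, if_neg ha, hcomm i j, hD]
    · simp only [f₂, hcomm i j, hD]
    · simp only [f₂, f₃, map_add, Der.leibniz]
      rw [hclosed i j, show D i (D j _) = D j (D i _) from hcomm i j _]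
      ring
  have hconn := conn_eq_of_smul hf
  let h' : ι ⊕ Option ι → F⸨X⸩ := Sum.elim h (fun o => o.elim 1 fun _ => 0)
  have hv₁ : v₁ h' = h := rfl
  have hh : ∀ a, ¬ good a → h a = 0 := fun a ha => by
    by_contra h0
    exact ha ⟨a, hrefl a, h0⟩
  have hs₁ : ∀ b, v₁ (Pi.single (Sum.inl b) 1) = Pi.single b 1 := fun b => by
    ext1 a
    simp [v₁, Pi.single_apply]
  have hs₂ : ∀ b, v₁ (Pi.single (Sum.inr b) 1) = 0 := fun b => by
    ext1 a
    simp [v₁]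
  -- The ranks put the three groups in disjoint ranges, with `none` last since its column feeds the
  -- rows `some a`.
  refine ⟨ι ⊕ Option ι, inferInstance, inferInstance,
    Sum.elim ρ (fun o => o.elim (2 * (R + 1)) fun a => ρ a + (R + 1)),
    fun j a b => f j (Pi.single b 1) a, h',
    ⟨?_, fun j a b hab => ?_, fun i j v => ?_, fun a => ?_, fun c hc0 hc => ?_⟩, fun j a => ?_⟩
  · have h1 := hR
    rintro (a | _ | a) (b | _ | b) hab <;>
      simp only [Sum.elim_inl, Sum.elim_inr, Option.elim_none, Option.elim_some] at hab
    · rw [H.inj hab]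
    · have := h1 a; omega
    · have := h1 a; omega
    · have := h1 b; omega
    · rfl
    · have := h1 b; omega
    · have := h1 b; omega
    · have := h1 a; omega
    · rw [H.inj (Nat.add_right_cancel hab)]
  · have h1 := hR
    rcases a with a | _ | a <;> rcases b with b | _ | b <;>
      simp only [Sum.elim_inl, Sum.elim_inr, Option.elim_none, Option.elim_some]
    · simp only [f₁, hs₁, conn_single] at hab
      by_contra! h0
      have h2 : a ≠ b := fun h2 => by rw [h2] at h0; exact lt_irrefl _ h0
      rw [H.eq_zero h0] at hab
      simp [h2] at hab
    · have := h1 a; omega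
    · have := h1 a; omega
    · simp [f₂] at hab
    · rfl
    · simp [f₂] at hab
    · simp [f₃] at hab
    · have := h1 a; omega
    · by_cases h2 : a = b
      · rw [h2]
      · simp [f₃, h2] at hab
  · rw [hconn, hconn]
    exact hfcomm i j v
  · simp only [hconn]
    rcases a with a | _ | a
    · by_cases ha : good a
      · simp only [f₁, if_pos ha, hv₁, mul_add, ← mul_assoc, Finset.sum_add_distrib,
          ← Finset.sum_mul, hPτ, zero_mul, add_zero]
        exact H.proj a
      · simp [f₁, if_neg ha, h', hh a ha]
    · simp [f₂, h']
    · simp [f₃, h', hPτ]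
  · simp only [hconn] at hc
    have hcτ : ∀ a, ∑ j, c j * τ a j = 0 := fun a => by
      simpa [f₃, h'] using hc (Sum.inr (some a))
    refine H.indep c hc0 fun a => ?_
    by_cases ha : good a
    · have := hc (Sum.inl a)
      simp only [f₁, if_pos ha, hv₁, mul_add, ← mul_assoc, Finset.sum_add_distrib,
          ← Finset.sum_mul, hcτ, zero_mul, add_zero] at this
      exact this
    · refine Finset.sum_eq_zero fun j _ => ?_
      have h1 : conn D B j h a = conn D B j 0 a := conn_congr (hh a ha) fun c hc =>
        hh c (mt (hgood (hB j a c hc)).2 ha)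
      rw [h1, map_zero, Pi.zero_apply, mul_zero]
  · rcases a with a | _ | a
    · by_cases ha : good a
      · obtain ⟨a1, a2, a3⟩ := hp a ha
        simp only [f₁, if_pos ha, hs₁, conn_single, Pi.single_eq_same, mul_one]
        have h1 := (hsymm a1 j).sub (ordGE_logDeriv (d j) (γ j) e a2)
        simp only [τ, if_pos ha]
        convert h1 using 1
        ring
      · simp only [f₁, if_neg ha, Pi.single_eq_same, Derivation.map_one_eq_zero]
        exact ordGE_zero 0
    · simp only [f₂, Pi.single_eq_same, Derivation.map_one_eq_zero]
      exact ordGE_zero 0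
    · have : (Pi.single (Sum.inr (some a)) 1 : ι ⊕ Option ι → F⸨X⸩) (Sum.inr none) = 0 := by simp
      simp only [f₃, Pi.single_eq_same, Derivation.map_one_eq_zero, this, mul_zero, add_zero]
      exact ordGE_zero 0

end Split

/-! ### Truncation of a regular connection to the coefficient field. -/

section Truncation

open HahnSeries

open scoped LaurentSeries

variable {F : Type u} [Field F] {n : ℕ} {d : Fin n → Der F} {γ : Fin n → F} {e : ℕ}
  {ι : Type} [Fintype ι] [DecidableEq ι] {P : Fin n → F} {k₀ : Fin n} {ρ : ι → ℕ}
  {B : Fin n → ι → ι → F⸨X⸩} {h : ι → F⸨X⸩}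

theorem coeff_C_mul' (a : F) (x : F⸨X⸩) (k : ℤ) : (C a * x).coeff k = a * x.coeff k := by
  rw [C_apply, coeff_single_zero_mul]

/-- A flat triangular connection with regular diagonal entries over the field of Laurent series
over `F` induces one on the truncated series. -/
theorem IsTri.truncate
    (H : IsTri (fun i => laurentDeriv (d i) (γ i) e) (fun j => C (P j)) k₀ ρ B h)
    (hreg : ∀ j a, OrdGE 0 (B j a a)) :
    ∃ (κ : Type) (_ : Fintype κ) (_ : DecidableEq κ) (ρ' : κ → ℕ) (B' : Fin n → κ → κ → F)
      (h' : κ → F), IsTri d P k₀ ρ' B' h' := by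
  set D : Fin n → Der F⸨X⸩ := fun i => laurentDeriv (d i) (γ i) e with hD
  obtain ⟨R, hR⟩ : ∃ R, ∀ a, ρ a ≤ R :=
    ⟨∑ a, ρ a, fun a => Finset.single_le_sum (fun _ _ => Nat.zero_le _) (Finset.mem_univ a)⟩
  -- the weights of a stable lattice
  obtain ⟨c₁, hc₁, hB⟩ := exists_ordGE_forall fun x : Fin n × ι × ι => B x.1 x.2.1 x.2.2
  obtain ⟨c₂, hc₂, hh⟩ := exists_ordGE_forall h
  obtain ⟨C', hC'⟩ := exists_left_inverse H.indep
  obtain ⟨c₃, hc₃, hC⟩ := exists_ordGE_forall fun x : Fin n × ι => C' x.1 x.2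
  -- Each unit of rank raises the weight by `-c₁`, enough to absorb the poles of the off-diagonal
  -- entries; the diagonal entries have none. The constant keeps `w ≤ c₂`, so that `h` lies in the
  -- lattice.
  let w : ι → ℤ := fun a => c₂ + c₁ * R - c₁ * ρ a
  have hw₁ : ∀ a, w a ≤ c₂ := fun a => by
    have : c₁ * (R : ℤ) ≤ c₁ * ρ a := mul_le_mul_of_nonpos_left (by exact_mod_cast hR a) hc₁
    simp only [w]
    linarith
  have hw₂ : ∀ a, c₂ + c₁ * R ≤ w a := fun a => by
    have : c₁ * (ρ a : ℤ) ≤ 0 := mul_nonpos_of_nonpos_of_nonneg hc₁ (Nat.cast_nonneg _)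
    simp only [w]
    linarith
  have hw₃ : ∀ a b, ρ a < ρ b → w a ≤ c₁ + w b := fun a b hab => by
    have : c₁ * (ρ b : ℤ) ≤ c₁ * (ρ a + 1) :=
      mul_le_mul_of_nonpos_left (by exact_mod_cast hab) hc₁
    simp only [w]
    linarith
  let Λ : ℤ → (ι → F⸨X⸩) → Prop := fun m v => ∀ a, OrdGE (w a + m) (v a)
  have hΛ : ∀ j m v, Λ m v → Λ m (conn D B j v) := fun j m v hv a => by
    rw [conn_apply]
    refine (hv a).laurentDeriv.add (OrdGE.sum fun b _ => ?_)
    by_cases hab : B j a b = 0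
    · rw [hab, zero_mul]
      exact ordGE_zero _
    rcases (H.tri j a b hab).lt_or_eq with h1 | h1
    · exact ((hB (j, a, b)).mul (hv b)).mono (by linarith [hw₃ a b h1])
    · obtain rfl := H.inj h1
      exact ((hreg j a).mul (hv a)).mono (by linarith)
  -- The truncation is so deep that applying the left inverse, with poles bounded by `c₃`, to a
  -- vector of `Λ K` gives series of positive order.
  obtain ⟨K, hK⟩ : ∃ K : ℕ, 1 ≤ c₃ + (c₂ + c₁ * R + K) :=
    ⟨(1 - (c₃ + (c₂ + c₁ * R))).toNat, by
      have := Int.self_le_toNat (1 - (c₃ + (c₂ + c₁ * R)))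
      linarith⟩
  let tr : (ι → F⸨X⸩) →+ (ι × Fin K → F) :=
    { toFun := fun v a => (v a.1).coeff (w a.1 + a.2)
      map_zero' := rfl
      map_add' := fun _ _ => rfl }
  have htr : ∀ v a m, tr v (a, m) = (v a).coeff (w a + m) := fun _ _ _ => rfl
  let lf : (ι × Fin K → F) →+ (ι → F⸨X⸩) :=
    { toFun := fun v a => ∑ m : Fin K, single (w a + m) (v (a, m))
      map_zero' := by
        ext1 a
        simp
      map_add' := fun v v' => by
        ext1 a
        simp [Finset.sum_add_distrib] }
  have hlf : ∀ v a, lf v a = ∑ m : Fin K, single (w a + m) (v (a, m)) := fun _ _ => rfl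
  have htl : ∀ v, tr (lf v) = v := fun v => by
    ext ⟨a, m⟩
    rw [htr, hlf, coeff_sum, Fintype.sum_eq_single m]
    · rw [coeff_single_same]
    · intro m' hm
      rw [coeff_single_of_ne]
      intro h0
      exact hm (Fin.ext (by omega))
  have hlfΛ : ∀ v, Λ 0 (lf v) := fun v a =>
    OrdGE.sum fun m _ => (ordGE_single _ _).mono (by omega)
  have hΛK : ∀ v, Λ 0 v → tr v = 0 → Λ K v := fun v hv h0 a k hk => by
    by_cases h1 : k < w a
    · exact hv a k (by omega)
    · have h2 := congrFun h0 (a, ⟨(k - w a).toNat, by omega⟩)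
      rw [htr] at h2
      rw [← show w a + ((⟨(k - w a).toNat, by omega⟩ : Fin K) : ℕ) = k by
        show w a + ((k - w a).toNat : ℤ) = k
        omega]
      exact h2
  have htrΛ : ∀ v, Λ K v → tr v = 0 := fun v hv => by
    ext ⟨a, m⟩
    exact hv a _ (by have := m.2; dsimp only; omega)
  have hltΛ : ∀ v, Λ 0 v → Λ K (v - lf (tr v)) := fun v hv =>
    hΛK _ (fun a => (hv a).sub (hlfΛ _ a)) (by rw [map_sub, htl, sub_self])
  have hCtr : ∀ (c : F) v, tr ((C c : F⸨X⸩) • v) = c • tr v := fun c v => by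
    ext ⟨a, m⟩
    rw [htr, Pi.smul_apply, smul_eq_mul, coeff_C_mul', Pi.smul_apply, htr, smul_eq_mul]
  have hClf : ∀ (c : F) v, lf (c • v) = (C c : F⸨X⸩) • lf v := fun c v => by
    ext1 a
    simp only [hlf, Pi.smul_apply, smul_eq_mul, Finset.mul_sum, C_apply, single_mul_single,
      zero_add]
  let f : Fin n → (ι × Fin K → F) →+ (ι × Fin K → F) := fun j => tr.comp ((conn D B j).comp lf)
  have hf₁ : ∀ j v, f j v = tr (conn D B j (lf v)) := fun _ _ => rfl
  -- Since `∇` preserves `Λ K`, it descends to `Λ 0 / Λ K`; `lf` is merely a choice of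
  -- representatives.
  have hf₂ : ∀ j v, Λ 0 v → f j (tr v) = tr (conn D B j v) := fun j v hv => by
    have h1 := htrΛ _ (hΛ j K _ (hltΛ v hv))
    rw [map_sub, map_sub, sub_eq_zero] at h1
    exact h1.symm
  have hf : ∀ j (c : F) v, f j (c • v) = d j c • v + c • f j v := fun j c v => by
    rw [hf₁, hClf, conn_smul, map_add, hCtr]
    have : D j (C c) = C (d j c) := laurentDeriv_C _ _ _ _
    rw [this, hCtr, htl, hf₁]
  have hconn := conn_eq_of_smul hf
  have hhΛ : Λ 0 h := fun a => (hh a).mono (by linarith [hw₁ a])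
  have hA : ∀ c : Fin n → F, (∑ j, c j • f j (tr h)) =
      tr (∑ j, (C (c j) : F⸨X⸩) • conn D B j h) := fun c => by
    rw [map_sum]
    exact Finset.sum_congr rfl fun j _ => by rw [hCtr, hf₂ j h hhΛ]
  -- The connection can only raise the degree relative to the weights, so the degree enters the rank
  -- reversed, and the old rank breaks ties.
  refine ⟨ι × Fin K, inferInstance, inferInstance, fun a => (K - a.2) * (R + 1) + ρ a.1,
    fun j a b => f j (Pi.single b 1) a, tr h, ?_, ?_, fun i j v => ?_, fun a => ?_,
    fun c hc0 hc => ?_⟩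
  · rintro ⟨a, m⟩ ⟨b, m'⟩ h0
    simp only at h0
    have h1 := hR a
    have h2 := hR b
    have h3 : K - (m : ℕ) = K - (m' : ℕ) := by
      rcases lt_trichotomy (K - (m : ℕ)) (K - (m' : ℕ)) with h | h | h
      · have := Nat.mul_le_mul_right (R + 1) (Nat.succ_le_of_lt h)
        rw [Nat.succ_mul] at this
        omega
      · exact h
      · have := Nat.mul_le_mul_right (R + 1) (Nat.succ_le_of_lt h)
        rw [Nat.succ_mul] at this
        omega
    rw [h3] at h0
    have h4 := m.2
    have h5 := m'.2
    have h6 : ρ a = ρ b := by omega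
    have h7 : (m : ℕ) = m' := by omega
    exact Prod.ext (H.inj h6) (Fin.ext h7)
  · rintro j ⟨a, m⟩ ⟨b, m'⟩ h0
    simp only at h0 ⊢
    have h1 : lf (Pi.single (b, m') 1) = (single (w b + m') 1 : F⸨X⸩) • Pi.single b 1 := by
      ext1 c
      rw [hlf, Fintype.sum_eq_single m']
      · rcases eq_or_ne c b with rfl | hcb
        · simp
        · simp [hcb]
      · intro m₂ hm₂
        rw [Pi.single_eq_of_ne (by simp [hm₂]), single_eq_zero]
    have h2 : Λ m' (lf (Pi.single (b, m') 1)) := fun c => by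
      rw [h1, Pi.smul_apply, smul_eq_mul]
      rcases eq_or_ne c b with rfl | hcb
      · rw [Pi.single_eq_same, mul_one]
        exact ordGE_single _ _
      · rw [Pi.single_eq_of_ne hcb, mul_zero]
        exact ordGE_zero _
    have h3 : m' ≤ m := by
      by_contra! h4
      refine h0 (hΛ j _ _ h2 a _ ?_)
      have : (m : ℕ) < m' := h4
      dsimp only
      omega
    have h4 : ρ a ≤ ρ b := by
      by_contra! h5
      refine h0 ?_
      have hne : a ≠ b := fun h6 => by
        rw [h6] at h5
        exact lt_irrefl _ h5
      rw [hf₁, h1, conn_smul, htr, Pi.add_apply, Pi.smul_apply, Pi.smul_apply, conn_single,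
        H.eq_zero h5, Pi.single_eq_of_ne hne, smul_zero, smul_zero, add_zero, coeff_zero]
    have h5 : (m' : ℕ) ≤ m := h3
    exact add_le_add (Nat.mul_le_mul_right _ (by omega)) h4
  · rw [hconn, hconn, hf₁ j v, hf₁ i v, hf₂ _ _ (hΛ _ _ _ (hlfΛ v)), hf₂ _ _ (hΛ _ _ _ (hlfΛ v)),
      H.comm i j]
  · simp only [hconn]
    have h1 := congrFun (hA P) a
    have h2 : (∑ j, (C (P j) : F⸨X⸩) • conn D B j h) = 0 := by
      ext1 b
      rw [Finset.sum_apply]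
      exact H.proj b
    rw [h2, map_zero, Finset.sum_apply] at h1
    exact h1
  · simp only [hconn] at hc
    have h1 : tr (∑ j, (C (c j) : F⸨X⸩) • conn D B j h) = 0 := by
      rw [← hA]
      ext1 a
      rw [Finset.sum_apply]
      exact hc a
    have h2 : Λ K (∑ j, (C (c j) : F⸨X⸩) • conn D B j h) := by
      refine hΛK _ (fun a => ?_) h1
      rw [Finset.sum_apply]
      refine OrdGE.sum fun j _ => ?_
      rw [Pi.smul_apply, smul_eq_mul]
      exact ((ordGE_C (c j)).mul (hΛ j 0 h hhΛ a)).mono (by omega)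
    ext j
    rcases eq_or_ne j k₀ with rfl | hj
    · rw [hc0]
      rfl
    have h3 := indep_of_left_inverse hC' (c := fun j => C (c j)) (by simp [hc0]) hj
    -- A constant series of positive order is zero: this is where independence survives truncation.
    have h4 : OrdGE 1 (C (c j) : F⸨X⸩) := by
      rw [h3]
      refine OrdGE.sum fun a _ => ((hC (j, a)).mul (OrdGE.mono (k := w a + K) ?_ le_rfl)).mono ?_
      · have := h2 a
        rwa [Finset.sum_apply] at this
      · linarith [hw₂ a]
    have h5 := h4 0 zero_lt_one
    rwa [C_apply, coeff_single_same] at h5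

end Truncation

/-! ### One step of descent along a Liouvillian tower. -/

section Descent

variable {Ω : Type u} [Field Ω] [CharZero Ω] [IsAlgClosed Ω] {n : ℕ} {d : Fin n → Der Ω}
  {P : Fin n → Ω} {k₀ : Fin n}

open scoped IntermediateField in
/-- Connections descend along the algebraic closure of an extension by a primitive or an
exponential. -/
theorem HasTri.descend (hd : ∀ i j a, d i (d j a) = d j (d i a)) {S : Subfield Ω}
    (hS : IsStable d S) (hSc : ∀ x : Ω, IsAlgebraic S x → x ∈ S) {t : Ω} (ht : Transcendental S t)
    (htS : (∀ i, d i t ∈ S) ∨ (∀ i, d i t / t ∈ S)) (hP : ∀ j, P j ∈ S)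
    (H : HasTri d P k₀ (algClosure S⟮t⟯.toSubfield)) : HasTri d P k₀ S := by
  classical
  obtain ⟨ι, _, _, ρ, B, h, hB, hh, H⟩ := H
  obtain ⟨γ, e, hγ, T, hST, hT, ψ, hZ, hψS, hψ⟩ := exists_laurent_embedding hd hS hSc ht htS
    (Finset.univ.image (fun x : Fin n × ι × ι => B x.1 x.2.1 x.2.2) ∪ Finset.univ.image h)
    (fun z hz => by
      rw [Finset.mem_union, Finset.mem_image, Finset.mem_image] at hz
      rcases hz with ⟨x, _, rfl⟩ | ⟨a, _, rfl⟩
      · exact mem_algClosure.1 (hB _ _ _)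
      · exact mem_algClosure.1 (hh _))
  have hBT : ∀ j a b, B j a b ∈ T := fun j a b => hZ _ (Finset.mem_union_left _
    (Finset.mem_image.2 ⟨(j, a, b), Finset.mem_univ _, rfl⟩))
  have hhT : ∀ a, h a ∈ T := fun a => hZ _ (Finset.mem_union_right _
    (Finset.mem_image.2 ⟨a, Finset.mem_univ _, rfl⟩))
  have hdS : ∀ i j a, (d i).restrict S (hS i) ((d j).restrict S (hS j) a) =
    (d j).restrict S (hS j) ((d i).restrict S (hS i) a) := fun i j a => Subtype.ext (hd i j a)
  have hcomm := fun i j => laurentDeriv_comm e (hdS i j) (hγ i j)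
  have H₁ := IsTri.restrict hd hT (P := fun j => ⟨P j, hST (hP j)⟩) (B := fun j a b => ⟨B j a b,
      hBT j a b⟩)
    (h := fun a => ⟨h a, hhT a⟩) H
  have H₂ := H₁.map (fun i j a => Subtype.ext (hd i j a)) hcomm ψ hψ
  have hψP : (fun j => ψ ⟨P j, hST (hP j)⟩) = fun j => HahnSeries.C (⟨P j, hP j⟩ : S) :=
    funext fun j => hψS ⟨P j, hP j⟩
  rw [hψP] at H₂
  obtain ⟨κ, _, _, ρ', B', h', H₃, hreg⟩ := H₂.exists_regular hcomm
  obtain ⟨κ', _, _, ρ'', B'', h'', H₄⟩ := H₃.truncate hreg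
  exact IsTri.hasTri hd hS H₄

end Descent

/-! ### Derivatives of determinants and nonvanishing minors. -/

section Determinant

variable {K : Type*} [Field K] {m : Type*} [Fintype m] [DecidableEq m]

theorem Der.map_prod {ι : Type*} [DecidableEq ι] (D : Der K) (s : Finset ι) (f : ι → K) :
    D (∏ i ∈ s, f i) = ∑ i ∈ s, D (f i) * ∏ j ∈ s.erase i, f j := by
  induction s using Finset.induction_on with
  | empty => simp
  | insert a s ha ih =>
    rw [Finset.prod_insert ha, Finset.sum_insert ha, Der.leibniz, ih, Finset.erase_insert ha,
      Finset.mul_sum, add_comm, mul_comm (∏ i ∈ s, f i)]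
    congr 1
    refine Finset.sum_congr rfl fun i hi => ?_
    have hia : i ≠ a := fun h => ha (h ▸ hi)
    rw [Finset.erase_insert_of_ne hia.symm, Finset.prod_insert (by simp [ha])]
    ring

theorem Der.map_det (D : Der K) (M : Matrix m m K) :
    D M.det = ∑ k, (M.updateRow k fun l => D (M k l)).det := by
  have h : ∀ N : Matrix m m K, N.det = ∑ σ : Equiv.Perm m, Equiv.Perm.sign σ * ∏ i, N i (σ i) :=
    fun N => by
      rw [← Matrix.det_transpose, Matrix.det_apply']
      rfl
  rw [h, map_sum]
  simp only [h]
  rw [Finset.sum_comm]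
  refine Finset.sum_congr rfl fun σ _ => ?_
  rw [Der.leibniz, Derivation.map_intCast, mul_zero, add_zero, Der.map_prod, Finset.mul_sum]
  refine Finset.sum_congr rfl fun k _ => ?_
  rw [← Finset.mul_prod_erase _ _ (Finset.mem_univ k), Matrix.updateRow_self]
  congr 2
  refine Finset.prod_congr rfl fun i hi => ?_
  rw [Matrix.updateRow_ne (Finset.ne_of_mem_erase hi)]

theorem det_updateRow_sum_smul {κ : Type*} (M : Matrix m m K) (k : m) (s : Finset κ) (c : κ → K)
    (r : κ → m → K) : (M.updateRow k (∑ b ∈ s, c b • r b)).det =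
      ∑ b ∈ s, c b * (M.updateRow k (r b)).det := by
  classical
  induction s using Finset.induction_on with
  | empty =>
    rw [Finset.sum_empty, Finset.sum_empty]
    exact Matrix.det_eq_zero_of_row_eq_zero k fun j => by rw [Matrix.updateRow_self]; rfl
  | insert a s ha ih =>
    rw [Finset.sum_insert ha, Finset.sum_insert ha, Matrix.det_updateRow_add,
      Matrix.det_updateRow_smul, ih]

/-- Writing `M N = (M N M⁻¹) M`, replacing row `k` picks out the `k`-th diagonal entry of `M N M⁻¹`,
and the trace is invariant under conjugation. -/
theorem sum_det_updateRow_mul {M : Matrix m m K} (hM : M.det ≠ 0) (N : Matrix m m K) :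
    ∑ k, (M.updateRow k ((M * N) k)).det = N.trace * M.det := by
  have hu : IsUnit M.det := isUnit_iff_ne_zero.2 hM
  have h1 : ∀ k, (M * N) k = ∑ l, (M * N * M⁻¹) k l • M l := fun k => by
    have : M * N = M * N * M⁻¹ * M := by
      rw [Matrix.mul_assoc, Matrix.nonsing_inv_mul _ hu, Matrix.mul_one]
    conv_lhs => rw [this]
    ext j
    rw [Matrix.mul_apply, Finset.sum_apply]
    rfl
  have h2 : ∀ k, (M.updateRow k ((M * N) k)).det = (M * N * M⁻¹) k k * M.det := fun k => by
    rw [h1, Matrix.det_updateRow_sum, smul_eq_mul]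
  simp only [h2]
  rw [← Finset.sum_mul]
  congr 1
  have h3 : (M * N * M⁻¹).trace = N.trace := by
    rw [Matrix.trace_mul_comm, ← Matrix.mul_assoc, Matrix.nonsing_inv_mul _ hu, Matrix.one_mul]
  exact h3

/-- A matrix with a left inverse has a nonvanishing maximal minor. -/
theorem exists_minor_ne_zero {ι : Type*} [Fintype ι] {A : ι → m → K} {C : m → ι → K}
    (hC : ∀ j l, ∑ a, C j a * A a l = if j = l then 1 else 0) :
    ∃ σ : m → ι, (Matrix.of fun j => A (σ j)).det ≠ 0 := by
  classical
  by_contra! h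
  have h1 : (Matrix.of fun j l => ∑ a, C j a * A a l) = (1 : Matrix m m K) := by
    ext j l
    rw [Matrix.of_apply, hC, Matrix.one_apply]
  have h2 : (fun j => ∑ a, C j a • A a) = (1 : Matrix m m K) := by
    rw [← h1]
    ext j l
    simp
  -- Multilinear expansion of `det (C A) = 1` in the rows of `A`, as in the Cauchy–Binet formula.
  have h3 := (Matrix.detRowAlternating (R := K) (n := m)).toMultilinearMap.map_sum
    (fun j a => C j a • A a)
  simp only [MultilinearMap.map_smul_univ] at h3
  rw [h2] at h3
  have h4 : ∀ σ : m → ι, (Matrix.detRowAlternating (R := K) (n := m)).toMultilinearMap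
    (fun j => A (σ j)) = 0 := h
  simp only [h4, smul_zero, Finset.sum_const_zero] at h3
  have h5 : (1 : Matrix m m K).det = 0 := h3
  rw [Matrix.det_one] at h5
  exact one_ne_zero h5

end Determinant

/-! ### From triangular connections to closed forms, and from first integrals to connections. -/

section Divergence

variable {K : Type*} [Field K] {n : ℕ} {ι : Type*} [Fintype ι] [DecidableEq ι]
  {d : Fin n → Der K} {P : Fin n → K} {k₀ : Fin n} {ρ : ι → ℕ} {B : Fin n → ι → ι → K} {h : ι → K}

/-- The inverse integrating form provided by a triangular connection. -/
theorem IsTri.exists_form (H : IsTri d P k₀ ρ B h) (hd : ∀ i j a, d i (d j a) = d j (d i a))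
    (hP : P k₀ ≠ 0) : ∃ α : Fin n → K, (∀ i j, d i (α j) = d j (α i)) ∧
      ∑ j, P j * α j = -∑ j, d j (P j) := by
  classical
  obtain ⟨C, hC⟩ := exists_left_inverse H.indep
  let J := {j : Fin n // j ≠ k₀}
  let A : ι → J → K := fun a j => conn d B j h a
  obtain ⟨σ₀, hσ₀⟩ := exists_minor_ne_zero (A := A) (C := fun j : J => C j) (fun j l => by
    refine (hC j j.2 l l.2).trans ?_
    exact if_congr Subtype.ext_iff.symm rfl rfl)
  -- Maximality of the total rank makes every minor obtained by replacing a row with one of higher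
  -- rank vanish.
  obtain ⟨σ, hσ, hmax⟩ := Finset.exists_max_image
    (Finset.univ.filter fun σ : J → ι => (Matrix.of fun j => A (σ j)).det ≠ 0)
    (fun σ => ∑ j, ρ (σ j)) ⟨σ₀, by simpa using hσ₀⟩
  replace hσ : (Matrix.of fun j => A (σ j)).det ≠ 0 := (Finset.mem_filter.1 hσ).2
  set Q : Matrix J J K := Matrix.of fun j => A (σ j) with hQ
  have hzero : ∀ k b, ρ (σ k) < ρ b → (Q.updateRow k (A b)).det = 0 := fun k b hb => by
    by_contra h0
    have h1 : (Matrix.of fun j => A (Function.update σ k b j)) = Q.updateRow k (A b) := by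
      ext j l
      rcases eq_or_ne j k with rfl | hj
      · simp
      · simp [hj, hQ]
    have h2 := hmax (Function.update σ k b) (by
      rw [Finset.mem_filter, h1]
      exact ⟨Finset.mem_univ _, h0⟩)
    rw [← Finset.add_sum_erase _ _ (Finset.mem_univ k),
      ← Finset.add_sum_erase (a := k) _ _ (Finset.mem_univ k), Function.update_self] at h2
    have h3 : ∑ j ∈ Finset.univ.erase k, ρ (Function.update σ k b j) =
        ∑ j ∈ Finset.univ.erase k, ρ (σ j) := Finset.sum_congr rfl fun j hj => by
      rw [Function.update_of_ne (Finset.ne_of_mem_erase hj)]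
    omega
  -- the derivation along `P`
  let N : Matrix J J K := fun i j => d j (P i) - P i / P k₀ * d j (P k₀)
  let β : ι → ι → K := fun a b => ∑ i, P i * B i a b
  have hk₀ : ∀ a, conn d B k₀ h a = -∑ i : J, P i / P k₀ * A a i := fun a => by
    have := H.proj a
    rw [Fintype.sum_eq_add_sum_subtype_ne _ k₀] at this
    simp only [div_mul_eq_mul_div]
    rw [← Finset.sum_div, ← neg_div, eq_div_iff hP]
    linear_combination this
  -- Apply `∇ⱼ` to `∑ Pᵢ ∇ᵢ h = 0` and commute. The same relation eliminates `∇ h` in direction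
  -- `k₀`, which produces `N`.
  have hX : ∀ a (j : J), ∑ i, P i * d i (A a j) =
      -∑ b, β a b * A b j - ∑ i, A a i * N i j := fun a j => by
    have h1 : ∑ i, P i * conn d B i (conn d B j h) a = -∑ i, d j (P i) * conn d B i h a := by
      simp only [H.comm _ j]
      have h2 := congrArg (fun v => conn d B j v a)
        (show (∑ i, P i • conn d B i h) = 0 from by
          ext1 b
          rw [Finset.sum_apply]
          exact H.proj b)
      simp only [map_sum, Finset.sum_apply, conn_smul, Pi.add_apply, Pi.smul_apply, smul_eq_mul,
        Finset.sum_add_distrib, map_zero, Pi.zero_apply] at h2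
      linear_combination h2
    have h3 : ∀ i, conn d B i (conn d B j h) a = d i (A a j) + ∑ b, B i a b * A b j :=
      fun i => rfl
    simp only [h3, mul_add, Finset.sum_add_distrib] at h1
    rw [Fintype.sum_eq_add_sum_subtype_ne (fun i => d j (P i) * conn d B i h a) k₀, hk₀] at h1
    have h4 : ∑ b, β a b * A b j = ∑ i, P i * ∑ b, B i a b * A b j := by
      simp only [β, Finset.sum_mul, Finset.mul_sum]
      rw [Finset.sum_comm]
      simp only [mul_assoc]
    have h5 : ∑ i, A a i * N i j = ∑ i : J, d j (P i) * conn d B i h a -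
        d j (P k₀) * ∑ i : J, P i / P k₀ * A a i := by
      rw [Finset.mul_sum, ← Finset.sum_sub_distrib]
      refine Finset.sum_congr rfl fun i _ => ?_
      simp only [N, A]
      ring
    rw [h4, h5]
    linear_combination h1
  -- Triangularity of `β` allows only rows of rank at least that of `σ k`, and those of higher rank
  -- give zero minors; so `β` contributes only its diagonal entries.
  have hdet : ∑ i, P i * d i Q.det = (-∑ k, β (σ k) (σ k) - N.trace) * Q.det := by
    simp only [Der.map_det, Finset.mul_sum]
    rw [Finset.sum_comm]
    have h1 : ∀ k, ∑ i, P i * (Q.updateRow k fun l => d i (Q k l)).det =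
        -(β (σ k) (σ k) * Q.det) - (Q.updateRow k ((Q * N) k)).det := fun k => by
      rw [← det_updateRow_sum_smul]
      have h2 : (∑ i, P i • fun l => d i (Q k l)) =
          (∑ b, (-β (σ k) b) • A b) + (-1 : K) • (Q * N) k := by
        ext l
        simp only [Finset.sum_apply, Pi.smul_apply, smul_eq_mul, Pi.add_apply, Matrix.mul_apply]
        have := hX (σ k) l
        refine this.trans ?_
        simp only [neg_mul, Finset.sum_neg_distrib, one_mul]
        exact sub_eq_add_neg _ _
      rw [h2, Matrix.det_updateRow_add, Matrix.det_updateRow_smul, det_updateRow_sum_smul,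
        Fintype.sum_eq_single (σ k)]
      · have : Q.updateRow k (A (σ k)) = Q := Matrix.updateRow_eq_self Q k
        rw [this]
        ring
      · intro b hb
        by_cases hβ : β (σ k) b = 0
        · rw [hβ, neg_zero, zero_mul]
        · have h3 : ρ (σ k) ≤ ρ b := by
            by_contra! h4
            refine hβ (Finset.sum_eq_zero fun i _ => ?_)
            rw [H.eq_zero h4, mul_zero]
          rw [hzero k b (lt_of_le_of_ne h3 fun h4 => hb (H.inj h4).symm), mul_zero]
    simp only [h1, Finset.sum_sub_distrib, sum_det_updateRow_mul hσ, Finset.sum_neg_distrib]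
    rw [← Finset.sum_mul]
    ring
  have htr : N.trace = ∑ j, d j (P j) - (∑ j, P j * d j (P k₀)) / P k₀ := by
    rw [Fintype.sum_eq_add_sum_subtype_ne _ k₀,
      Fintype.sum_eq_add_sum_subtype_ne (fun j => P j * d j (P k₀)) k₀, add_div,
      mul_div_cancel_left₀ _ hP, Finset.sum_div, Matrix.trace]
    simp only [Matrix.diag, N, Finset.sum_sub_distrib, div_mul_eq_mul_div]
    ring
  -- The diagonal entries of `B` cancel the `β` term of the determinant equation, and the
  -- logarithmic derivative of `P k₀` cancels the excess of `N.trace` over the divergence.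
  refine ⟨fun i => d i Q.det / Q.det - d i (P k₀) / P k₀ + ∑ k, B i (σ k) (σ k), fun i j => ?_, ?_⟩
  · simp only [map_add, map_sub, map_sum, Derivation.leibniz_div, smul_eq_mul, hd i j,
      H.closed_diag hd i j]
    ring
  · simp only [mul_add, mul_sub, Finset.sum_add_distrib, Finset.sum_sub_distrib, ← mul_div_assoc]
    rw [← Finset.sum_div, ← Finset.sum_div, hdet, mul_div_cancel_right₀ _ hσ, htr]
    have : ∑ i, P i * ∑ k, B i (σ k) (σ k) = ∑ k, β (σ k) (σ k) := by
      simp only [β, Finset.mul_sum]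
      rw [Finset.sum_comm]
    rw [this]
    ring

/-- Functionally independent first integrals give a trivial connection. -/
theorem isTri_of_linearIndependent (hd : ∀ i j a, d i (d j a) = d j (d i a)) (hP : P k₀ ≠ 0)
    {H : Fin (n - 1) → K} (hH : ∀ a, ∑ j, P j * d j (H a) = 0)
    (hind : LinearIndependent K fun a j => d j (H a)) :
    IsTri d P k₀ (fun a : Fin (n - 1) => (a : ℕ)) (fun _ _ _ => 0) H := by
  have hc : ∀ j v a, conn d (fun _ _ _ => 0 : Fin n → Fin (n - 1) → Fin (n - 1) → K) j v a =
      d j (v a) := fun j v a => by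
    rw [conn_apply]
    simp
  have hn : 0 < n := Fin.pos k₀
  refine ⟨Fin.val_injective, fun _ _ _ h0 => absurd rfl h0, fun i j v => ?_, fun a => ?_,
    fun c hc0 hc1 => ?_⟩
  · ext a
    simp only [hc, hd i j]
  · simp only [hc, hH]
  · simp only [hc] at hc1
    let M : Matrix (Fin (n - 1)) (Fin n) K := Matrix.of fun a j => d j (H a)
    have hr : M.rank = n - 1 := by
      rw [LinearIndependent.rank_matrix (M := M) hind, Fintype.card_fin]
    -- The Jacobian matrix has rank `n - 1`, so `P` spans its kernel; a multiple of `P` with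
    -- vanishing component at `k₀` is zero.
    have hker : Module.finrank K (LinearMap.ker M.mulVecLin) = 1 := by
      have := LinearMap.finrank_range_add_finrank_ker M.mulVecLin
      rw [Module.finrank_fin_fun] at this
      rw [Matrix.rank] at hr
      omega
    have hmem : ∀ v : Fin n → K, (∀ a, ∑ j, v j * d j (H a) = 0) →
        v ∈ LinearMap.ker M.mulVecLin := fun v hv => by
      rw [LinearMap.mem_ker, Matrix.mulVecLin_apply]
      ext a
      rw [Matrix.mulVec, dotProduct, Pi.zero_apply, ← hv a]
      exact Finset.sum_congr rfl fun j _ => mul_comm _ _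
    have hP0 : (⟨P, hmem P hH⟩ : LinearMap.ker M.mulVecLin) ≠ 0 := fun h0 => hP (by
      have := congrArg Subtype.val h0
      exact congrFun this k₀)
    obtain ⟨x, hx⟩ := (finrank_eq_one_iff_of_nonzero' _ hP0).1 hker ⟨c, hmem c hc1⟩
    have hx' : x • P = c := congrArg Subtype.val hx
    have : x * P k₀ = 0 := by
      rw [← hc0, ← hx']
      rfl
    rw [← hx', (mul_eq_zero.1 this).resolve_right hP, zero_smul]

end Divergence

/-! ### Averaging over conjugates. -/

section Average

variable {Ω : Type u} [Field Ω] [CharZero Ω] {n : ℕ} {d : Fin n → Der Ω}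

theorem Der.map_prod_div {K ι : Type*} [Field K] (D : Der K) (s : Finset ι) {f : ι → K}
    (hf : ∀ i ∈ s, f i ≠ 0) : D (∏ i ∈ s, f i) / ∏ i ∈ s, f i = ∑ i ∈ s, D (f i) / f i := by
  classical
  rw [Der.map_prod, Finset.sum_div]
  refine Finset.sum_congr rfl fun i hi => ?_
  rw [← Finset.mul_prod_erase s f hi, mul_div_mul_right]
  exact Finset.prod_ne_zero_iff.2 fun j hj => hf j (Finset.mem_of_mem_erase hj)

/-- Averages over the conjugates, for elements which are algebraic over a differential field. -/
theorem exists_average [IsAlgClosed Ω] {S : Subfield Ω} (hS : IsStable d S) (Z : Finset Ω)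
    (hZ : ∀ z ∈ Z, IsAlgebraic S z) : ∃ (L : Subfield Ω) (T : Ω →ₗ[S] Ω), (∀ z ∈ Z, z ∈ L) ∧
      (∀ x ∈ L, T x ∈ S) ∧ (∀ i, ∀ x ∈ L, T (d i x) = d i (T x)) ∧ T 1 = 1 ∧
      ∀ a ∈ L, a ≠ 0 → ∃ b ∈ S, b ≠ 0 ∧ ∃ N : ℕ, N ≠ 0 ∧
        ∀ i, T (d i a / a) = (N : Ω)⁻¹ * (d i b / b) := by
  let L : IntermediateField S Ω := IntermediateField.adjoin S (Z : Set Ω)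
  have hfin : FiniteDimensional S L :=
    IntermediateField.finiteDimensional_adjoin fun z hz => (hZ z hz).isIntegral
  have hSL : S ≤ L.toSubfield := fun x hx => L.algebraMap_mem ⟨x, hx⟩
  have hLalg : ∀ x : L, IsAlgebraic S x := fun x => Algebra.IsAlgebraic.isAlgebraic x
  have hL : IsStable d L.toSubfield := fun i x hx =>
    derivation_mem_of_isAlgebraic (d i) (hS i) hSL hx
      ((hLalg ⟨x, hx⟩).algebraMap (A := Ω))
  have hσ : ∀ i (σ : L →ₐ[S] Ω) (x : L), d i (σ x) = σ ⟨d i x, hL i x x.2⟩ := fun i σ x =>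
    map_derivation_of_isAlgebraic (A := S) (T := L) σ.toRingHom
      ((d i).restrict L.toSubfield (hL i)) (d i) (fun a => by
        have h1 : σ (algebraMap S L a) = a := σ.commutes a
        have h2 : σ (algebraMap S L ⟨d i a, hS i a a.2⟩) = d i a := σ.commutes _
        exact (congrArg (d i) h1).trans h2.symm) (hLalg x)
  have hN : (Module.finrank S L : Ω) ≠ 0 := by
    exact_mod_cast (Module.finrank_pos (R := S) (M := L)).ne'
  have hN' : (Module.finrank S L : S) ≠ 0 := by
    exact_mod_cast (Module.finrank_pos (R := S) (M := L)).ne'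
  -- The normalized trace. The embeddings of `L` commute with the derivations, hence so does `T₀`;
  -- logarithmic derivatives go to those of the norm, divided by the degree.
  let T₀ : L →ₗ[S] Ω := (Algebra.linearMap S Ω).comp
    ((Module.finrank S L : S)⁻¹ • Algebra.trace S L)
  obtain ⟨T, hT⟩ := LinearMap.exists_extend (p := L.toSubmodule) T₀
  have hT₁ : ∀ x : L, T x = ((Module.finrank S L : S)⁻¹ * Algebra.trace S L x : S) := fun x =>
    LinearMap.congr_fun hT x
  have hT₂ : ∀ x : L, T x = (Module.finrank S L : Ω)⁻¹ * ∑ σ : L →ₐ[S] Ω, σ x := fun x => by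
    rw [hT₁, ← trace_eq_sum_embeddings Ω]
    push_cast
    rfl
  refine ⟨L.toSubfield, T, fun z hz => IntermediateField.subset_adjoin _ _ hz, fun x hx => ?_,
    fun i x hx => ?_, ?_, fun a ha ha0 => ?_⟩
  · rw [hT₁ ⟨x, hx⟩]
    exact Subtype.property _
  · rw [hT₂ ⟨x, hx⟩, hT₂ ⟨d i x, hL i x hx⟩, Der.leibniz, map_sum]
    simp only [hσ]
    have : d i ((Module.finrank S L : Ω)⁻¹) = 0 := by
      rw [Derivation.leibniz_inv, Derivation.map_natCast, smul_zero]
    rw [this, mul_zero, add_zero]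
  · have h1 := hT₁ (algebraMap S L 1)
    rw [Algebra.trace_algebraMap, nsmul_eq_mul, mul_one, inv_mul_cancel₀ hN', map_one] at h1
    exact h1
  · refine ⟨Algebra.norm S (⟨a, ha⟩ : L), Subtype.property _, ?_, Module.finrank S L,
      Module.finrank_pos.ne', fun i => ?_⟩
    · have : (⟨a, ha⟩ : L) ≠ 0 := fun h0 => ha0 (congrArg Subtype.val h0)
      exact_mod_cast Algebra.norm_ne_zero_iff.2 this
    · have h1 : ((Algebra.norm S (⟨a, ha⟩ : L) : S) : Ω) = ∏ σ : L →ₐ[S] Ω, σ ⟨a, ha⟩ :=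
        Algebra.norm_eq_prod_embeddings S Ω _
      have h2 : ∀ σ : L →ₐ[S] Ω, σ ⟨a, ha⟩ ≠ 0 := fun σ h0 => ha0
        (congrArg Subtype.val ((map_eq_zero σ).1 h0))
      have h3 : (⟨d i a / a, div_mem (hL i a ha) ha⟩ : L) = ⟨d i a, hL i a ha⟩ / ⟨a, ha⟩ := rfl
      rw [h1, Der.map_prod_div _ _ fun σ _ => h2 σ, hT₂ ⟨d i a / a, div_mem (hL i a ha) ha⟩, h3]
      simp only [map_div₀, hσ]

end Average

/-! ### Logarithmic forms. -/

section LogForms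

variable {Ω : Type u} [Field Ω] {n : ℕ}

/-- The forms `dR + ∑ c da/a` with coefficients `c` in `k` and functions `R`, `a` in `S`. -/
def logForms (d : Fin n → Der Ω) (k S : Subfield Ω) : AddSubmonoid (Fin n → Ω) :=
  AddSubmonoid.closure ({α | ∃ R ∈ S, α = fun i => d i R} ∪
    {α | ∃ c ∈ k, ∃ a ∈ S, a ≠ 0 ∧ α = fun i => c * (d i a / a)})

variable {d : Fin n → Der Ω} {k S : Subfield Ω}

theorem logForms_mono {T : Subfield Ω} (h : S ≤ T) : logForms d k S ≤ logForms d k T := by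
  refine AddSubmonoid.closure_mono (Set.union_subset_union ?_ ?_)
  · rintro _ ⟨R, hR, rfl⟩
    exact ⟨R, h hR, rfl⟩
  · rintro _ ⟨c, hc, a, ha, ha0, rfl⟩
    exact ⟨c, hc, a, h ha, ha0, rfl⟩

theorem exact_mem_logForms {R : Ω} (hR : R ∈ S) : (fun i => d i R) ∈ logForms d k S :=
  AddSubmonoid.subset_closure (Or.inl ⟨R, hR, rfl⟩)

theorem dlog_mem_logForms {c a : Ω} (hc : c ∈ k) (ha : a ∈ S) (ha0 : a ≠ 0) :
    (fun i => c * (d i a / a)) ∈ logForms d k S :=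
  AddSubmonoid.subset_closure (Or.inr ⟨c, hc, a, ha, ha0, rfl⟩)

theorem logForms_closed [CharZero Ω] (hd : ∀ i j a, d i (d j a) = d j (d i a))
    (hk : ∀ i, ∀ c ∈ k, d i c = 0) {α : Fin n → Ω} (hα : α ∈ logForms d k S) (i j : Fin n) :
    d i (α j) = d j (α i) := by
  induction hα using AddSubmonoid.closure_induction with
  | mem α h =>
    rcases h with ⟨R, _, rfl⟩ | ⟨c, hc, a, _, ha, rfl⟩
    · exact hd i j R
    · simp only [Der.leibniz, hk _ c hc, Derivation.leibniz_div, smul_eq_mul, hd i j]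
      ring
  | zero => simp
  | add α β _ _ h1 h2 => simp only [Pi.add_apply, map_add, h1, h2]

/-- Only finitely many functions occur in a logarithmic form. -/
theorem exists_finset_of_mem_logForms {α : Fin n → Ω} (hα : α ∈ logForms d k S) :
    ∃ Z : Finset Ω, (∀ z ∈ Z, z ∈ S) ∧ ∀ L : Subfield Ω, (∀ z ∈ Z, z ∈ L) → α ∈ logForms d k L := by
  classical
  induction hα using AddSubmonoid.closure_induction with
  | mem α h =>
    rcases h with ⟨R, hR, rfl⟩ | ⟨c, hc, a, haS, ha, rfl⟩
    · exact ⟨{R}, by simpa using hR, fun L hL => exact_mem_logForms (hL R (by simp))⟩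
    · exact ⟨{a}, by simpa using haS, fun L hL => dlog_mem_logForms hc (hL a (by simp)) ha⟩
  | zero => exact ⟨∅, by simp, fun L _ => zero_mem _⟩
  | add α β _ _ h1 h2 =>
    obtain ⟨Z, h1, h3⟩ := h1
    obtain ⟨Z', h2, h4⟩ := h2
    refine ⟨Z ∪ Z', fun z hz => ?_, fun L hL => add_mem (h3 L fun z hz => hL z ?_)
      (h4 L fun z hz => hL z ?_)⟩
    · rcases Finset.mem_union.1 hz with h | h
      exacts [h1 z h, h2 z h]
    · exact Finset.mem_union_left _ hz
    · exact Finset.mem_union_right _ hz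

/-- Linearity over `S ≥ k` lets the coefficients pass through `T`; the factor `1 / N` coming from
the norm is absorbed into the coefficient. -/
theorem average_mem_logForms {L : Subfield Ω} (hkS : k ≤ S) (T : Ω →ₗ[S] Ω)
    (hT₁ : ∀ x ∈ L, T x ∈ S) (hT₂ : ∀ i, ∀ x ∈ L, T (d i x) = d i (T x))
    (hT₃ : ∀ a ∈ L, a ≠ 0 → ∃ b ∈ S, b ≠ 0 ∧ ∃ N : ℕ, N ≠ 0 ∧
      ∀ i, T (d i a / a) = (N : Ω)⁻¹ * (d i b / b))
    {α : Fin n → Ω} (hα : α ∈ logForms d k L) : (fun i => T (α i)) ∈ logForms d k S := by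
  induction hα using AddSubmonoid.closure_induction with
  | mem α h =>
    rcases h with ⟨R, hR, rfl⟩ | ⟨c, hc, a, haL, ha, rfl⟩
    · simp only [hT₂ _ R hR]
      exact exact_mem_logForms (hT₁ R hR)
    · obtain ⟨b, hb, hb0, N, hN, h⟩ := hT₃ a haL ha
      have h1 : ∀ i, T (c * (d i a / a)) = c * (N : Ω)⁻¹ * (d i b / b) := fun i => by
        have : c * (d i a / a) = (⟨c, hkS hc⟩ : S) • (d i a / a) := rfl
        rw [this, map_smul, h, mul_assoc]
        rfl
      simp only [h1]
      exact dlog_mem_logForms (mul_mem hc (inv_mem (natCast_mem k N))) hb hb0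
  | zero =>
    simp only [Pi.zero_apply, map_zero]
    exact zero_mem _
  | add α β _ _ h1 h2 =>
    simp only [Pi.add_apply, map_add]
    exact add_mem h1 h2

end LogForms

/-! ### Integration of rational functions of one variable. -/

section PartialFractions

theorem order_eq_of_ordGE {F : Type u} [Field F] {x : LaurentSeries F} {k : ℤ} (hx : OrdGE k x)
    (hk : x.coeff k ≠ 0) : x.order = k := by
  have hx0 : x ≠ 0 := fun h => hk (by rw [h, HahnSeries.coeff_zero])
  refine le_antisymm (HahnSeries.order_le_of_coeff_ne_zero hk) ?_
  by_contra! h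
  exact hx0 (HahnSeries.coeff_order_eq_zero.1 (hx _ h))

open scoped IntermediateField LaurentSeries

variable {Ω : Type u} [Field Ω] {F : Subfield Ω} {t : Ω} {D : Der Ω}

theorem sub_ne_zero_of_transcendental (ht : Transcendental F t) {ρ : Ω} (hρ : ρ ∈ F) :
    t - ρ ≠ 0 := fun h => ht (by
  rw [sub_eq_zero.1 h]
  exact isAlgebraic_algebraMap (⟨ρ, hρ⟩ : F))

/-- Integration of rational functions. -/
theorem exists_primitive_add_sum [CharZero Ω] [IsAlgClosed F] (ht : Transcendental F t)
    (hDF : ∀ a ∈ F, D a = 0) (hDt : D t = 1) {y : Ω} (hy : y ∈ F⟮t⟯) :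
    ∃ R ∈ F⟮t⟯, ∃ c : F →₀ F, y = D R + c.sum fun ρ a => (a : Ω) / (t - ρ) := by
  classical
  let Good : Ω → Prop := fun y => ∃ R ∈ F⟮t⟯, ∃ c : F →₀ F,
    y = D R + c.sum fun ρ a => (a : Ω) / (t - ρ)
  have htm := IntermediateField.mem_adjoin_simple_self F t
  have hFm : ∀ a : F, (a : Ω) ∈ F⟮t⟯ := fun a => F⟮t⟯.algebraMap_mem a
  have hadd : ∀ x y, Good x → Good y → Good (x + y) := by
    rintro _ _ ⟨R, hR, c, rfl⟩ ⟨R', hR', c', rfl⟩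
    refine ⟨R + R', add_mem hR hR', c + c', ?_⟩
    rw [map_add, Finsupp.sum_add_index' (by simp) fun ρ a b => by push_cast; rw [add_div]]
    ring
  have hD : ∀ R ∈ F⟮t⟯, Good (D R) := fun R hR => ⟨R, hR, 0, by simp⟩
  have hsingle : ∀ ρ a : F, Good ((a : Ω) / (t - ρ)) := fun ρ a =>
    ⟨0, zero_mem _, Finsupp.single ρ a, by
      rw [map_zero, zero_add, Finsupp.sum_single_index (by simp)]⟩
  have hzero : Good 0 := by simpa using hD 0 (zero_mem _)
  have hpoly : ∀ q : Polynomial F, Good (Polynomial.aeval t q) := fun q => by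
    induction q using Polynomial.induction_on' with
    | add p q h1 h2 =>
      rw [map_add]
      exact hadd _ _ h1 h2
    | monomial m a =>
      have h1 := hD ((a : Ω) * t ^ (m + 1) * ((m + 1 : ℕ) : Ω)⁻¹)
        (mul_mem (mul_mem (hFm a) (pow_mem htm _)) (inv_mem (natCast_mem _ _)))
      have h2 : D (((m + 1 : ℕ) : Ω)⁻¹) = 0 := by
        rw [Derivation.leibniz_inv, Derivation.map_natCast, smul_zero]
      have h3 : ((m + 1 : ℕ) : Ω) ≠ 0 := Nat.cast_ne_zero.2 (Nat.succ_ne_zero m)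
      rw [Der.leibniz, Der.leibniz, h2, hDF a a.2, Derivation.leibniz_pow, hDt] at h1
      convert h1 using 1
      rw [Polynomial.aeval_monomial]
      simp only [Nat.add_sub_cancel, nsmul_eq_mul, smul_eq_mul, mul_one, mul_zero, add_zero,
        zero_add]
      field_simp
      exact mul_comm _ _
  have hpow : ∀ (ρ a : F) (j : ℕ), Good ((a : Ω) * (t - ρ)⁻¹ ^ (j + 1)) := fun ρ a j => by
    have hne := sub_ne_zero_of_transcendental ht ρ.2
    -- Only simple poles resist integration; the higher ones are derivatives.
    rcases j with _ | j
    · have := hsingle ρ a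
      rwa [zero_add, pow_one, ← div_eq_mul_inv]
    · have h1 := hD ((a : Ω) * (t - ρ)⁻¹ ^ (j + 1) * (-((j + 1 : ℕ) : Ω)⁻¹))
        (mul_mem (mul_mem (hFm a) (pow_mem (inv_mem (sub_mem htm (hFm ρ))) _))
          (neg_mem (inv_mem (natCast_mem _ _))))
      have h2 : D (-((j + 1 : ℕ) : Ω)⁻¹) = 0 := by
        rw [map_neg, Derivation.leibniz_inv, Derivation.map_natCast, smul_zero, neg_zero]
      have h3 : ((j + 1 : ℕ) : Ω) ≠ 0 := Nat.cast_ne_zero.2 (Nat.succ_ne_zero j)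
      rw [Der.leibniz, Der.leibniz, h2, hDF a a.2, Derivation.leibniz_pow, Derivation.leibniz_inv,
        map_sub, hDt, hDF ρ ρ.2] at h1
      convert h1 using 1
      simp only [Nat.add_sub_cancel, nsmul_eq_mul, smul_eq_mul, mul_one, mul_zero, add_zero,
        zero_add, sub_zero]
      have h4 : -((j + 1 : ℕ) : Ω)⁻¹ * (a * ((j + 1 : ℕ) * ((t - ρ)⁻¹ ^ j * -(t - ρ)⁻¹ ^ 2))) =
          (((j + 1 : ℕ) : Ω)⁻¹ * (j + 1 : ℕ)) * (a * (t - ρ)⁻¹ ^ (j + 1 + 1)) := by ring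
      rw [h4, inv_mul_cancel₀ h3, one_mul]
  obtain ⟨r, s, rfl⟩ := (IntermediateField.mem_adjoin_simple_iff F y).1 hy
  rcases eq_or_ne s 0 with rfl | hs
  · rw [map_zero, div_zero]
    exact hzero
  let _ : Algebra (Polynomial F) Ω := (Polynomial.aeval t).toRingHom.toAlgebra
  have hmap : ∀ p : Polynomial F, algebraMap (Polynomial F) Ω p = Polynomial.aeval t p :=
    fun _ => rfl
  obtain ⟨q, g, hg, h⟩ := Polynomial.mul_prod_pow_inverse_eq_quo_add_sum_rem_mul_pow_inverse (K :=
      Ω)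
    (s := s.roots.toFinset) (Polynomial.C s.leadingCoeff⁻¹ * r)
    (g := fun ρ => Polynomial.X - Polynomial.C ρ) (fun ρ _ => Polynomial.monic_X_sub_C ρ)
    (fun ρ _ ρ' _ hne => Polynomial.isCoprime_X_sub_C_of_isUnit_sub
      (isUnit_iff_ne_zero.2 (sub_ne_zero.2 hne))) (fun ρ => s.roots.count ρ)
    (gi := fun ρ => (t - ρ)⁻¹) (fun ρ _ => by
      rw [hmap, map_sub, Polynomial.aeval_X, Polynomial.aeval_C]
      exact inv_mul_cancel₀ (sub_ne_zero_of_transcendental ht ρ.2))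
  have hsp : Polynomial.aeval t s = s.leadingCoeff *
      ∏ ρ ∈ s.roots.toFinset, (t - (ρ : Ω)) ^ s.roots.count ρ := by
    conv_lhs => rw [(IsAlgClosed.splits s).eq_prod_roots, map_mul, Polynomial.aeval_C,
      Finset.prod_multiset_map_count, map_prod]
    congr 1
    refine Finset.prod_congr rfl fun ρ _ => ?_
    rw [map_pow, map_sub, Polynomial.aeval_X, Polynomial.aeval_C]
    rfl
  have hy' : Polynomial.aeval t r / Polynomial.aeval t s =
      Polynomial.aeval t q + ∑ ρ ∈ s.roots.toFinset, ∑ j,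
        algebraMap (Polynomial F) Ω (g ρ j) * (t - ρ)⁻¹ ^ (j.1 + 1) := by
    rw [← hmap q, ← h, hmap, map_mul, Polynomial.aeval_C, hsp]
    simp only [inv_pow, Finset.prod_inv_distrib]
    rw [map_inv₀, div_eq_mul_inv, mul_inv]
    have : algebraMap F Ω s.leadingCoeff = s.leadingCoeff := rfl
    rw [this]
    ring
  have hsum : ∀ {κ : Type u} (s : Finset κ) (f : κ → Ω), (∀ i ∈ s, Good (f i)) →
      Good (∑ i ∈ s, f i) := fun s f hf => Finset.sum_induction f Good hadd hzero hf
  have hsum' : ∀ {m : ℕ} (f : Fin m → Ω), (∀ i, Good (f i)) → Good (∑ i, f i) := fun f hf =>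
    Finset.sum_induction f Good hadd hzero fun i _ => hf i
  rw [hy']
  refine hadd _ _ (hpoly q) (hsum _ _ fun ρ hρ => hsum' _ fun j => ?_)
  have hdeg := hg ρ hρ j
  rw [Polynomial.degree_X_sub_C] at hdeg
  rw [Polynomial.eq_C_of_degree_le_zero (Order.le_of_lt_succ hdeg), hmap, Polynomial.aeval_C]
  exact hpow ρ _ j

/-- A sum of simple fractions which has a rational primitive vanishes. -/
theorem eq_zero_of_sum_eq_derivation (ht : Transcendental F t)
    (hDF : ∀ a ∈ F, D a = 0) (hDt : D t = 1) {G : Ω} (hG : G ∈ F⟮t⟯) {c : F →₀ F}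
    (hc : D G = c.sum fun ρ a => (a : Ω) / (t - ρ)) : c = 0 := by
  classical
  ext ρ
  have ht' : Transcendental F (t - ρ) := fun h => ht (by
    have := h.add (isAlgebraic_algebraMap (A := Ω) ρ)
    have h1 : t - ρ + algebraMap F Ω ρ = t := sub_add_cancel _ _
    rwa [h1] at this)
  obtain ⟨ψ, hψ⟩ := exists_algHom_of_transcendental ht' (transcendental_single (F := F) one_ne_zero)
  have htm : t ∈ F⟮t - (ρ : Ω)⟯ := by
    have := add_mem (IntermediateField.mem_adjoin_simple_self F (t - (ρ : Ω)))
      (F⟮t - (ρ : Ω)⟯.algebraMap_mem ρ)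
    have h1 : t - ρ + algebraMap F Ω ρ = t := sub_add_cancel _ _
    rwa [h1] at this
  have hGm : G ∈ F⟮t - (ρ : Ω)⟯ := IntermediateField.adjoin_simple_le_iff.2 htm hG
  have hm' := IntermediateField.mem_adjoin_simple_self F (t - (ρ : Ω))
  have hψC : ∀ a : F, ψ (algebraMap F _ a) = HahnSeries.C a := fun a => by
    rw [ψ.commutes, algebraMap_eq_C]
  -- In the expansion at `ρ` this is `s d/ds`, which multiplies the coefficient of degree `k` by
  -- `k`. Hence `D' G` has constant term zero, whereas for the sum of fractions it is the residue `c
  -- ρ`.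
  let D' : Der Ω := (t - (ρ : Ω)) • D
  have hD' : ∀ x, D' x = (t - ρ) * D x := fun _ => rfl
  have hst : ∀ x ∈ F⟮t - (ρ : Ω)⟯, D' x ∈ F⟮t - (ρ : Ω)⟯ := fun x hx =>
    derivation_mem_adjoin D' (fun a => by
      have : D' (algebraMap F Ω a) = 0 := by rw [hD', show algebraMap F Ω a = a from rfl,
        hDF a a.2, mul_zero]
      rw [this]
      exact zero_mem _) (by
      rw [hD', map_sub, hDt, hDF ρ ρ.2, sub_zero, mul_one]
      exact hm') hx
  have h1 := map_derivation_of_mem_adjoin D' (laurentDeriv (0 : Der F) 1 0) ψ.toRingHom hst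
    (fun a => by
      have h2 : (⟨D' (algebraMap F Ω a), hst _ (F⟮t - (ρ : Ω)⟯.algebraMap_mem a)⟩ :
          F⟮t - (ρ : Ω)⟯) = 0 := Subtype.ext (by
        show D' a = 0
        rw [hD', hDF a a.2, mul_zero])
      rw [h2, map_zero]
      show laurentDeriv _ _ _ (ψ _) = 0
      rw [hψC, laurentDeriv_C, Derivation.zero_apply, map_zero])
    (by
      have h2 : (⟨D' (t - ρ), hst _ hm'⟩ : F⟮t - (ρ : Ω)⟯) =
          IntermediateField.AdjoinSimple.gen F (t - (ρ : Ω)) := Subtype.ext (by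
        show D' (t - ρ) = t - ρ
        rw [hD', map_sub, hDt, hDF ρ ρ.2, sub_zero, mul_one])
      rw [h2]
      show laurentDeriv _ _ _ (ψ _) = ψ _
      rw [hψ, laurentDeriv_single]
      simp) ⟨G, hGm⟩
  have h3 : (⟨D' G, hst G hGm⟩ : F⟮t - (ρ : Ω)⟯) = c.sum fun σ a =>
      algebraMap F _ a * (IntermediateField.AdjoinSimple.gen F (t - (ρ : Ω)) /
        (IntermediateField.AdjoinSimple.gen F (t - (ρ : Ω)) + algebraMap F _ (ρ - σ))) := by
    apply Subtype.ext
    show D' G = _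
    rw [hD', hc, Finsupp.sum, Finsupp.sum, Finset.mul_sum]
    push_cast
    refine Finset.sum_congr rfl fun σ _ => ?_
    rw [IntermediateField.AdjoinSimple.coe_gen]
    show (t - (ρ : Ω)) * ((c σ : Ω) / (t - σ)) = (c σ : Ω) * ((t - ρ) / (t - ρ + (ρ - σ : F)))
    push_cast
    rw [sub_add_sub_cancel]
    ring
  rw [h3] at h1
  have h4 := congrArg (fun x : F⸨X⸩ => x.coeff 0) h1
  simp only [coeff_laurentDeriv] at h4
  have h5 : ∀ σ : F, (ψ (algebraMap F _ (c σ) * (IntermediateField.AdjoinSimple.gen F (t - (ρ : Ω))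
      /
        (IntermediateField.AdjoinSimple.gen F (t - (ρ : Ω)) + algebraMap F _ (ρ - σ))))).coeff 0 =
        if σ = ρ then c σ else 0 := fun σ => by
    rw [map_mul, map_div₀, map_add, hψ, hψC, hψC]
    split_ifs with hσ
    · rw [hσ, sub_self, map_zero, add_zero, div_self, mul_one, HahnSeries.C_apply,
        HahnSeries.coeff_single_same]
      exact HahnSeries.single_ne_zero one_ne_zero
    · have hcoeff : (HahnSeries.single 1 1 + HahnSeries.C (ρ - σ) : F⸨X⸩).coeff 0 ≠ 0 := by
        rw [HahnSeries.coeff_add, HahnSeries.coeff_single_of_ne (by norm_num), zero_add,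
          HahnSeries.C_apply, HahnSeries.coeff_single_same]
        exact sub_ne_zero.2 (Ne.symm hσ)
      have h6 : (HahnSeries.single 1 1 + HahnSeries.C (ρ - σ) : F⸨X⸩).order = 0 :=
        order_eq_of_ordGE (((ordGE_single 1 1).mono (by norm_num)).add (ordGE_C _)) hcoeff
      have h7 := (ordGE_C (c σ)).mul ((ordGE_single 1 (1 : F)).mul (ordGE_inv (x :=
        (HahnSeries.single 1 1 + HahnSeries.C (ρ - σ) : F⸨X⸩)) fun h0 => hcoeff
            (by rw [h0, HahnSeries.coeff_zero])))
      rw [h6] at h7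
      rw [div_eq_mul_inv]
      exact h7 0 (by norm_num)
  have h8 : (ψ (c.sum fun σ a => algebraMap F _ a *
      (IntermediateField.AdjoinSimple.gen F (t - (ρ : Ω)) /
        (IntermediateField.AdjoinSimple.gen F (t - (ρ : Ω)) + algebraMap F _ (ρ - σ))))).coeff 0 =
      c ρ := by
    rw [Finsupp.sum, map_sum, HahnSeries.coeff_sum]
    simp only [h5]
    rw [Finset.sum_ite_eq']
    simp only [Finsupp.mem_support_iff, ne_eq, ite_eq_left_iff, not_not]
    exact fun h => h.symm
  have h9 : c ρ = 0 := by
    rw [← h8]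
    refine Eq.trans h4.symm ?_
    simp
  rw [h9]
  rfl

end PartialFractions

/-! ### Constants of rational and algebraic extensions. -/

section Constants

open scoped IntermediateField LaurentSeries

variable {Ω : Type u} [Field Ω] {n : ℕ}

theorem derivation_eq_zero_of_isAlgebraic [CharZero Ω] {S : Subfield Ω} (D : Der Ω)
    (h : ∀ y ∈ S, D y = 0) {y : Ω} (hy : IsAlgebraic S y) : D y = 0 := by
  have := map_derivation_of_isAlgebraic (A := S) (RingHom.id Ω) D 0
    (fun a => (h a a.2).symm) hy
  exact this.symm

/-- The constants of a rational function field in one variable. -/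
theorem mem_of_derivation_eq_zero [CharZero Ω] {F : Subfield Ω} {t : Ω} {D : Der Ω}
    (ht : Transcendental F t) (hDF : ∀ a ∈ F, D a = 0) (hDt : D t = 1) {y : Ω} (hy : y ∈ F⟮t⟯)
    (hDy : D y = 0) : y ∈ F := by
  obtain ⟨ψ, hψ⟩ := exists_algHom_of_transcendental ht (transcendental_single (F := F) one_ne_zero)
  have htm := IntermediateField.mem_adjoin_simple_self F t
  have hψC : ∀ a : F, ψ (algebraMap F _ a) = HahnSeries.C a := fun a => by
    rw [ψ.commutes, algebraMap_eq_C]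
  -- In the expansion at `t = 0` this is `s d/ds`, so an element it kills has only a constant term.
  let D' : Der Ω := t • D
  have hD' : ∀ x, D' x = t * D x := fun _ => rfl
  have hF : ∀ a : F, D' (algebraMap F Ω a) = 0 := fun a => by
    rw [hD', show algebraMap F Ω a = a from rfl, hDF a a.2, mul_zero]
  have hst : ∀ x ∈ F⟮t⟯, D' x ∈ F⟮t⟯ := fun x hx =>
    derivation_mem_adjoin D' (fun a => by
      rw [hF]
      exact zero_mem _) (by rwa [hD', hDt, mul_one]) hx
  have h1 := map_derivation_of_mem_adjoin D' (laurentDeriv (0 : Der F) 1 0) ψ.toRingHom hst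
    (fun a => by
      rw [show (⟨D' (algebraMap F Ω a), hst _ (F⟮t⟯.algebraMap_mem a)⟩ : F⟮t⟯) = 0 from
        Subtype.ext (hF a), map_zero]
      show laurentDeriv _ _ _ (ψ _) = 0
      rw [hψC, laurentDeriv_C, Derivation.zero_apply, map_zero])
    (by
      rw [show (⟨D' t, hst _ htm⟩ : F⟮t⟯) = IntermediateField.AdjoinSimple.gen F t from
        Subtype.ext (show D' t = t by rw [hD', hDt, mul_one])]
      show laurentDeriv _ _ _ (ψ _) = ψ _
      rw [hψ, laurentDeriv_single]
      simp) ⟨y, hy⟩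
  have h2 : (⟨D' y, hst y hy⟩ : F⟮t⟯) = 0 := Subtype.ext (show D' y = 0 by rw [hD', hDy, mul_zero])
  rw [h2, map_zero] at h1
  have h3 : ψ ⟨y, hy⟩ = HahnSeries.C ((ψ ⟨y, hy⟩).coeff 0) := by
    ext j
    rw [HahnSeries.C_apply]
    rcases eq_or_ne j 0 with rfl | hj
    · rw [HahnSeries.coeff_single_same]
    · rw [HahnSeries.coeff_single_of_ne hj]
      have h4 := congrArg (fun x : F⸨X⸩ => x.coeff j) h1
      simp only [coeff_laurentDeriv, Derivation.zero_apply, zero_add, mul_one, Nat.cast_zero,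
        sub_zero, HahnSeries.coeff_zero] at h4
      exact congrArg Subtype.val ((mul_eq_zero.1 h4).resolve_left (Int.cast_ne_zero.2 hj))
  rw [← hψC] at h3
  have h4 := ψ.toRingHom.injective h3
  rw [show y = algebraMap F Ω ((ψ ⟨y, hy⟩).coeff 0) from congrArg Subtype.val h4]
  exact Subtype.property _

/-- A constant which is algebraic over a differential field is algebraic over its constants. -/
theorem mem_of_isAlgebraic_of_constant [CharZero Ω] {d : Fin n → Der Ω} {k S : Subfield Ω}
    (hkc : ∀ x : Ω, IsAlgebraic k x → x ∈ k) (hS : IsStable d S)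
    (hconst : ∀ y ∈ S, (∀ i, d i y = 0) → y ∈ k) {c : Ω} (hc : IsAlgebraic S c)
    (hdc : ∀ i, d i c = 0) : c ∈ k := by
  have hint : IsIntegral S c := hc.isIntegral
  set p := minpoly S c with hp
  have hcoeff : ∀ j, (p.coeff j : Ω) ∈ k := fun j => by
    refine hconst _ (Subtype.property _) fun i => ?_
    -- The minimal polynomial with its coefficients differentiated. It still kills the constant `c`
    -- and, `p` being monic, has smaller degree; so it is zero and the coefficients are constants.
    let q : Polynomial S := ∑ l ∈ Finset.range p.natDegree,
      Polynomial.monomial l ⟨d i (p.coeff l), hS i _ (Subtype.property _)⟩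
    have h1 : Polynomial.aeval c q = 0 := by
      have h2 := congrArg (d i) (minpoly.aeval S c)
      rw [← hp, Polynomial.aeval_eq_sum_range, Finset.sum_range_succ, map_add, map_sum, map_zero,
        (minpoly.monic hint).coeff_natDegree, one_smul, Derivation.leibniz_pow, hdc,
        smul_zero, smul_zero, add_zero] at h2
      rw [map_sum, ← h2]
      refine Finset.sum_congr rfl fun l _ => ?_
      rw [Polynomial.aeval_monomial, Algebra.smul_def, Der.leibniz, Derivation.leibniz_pow, hdc,
        smul_zero, smul_zero, mul_zero, zero_add, mul_comm]
      rfl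
    have h2 : q = 0 := by
      by_contra h0
      have h3 := minpoly.degree_le_of_ne_zero S c h0 h1
      refine absurd h3 (not_le.2 ?_)
      rw [← hp, Polynomial.degree_eq_natDegree (minpoly.ne_zero hint)]
      refine (Polynomial.degree_sum_le _ _).trans_lt ?_
      rw [Finset.sup_lt_iff (WithBot.bot_lt_coe _)]
      intro l hl
      exact (Polynomial.degree_monomial_le _ _).trans_lt
        (WithBot.coe_lt_coe.2 (Nat.cast_lt.2 (Finset.mem_range.1 hl)))
    rcases lt_trichotomy j p.natDegree with hj | hj | hj
    · have h3 := congrArg (fun q => q.coeff j) h2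
      simp only [q, Polynomial.finsetSum_coeff, Polynomial.coeff_monomial, Polynomial.coeff_zero,
        Finset.sum_ite_eq', Finset.mem_range, if_pos hj] at h3
      exact congrArg Subtype.val h3
    · rw [hj, (minpoly.monic hint).coeff_natDegree]
      exact Derivation.map_one_eq_zero _
    · rw [Polynomial.coeff_eq_zero_of_natDegree_lt hj]
      exact map_zero _
  refine hkc c ⟨∑ l ∈ Finset.range (p.natDegree + 1), Polynomial.monomial l ⟨p.coeff l, hcoeff l⟩,
    fun h0 => ?_, ?_⟩
  · have h1 := congrArg (fun q => q.coeff p.natDegree) h0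
    simp only [Polynomial.finsetSum_coeff, Polynomial.coeff_monomial, Polynomial.coeff_zero,
      Finset.sum_ite_eq', Finset.mem_range, if_pos (Nat.lt_succ_self _)] at h1
    have h2 : ((p.coeff p.natDegree : S) : Ω) = 0 := congrArg Subtype.val h1
    rw [(minpoly.monic hint).coeff_natDegree] at h2
    exact one_ne_zero h2
  · have h1 := minpoly.aeval S c
    rw [← hp, Polynomial.aeval_eq_sum_range] at h1
    rw [map_sum, ← h1]
    refine Finset.sum_congr rfl fun l _ => ?_
    rw [Polynomial.aeval_monomial, Algebra.smul_def]
    rfl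

end Constants

/-! ### Closed rational forms, by induction on the number of variables. -/

section Tower

open scoped IntermediateField

variable {Ω : Type u} [Field Ω] {n : ℕ} {d : Fin n → Der Ω} {k : Subfield Ω} {x : Fin n → Ω}

/-- The field of rational functions in the first `m` variables. -/
def ratTower (k : Subfield Ω) (x : Fin n → Ω) (m : ℕ) : Subfield Ω :=
  Subfield.closure ((k : Set Ω) ∪ {y | ∃ i : Fin n, i.val < m ∧ x i = y})

theorem le_ratTower (m : ℕ) : k ≤ ratTower k x m := fun _ hy =>
  Subfield.subset_closure (Or.inl hy)

theorem mem_ratTower {m : ℕ} {i : Fin n} (hi : i.val < m) : x i ∈ ratTower k x m :=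
  Subfield.subset_closure (Or.inr ⟨i, hi, rfl⟩)

theorem ratTower_le {m : ℕ} {S : Subfield Ω} (hk : k ≤ S) (hx : ∀ i : Fin n, i.val < m → x i ∈ S) :
    ratTower k x m ≤ S := by
  refine Subfield.closure_le.2 (Set.union_subset hk ?_)
  rintro _ ⟨i, hi, rfl⟩
  exact hx i hi

theorem ratTower_succ_le {F : Subfield Ω} {i : Fin n} (hF : ratTower k x i ≤ F) :
    ratTower k x (i + 1) ≤ F⟮x i⟯.toSubfield := by
  refine ratTower_le (fun c hc => F⟮x i⟯.algebraMap_mem ⟨c, hF (le_ratTower _ hc)⟩) fun j hj => ?_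
  rcases Nat.lt_succ_iff_lt_or_eq.1 hj with h | h
  · exact F⟮x i⟯.algebraMap_mem ⟨x j, hF (mem_ratTower h)⟩
  · rw [Fin.ext h]
    exact IntermediateField.mem_adjoin_simple_self F (x i)

theorem ratTower_derivation_mem {S : Subfield Ω} (D : Der Ω) {m : ℕ} (hk : ∀ c ∈ k, D c ∈ S)
    (hx : ∀ i : Fin n, i.val < m → D (x i) ∈ S) (hS : ratTower k x m ≤ S)
    {y : Ω} (hy : y ∈ ratTower k x m) : D y ∈ S := by
  induction hy using Subfield.closure_induction with
  | mem y h =>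
    rcases h with h | ⟨i, hi, rfl⟩
    exacts [hk y h, hx i hi]
  | one =>
    rw [Derivation.map_one_eq_zero]
    exact zero_mem _
  | add y z _ _ h1 h2 =>
    rw [map_add]
    exact add_mem h1 h2
  | neg y _ h =>
    rw [map_neg]
    exact neg_mem h
  | inv y hy h =>
    rw [Derivation.leibniz_inv, smul_eq_mul]
    exact mul_mem (neg_mem (pow_mem (inv_mem (hS hy)) 2)) h
  | mul y z hy hz h1 h2 =>
    rw [Der.leibniz]
    exact add_mem (mul_mem (hS hy) h2) (mul_mem (hS hz) h1)

theorem ratTower_derivation_eq_zero (D : Der Ω) {m : ℕ} (hk : ∀ c ∈ k, D c = 0)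
    (hx : ∀ i : Fin n, i.val < m → D (x i) = 0) {y : Ω} (hy : y ∈ ratTower k x m) : D y = 0 := by
  induction hy using Subfield.closure_induction with
  | mem y h =>
    rcases h with h | ⟨i, hi, rfl⟩
    exacts [hk y h, hx i hi]
  | one => exact Derivation.map_one_eq_zero _
  | add y z _ _ h1 h2 => rw [map_add, h1, h2, add_zero]
  | neg y _ h => rw [map_neg, h, neg_zero]
  | inv y _ h => rw [Derivation.leibniz_inv, h, smul_zero]
  | mul y z _ _ h1 h2 => rw [Der.leibniz, h1, h2, mul_zero, mul_zero, add_zero]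

/-- Closed rational forms are logarithmic. -/
theorem mem_logForms_of_closed [CharZero Ω] [IsAlgClosed Ω]
    (hd : ∀ i j a, d i (d j a) = d j (d i a)) (hk : ∀ i, ∀ c ∈ k, d i c = 0)
    (hkc : ∀ x : Ω, IsAlgebraic k x → x ∈ k) (hx : ∀ i j, d i (x j) = if i = j then 1 else 0)
    {m : ℕ} (hm : m ≤ n) {α : Fin n → Ω} (hα : ∀ i, α i ∈ ratTower k x m)
    (hα₀ : ∀ i : Fin n, m ≤ i → α i = 0) (hcl : ∀ i j, d i (α j) = d j (α i)) :
    α ∈ logForms d k (ratTower k x m) := by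
  have hstable : ∀ m, IsStable d (ratTower k x m) := fun m i y hy =>
    ratTower_derivation_mem (d i) (fun c hc => by rw [hk i c hc]; exact zero_mem _) (fun j _ => by
      rw [hx]
      split_ifs
      exacts [one_mem _, zero_mem _]) le_rfl hy
  have hzero : ∀ (i j : Fin n), j ≤ i → ∀ y ∈ ratTower k x j, d i y = 0 := fun i j hij y hy =>
    ratTower_derivation_eq_zero (d i) (hk i) (fun l hl => by
      rw [hx, if_neg]
      rintro rfl
      exact absurd hl (not_lt.2 hij)) hy
  have hzero' : ∀ (i j : Fin n), j ≤ i → ∀ y ∈ algClosure (ratTower k x j), d i y = 0 :=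
    fun i j hij y hy => derivation_eq_zero_of_isAlgebraic (d i) (hzero i j hij) (mem_algClosure.1
        hy)
  -- The derivation `d i` kills everything algebraic over the earlier variables, but not `x i`.
  have htrans : ∀ i : Fin n, Transcendental (algClosure (ratTower k x i)) (x i) := fun i h => by
    have h1 := hzero' i i le_rfl _ (algClosure_idem h)
    rw [hx, if_pos rfl] at h1
    exact one_ne_zero h1
  have htrans' : ∀ i : Fin n, Transcendental (ratTower k x i) (x i) := fun i h =>
    htrans i (IsAlgebraic.of_subfield_le (le_algClosure _) h)
  have hker : ∀ i : Fin n, ∀ y ∈ ratTower k x (i + 1), d i y = 0 → y ∈ ratTower k x i :=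
    fun i y hy h => mem_of_derivation_eq_zero (htrans' i) (hzero i i le_rfl)
      (by rw [hx, if_pos rfl]) (ratTower_succ_le le_rfl hy) h
  have hconst : ∀ m ≤ n, ∀ y ∈ ratTower k x m, (∀ i, d i y = 0) → y ∈ k := by
    intro m
    induction m with
    | zero =>
      exact fun _ y hy _ => ratTower_le le_rfl (fun i hi => absurd hi (Nat.not_lt_zero _)) hy
    | succ m ih => exact fun hm y hy h => ih (by omega) y (hker ⟨m, hm⟩ y hy (h _)) h
  induction m generalizing α with
  | zero =>
    rw [show α = 0 from funext fun i => hα₀ i (Nat.zero_le _)]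
    exact zero_mem _
  | succ m ih =>
    let i₀ : Fin n := ⟨m, hm⟩
    set F := algClosure (ratTower k x m) with hF
    set K := ratTower k x (m + 1) with hK
    have hFc : IsAlgClosed F := isAlgClosed_of_forall_mem fun y hy => algClosure_idem hy
    have ht : Transcendental F (x i₀) := htrans i₀
    have hdF : ∀ a ∈ F, d i₀ a = 0 := hzero' i₀ i₀ le_rfl
    have hdt : d i₀ (x i₀) = 1 := by rw [hx, if_pos rfl]
    have hFs : IsStable d F := (hstable m).algClosure
    have hKF : K ≤ F⟮x i₀⟯.toSubfield := ratTower_succ_le (i := i₀) (le_algClosure _)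
    have hmono : ratTower k x m ≤ K := ratTower_le (le_ratTower _) fun i hi =>
      mem_ratTower (hi.trans (Nat.lt_succ_self m))
    have hFm : ∀ a ∈ F, a ∈ F⟮x i₀⟯ := fun a ha => F⟮x i₀⟯.algebraMap_mem ⟨a, ha⟩
    have htm := IntermediateField.mem_adjoin_simple_self F (x i₀)
    obtain ⟨R, hR, c, hc⟩ := exists_primitive_add_sum ht hdF hdt (hKF (hα i₀))
    -- the residues are constant
    have hne : ∀ ρ : F, x i₀ - ρ ≠ 0 := fun ρ => sub_ne_zero_of_transcendental ht ρ.2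
    have hres : ∀ ρ i, d i (c ρ) = 0 := by
      intro ρ i
      by_cases hi : i = i₀
      · rw [hi]
        exact hdF _ (Subtype.property _)
      have hi' : d i (x i₀) = 0 := by rw [hx, if_neg hi]
      let c' : F →₀ F := c.mapRange (fun a : F => (⟨d i a, hFs i a a.2⟩ : F)) (Subtype.ext
          (map_zero (d i)))
      -- Closedness equates `d i₀ (α i)` with the `d i` derivative of the decomposition of `α i₀`.
      -- Moving the double poles into the primitive leaves simple fractions with residues `d i (c
      -- ρ)`, which must vanish.
      have h1 : d i₀ (α i - d i R + c.sum fun ρ a => (a : Ω) * d i ρ / (x i₀ - ρ)) =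
          c'.sum fun ρ a => (a : Ω) / (x i₀ - ρ) := by
        rw [map_add, map_sub, hcl, hc, map_add, hd i₀ i R, add_sub_cancel_left,
          Finsupp.sum_mapRange_index (by simp), Finsupp.sum, Finsupp.sum, Finsupp.sum, map_sum,
          map_sum, ← Finset.sum_add_distrib]
        refine Finset.sum_congr rfl fun σ _ => ?_
        have h2 := hne σ
        rw [Derivation.leibniz_div, Derivation.leibniz_div, Der.leibniz, map_sub, map_sub, hdt, hi',
          hdF _ (c σ).2, hdF _ σ.2, hdF _ (hFs i _ σ.2)]
        simp only [smul_eq_mul]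
        field_simp
        ring
      have h2 := eq_zero_of_sum_eq_derivation ht hdF hdt (add_mem (sub_mem (hKF (hα i))
        (derivation_mem_adjoin (d i) (fun a => hFm _ (hFs i a a.2)) (by
          rw [hi']
          exact zero_mem _) hR)) (sum_mem fun σ _ => div_mem (mul_mem (hFm _ (Subtype.property _))
            (hFm _ (hFs i _ σ.2))) (sub_mem htm (hFm _ σ.2)))) h1
      have h3 := DFunLike.congr_fun h2 ρ
      rw [Finsupp.mapRange_apply] at h3
      exact congrArg Subtype.val h3
    have hck : ∀ ρ, (c ρ : Ω) ∈ k := fun ρ => mem_of_isAlgebraic_of_constant hkc (hstable m)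
      (hconst m (by omega)) (mem_algClosure.1 (c ρ).2) (hres ρ)
    -- the form with the same component along `x i₀`
    let β : Fin n → Ω := (fun i => d i R) +
      ∑ ρ ∈ c.support, fun i => (c ρ : Ω) * (d i (x i₀ - ρ) / (x i₀ - ρ))
    have hβ : β ∈ logForms d k F⟮x i₀⟯.toSubfield := add_mem (exact_mem_logForms hR)
      (sum_mem fun ρ _ => dlog_mem_logForms (hck ρ) (sub_mem htm (hFm _ ρ.2)) (hne ρ))
    have hβ₀ : β i₀ = α i₀ := by
      rw [hc, Finsupp.sum]
      simp only [β, Pi.add_apply, Finset.sum_apply]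
      congr 1
      refine Finset.sum_congr rfl fun ρ _ => ?_
      rw [map_sub, hdt, hdF _ ρ.2, sub_zero, mul_one_div]
    have hβm : ∀ i, β i ∈ F⟮x i₀⟯ := fun i => by
      simp only [β, Pi.add_apply, Finset.sum_apply]
      have h1 : ∀ y ∈ F⟮x i₀⟯, d i y ∈ F⟮x i₀⟯ := fun y hy =>
        derivation_mem_adjoin (d i) (fun a => hFm _ (hFs i a a.2)) (by
          rw [hx]
          split_ifs
          exacts [one_mem _, zero_mem _]) hy
      have h2 : ∀ ρ : F, x i₀ - ρ ∈ F⟮x i₀⟯ := fun ρ => sub_mem htm (hFm _ ρ.2)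
      exact add_mem (h1 R hR) (sum_mem fun ρ _ => mul_mem (hFm _ (Subtype.property _))
        (div_mem (h1 _ (h2 ρ)) (h2 ρ)))
    have hβc := logForms_closed hd hk hβ
    -- The difference is closed and has no component along `x i₀`, so its components do not depend
    -- on `x i₀`.
    have hα' : ∀ i, α i - β i ∈ F := fun i => by
      refine mem_of_derivation_eq_zero ht hdF hdt (sub_mem (hKF (hα i)) (hβm i)) ?_
      rw [map_sub, hcl, hβc, hβ₀, sub_self]
    have hFK : ∀ y ∈ F⟮x i₀⟯, IsAlgebraic K y := fun y hy => by
      have h1 : F⟮x i₀⟯ ≤ (⊤ : IntermediateField F Ω) := le_top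
      have h2 : ∀ y ∈ F⟮x i₀⟯, y ∈ algClosure K := fun y hy => by
        induction hy using IntermediateField.adjoin_induction with
        | mem y hy =>
          obtain rfl : y = x i₀ := hy
          exact le_algClosure _ (mem_ratTower (Nat.lt_succ_self m))
        | algebraMap a => exact algClosure_mono hmono a.2
        | add y z _ _ h1 h2 => exact add_mem h1 h2
        | inv y _ h => exact inv_mem h
        | mul y z _ _ h1 h2 => exact mul_mem h1 h2
      exact mem_algClosure.1 (h2 y hy)
    classical
    obtain ⟨Z, hZ₁, hZ₂⟩ := exists_finset_of_mem_logForms hβ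
    obtain ⟨L, T, hZL, hT₁, hT₂, hT₃, hT₄⟩ := exists_average (hstable (m + 1))
      (Z ∪ Finset.univ.image fun i => α i - β i) (fun z hz => by
        rcases Finset.mem_union.1 hz with h | h
        · exact hFK z (hZ₁ z h)
        · obtain ⟨i, _, rfl⟩ := Finset.mem_image.1 h
          exact hFK _ (hFm _ (hα' i)))
    have hTβ := average_mem_logForms (le_ratTower (m + 1)) T hT₁ hT₂ hT₄
      (hZ₂ L fun z hz => hZL z (Finset.mem_union_left _ hz))
    have hαL : ∀ i, α i - β i ∈ L := fun i => hZL _ (Finset.mem_union_right _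
      (Finset.mem_image_of_mem _ (Finset.mem_univ i)))
    have hTα : ∀ y ∈ K, T y = y := fun y hy => by
      have h1 : y = (⟨y, hy⟩ : K) • (1 : Ω) := (mul_one y).symm
      conv_lhs => rw [h1, map_smul, hT₃]
      exact mul_one y
    -- The poles of `β` are only algebraic functions of the earlier variables. Averaging fixes `α`,
    -- keeps `β` logarithmic and makes the difference rational, ready for the induction.
    have hdecomp : α = (fun i => T (β i)) + fun i => T (α i - β i) := by
      ext i
      rw [Pi.add_apply, ← map_add, add_sub_cancel, hTα _ (hα i)]
    rw [hdecomp]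
    refine add_mem hTβ (logForms_mono hmono (ih (by omega) (fun i => ?_) (fun i hi => ?_)
      fun i j => ?_))
    · refine hker i₀ _ (hT₁ _ (hαL i)) ?_
      rw [← hT₂ i₀ _ (hαL i), hdF _ (hα' i), map_zero]
    · have : α i = β i := by
        rcases Nat.eq_or_lt_of_le hi with h | h
        · rw [show i = i₀ from Fin.ext h.symm, hβ₀]
        · have h1 : ∀ y ∈ F⟮x i₀⟯, d i y = 0 := fun y hy =>
            derivation_eq_zero_of_isAlgebraic (d i) (fun z hz => ratTower_derivation_eq_zero (d i)
              (hk i) (fun l hl => by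
                rw [hx, if_neg]
                rintro rfl
                exact absurd hl (not_lt.2 h)) hz) (hFK y hy)
          rw [hα₀ i h]
          simp only [β, Pi.add_apply, Finset.sum_apply]
          rw [h1 R hR, zero_add, Finset.sum_eq_zero]
          intro ρ _
          rw [h1 _ (sub_mem htm (hFm _ ρ.2)), zero_div, mul_zero]
      rw [this, sub_self, map_zero]
    · rw [← hT₂ i _ (hαL j), ← hT₂ j _ (hαL i), map_sub (d i), map_sub (d j), hcl, hβc]

end Tower

/-! ### Liouvillian towers of algebraically closed fields. -/

section LiouvillianClosure

open scoped IntermediateField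

variable {Ω : Type u} [Field Ω] {n : ℕ} {d : Fin n → Der Ω} {S₀ : Subfield Ω}

/-- The algebraically closed subfields obtained from `S₀` by successively adjoining primitives and
exponentials. -/
inductive LiouvilleReachable (d : Fin n → Der Ω) (S₀ : Subfield Ω) : Subfield Ω → Prop
  | base : LiouvilleReachable d S₀ S₀
  | step (S : Subfield Ω) (t : Ω) : LiouvilleReachable d S₀ S → Transcendental S t →
      ((∀ i, d i t ∈ S) ∨ (∀ i, d i t / t ∈ S)) →
      LiouvilleReachable d S₀ (algClosure S⟮t⟯.toSubfield)

theorem LiouvilleReachable.isStable_and_closed [CharZero Ω] (h₀ : IsStable d S₀)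
    (hc₀ : ∀ x : Ω, IsAlgebraic S₀ x → x ∈ S₀) {S : Subfield Ω} (h : LiouvilleReachable d S₀ S) :
    IsStable d S ∧ (∀ x : Ω, IsAlgebraic S x → x ∈ S) ∧ S₀ ≤ S := by
  induction h with
  | base => exact ⟨h₀, hc₀, le_rfl⟩
  | step S t _ ht htS ih =>
    have hS : S ≤ S⟮t⟯.toSubfield := fun a ha => S⟮t⟯.algebraMap_mem ⟨a, ha⟩
    have htm := IntermediateField.mem_adjoin_simple_self S t
    refine ⟨IsStable.algClosure fun i x hx => ?_, fun x hx => algClosure_idem hx,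
      (ih.2.2.trans hS).trans (le_algClosure _)⟩
    refine derivation_mem_adjoin (d i) (fun a => hS (ih.1 i a a.2)) ?_ hx
    rcases htS with h | h
    · exact hS (h i)
    · have ht0 : t ≠ 0 := fun h => ht (h ▸ isAlgebraic_zero)
      have := mul_mem (hS (h i)) htm
      rwa [div_mul_cancel₀ _ ht0] at this

theorem LiouvilleReachable.hasTri [CharZero Ω] [IsAlgClosed Ω] {P : Fin n → Ω} {k₀ : Fin n}
    (hd : ∀ i j a, d i (d j a) = d j (d i a)) (h₀ : IsStable d S₀)
    (hc₀ : ∀ x : Ω, IsAlgebraic S₀ x → x ∈ S₀) (hP : ∀ j, P j ∈ S₀) {S : Subfield Ω}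
    (h : LiouvilleReachable d S₀ S) (H : HasTri d P k₀ S) : HasTri d P k₀ S₀ := by
  induction h with
  | base => exact H
  | step S t hS ht htS ih =>
    obtain ⟨h1, h2, h3⟩ := hS.isStable_and_closed h₀ hc₀
    exact ih (H.descend hd h1 h2 ht htS fun j => h3 (hP j))

/-- A generator which is transcendental in its own tower may be algebraic over the field already
reached; it then lies in that algebraically closed field and needs no new step. -/
theorem LiouvilleReachable.exists_adjoin [CharZero Ω] (h₀ : IsStable d S₀)
    (hc₀ : ∀ x : Ω, IsAlgebraic S₀ x → x ∈ S₀) {S : Subfield Ω} (h : LiouvilleReachable d S₀ S)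
    {t : Ω} (ht : (∀ i, d i t ∈ S) ∨ (∀ i, d i t / t ∈ S)) :
    ∃ S', LiouvilleReachable d S₀ S' ∧ S ≤ S' ∧ t ∈ S' := by
  by_cases htr : IsAlgebraic S t
  · exact ⟨S, h, le_rfl, (h.isStable_and_closed h₀ hc₀).2.1 t htr⟩
  · exact ⟨_, h.step S t htr ht, fun a ha => le_algClosure _ (S⟮t⟯.algebraMap_mem ⟨a, ha⟩),
      le_algClosure _ (IntermediateField.mem_adjoin_simple_self S t)⟩

end LiouvillianClosure

/-! ### Liouvillian elements inside reachable fields. -/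

section Embedding

variable {n : ℕ} {M Ω : Type u} [Field M] [Algebra (RatField n) M] [Field Ω] [Algebra M Ω]
  {𝒟 : DiffExtension n M} {d : Fin n → Der Ω} {S₀ : Subfield Ω}

theorem isAlgebraic_of_intermediateField {K : IntermediateField (RatField n) M} {S : Subfield Ω}
    (hKS : ∀ a ∈ K, algebraMap M Ω a ∈ S) {x : M} (hx : IsAlgebraic K x) :
    IsAlgebraic S (algebraMap M Ω x) := by
  obtain ⟨p, hp, hpx⟩ := hx
  let f : K →+* S := ((algebraMap M Ω).comp (algebraMap K M)).codRestrict S fun a => hKS a a.2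
  refine ⟨p.map f, (Polynomial.map_ne_zero_iff f.injective).2 hp, ?_⟩
  rw [Polynomial.aeval_def, Polynomial.eval₂_map]
  have h1 : (algebraMap S Ω).comp f = (algebraMap M Ω).comp (algebraMap K M) := rfl
  rw [h1, ← Polynomial.hom_eval₂, ← Polynomial.aeval_def, hpx, map_zero]

/-- The tower of `a` is climbed on top of an arbitrary reachable `S`, so that several Liouvillian
elements with unrelated towers end up in one reachable field. -/
theorem LiouvilleReachable.exists_of_isLiouvillian [CharZero Ω]
    (hdδ : ∀ i a, d i (algebraMap M Ω a) = algebraMap M Ω (𝒟.δ i a)) (h₀ : IsStable d S₀)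
    (hc₀ : ∀ x : Ω, IsAlgebraic S₀ x → x ∈ S₀)
    (hR : ∀ a : RatField n, algebraMap M Ω (algebraMap _ M a) ∈ S₀) {S : Subfield Ω}
    (h : LiouvilleReachable d S₀ S) {a : M} (ha : IsLiouvillian 𝒟 a) :
    ∃ S', LiouvilleReachable d S₀ S' ∧ S ≤ S' ∧ algebraMap M Ω a ∈ S' := by
  obtain ⟨L, ⟨r, K, hK₀, rfl, hδ, hstep⟩, haL⟩ := ha
  have key : ∀ m ≤ r, ∃ S', LiouvilleReachable d S₀ S' ∧ S ≤ S' ∧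
      ∀ a ∈ K m, algebraMap M Ω a ∈ S' := by
    intro m
    induction m with
    | zero =>
      refine fun _ => ⟨S, h, le_rfl, fun a ha => ?_⟩
      rw [hK₀, IntermediateField.mem_bot] at ha
      obtain ⟨b, rfl⟩ := ha
      exact (h.isStable_and_closed h₀ hc₀).2.2 (hR b)
    | succ m ih =>
      intro hm
      obtain ⟨S', hS', hle, hmem⟩ := ih (by omega)
      have hadj : ∀ t : M, IntermediateField.extendScalars (hstep m hm).choose =
          IntermediateField.adjoin (K m) {t} → ((∀ i, d i (algebraMap M Ω t) ∈ S') ∨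
            (∀ i, d i (algebraMap M Ω t) / algebraMap M Ω t ∈ S')) →
          ∃ S', LiouvilleReachable d S₀ S' ∧ S ≤ S' ∧ ∀ a ∈ K (m + 1), algebraMap M Ω a ∈ S' := by
        intro t ht htS
        obtain ⟨S'', hS'', hle', ht'⟩ := hS'.exists_adjoin h₀ hc₀ htS
        refine ⟨S'', hS'', hle.trans hle', fun a ha => ?_⟩
        have ha' : a ∈ IntermediateField.extendScalars (hstep m hm).choose := ha
        rw [ht] at ha'
        clear ha
        induction ha' using IntermediateField.adjoin_induction with
        | mem x hx =>
          obtain rfl : x = t := hx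
          exact ht'
        | algebraMap x => exact hle' (hmem x x.2)
        | add x y _ _ h1 h2 =>
          rw [map_add]
          exact add_mem h1 h2
        | inv x _ h1 =>
          rw [map_inv₀]
          exact inv_mem h1
        | mul x y _ _ h1 h2 =>
          rw [map_mul]
          exact mul_mem h1 h2
      rcases (hstep m hm).choose_spec with hfin | ⟨t, _, ht, htS⟩ | ⟨t, _, ht, htS⟩
      · refine ⟨S', hS', hle, fun a ha => (hS'.isStable_and_closed h₀ hc₀).2.1 _
          (isAlgebraic_of_intermediateField hmem ?_)⟩
        have := Algebra.IsAlgebraic.isAlgebraic (R := K m)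
          (⟨a, ha⟩ : IntermediateField.extendScalars (hstep m hm).choose)
        exact this.algebraMap (A := M)
      · exact hadj t ht (Or.inr fun i => by
          rw [hdδ, ← map_div₀]
          exact hmem _ (htS i))
      · exact hadj t ht (Or.inl fun i => by
          rw [hdδ]
          exact hmem _ (htS i))
  obtain ⟨S', h1, h2, h3⟩ := key r le_rfl
  exact ⟨S', h1, h2, h3 a haL⟩

end Embedding

/-! ### Logarithmic forms with irreducible arguments. -/

section RationalData

open MvPolynomial

variable {n : ℕ} {Ω : Type u} [Field Ω] {d : Fin n → Der Ω} {φ : RatField n →+* Ω}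

theorem derivation_div (hφ : ∀ i (p : MvPolynomial (Fin n) ℂ), d i (φ (algebraMap _ _ p)) = φ
    (algebraMap _ _ (pderiv i p)))
    (i : Fin n) (p q : MvPolynomial (Fin n) ℂ) :
    d i (φ (algebraMap _ _ p / algebraMap _ _ q)) =
      φ ((algebraMap _ _ (pderiv i p) * algebraMap _ _ q -
        algebraMap _ _ p * algebraMap _ _ (pderiv i q)) / algebraMap _ _ q ^ 2) := by
  rw [map_div₀, Derivation.leibniz_div, hφ, hφ]
  simp only [smul_eq_mul, map_div₀, map_sub, map_mul, map_pow]
  ring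

/-- A logarithmic form on rational functions has a normal form with irreducible polynomials as
arguments of the logarithms. -/
theorem exists_irreducible_form
    (hφ : ∀ i (p : MvPolynomial (Fin n) ℂ), d i (φ (algebraMap _ _ p)) = φ (algebraMap _ _ (pderiv
        i p)))
    {k : Subfield Ω} (hk : ∀ y ∈ k, ∃ c : ℂ, φ (algebraMap (MvPolynomial (Fin n) ℂ) _ (C c)) = y)
    {α : Fin n → Ω} (hα : α ∈ logForms d k φ.fieldRange) :
    ∃ (R : RatField n) (e : MvPolynomial (Fin n) ℂ →₀ ℂ),
      (∀ f ∈ e.support, Irreducible f ∧ Quot.out (Associates.mk f) = f) ∧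
      ∀ i, α i = d i (φ R) + e.sum fun f c => φ (algebraMap (MvPolynomial (Fin n) ℂ) _ (C c)) *
        (φ (algebraMap _ _ (pderiv i f)) / φ (algebraMap _ _ f)) := by
  classical
  let A : MvPolynomial (Fin n) ℂ →+* Ω := φ.comp (algebraMap _ _)
  have hA : ∀ p, φ (algebraMap _ _ p) = A p := fun _ => rfl
  have hA0 : ∀ p, p ≠ 0 → A p ≠ 0 := fun p hp h => hp (by
    have h1 := (map_eq_zero φ).1 h
    exact (map_eq_zero_iff _ (IsFractionRing.injective _ (RatField n))).1 h1)
  simp only [hA] at hφ ⊢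
  let T : Fin n → (MvPolynomial (Fin n) ℂ →₀ ℂ) → Ω := fun i e =>
    e.sum fun f c => A (C c) * (A (pderiv i f) / A f)
  have hT : ∀ i e e', T i (e + e') = T i e + T i e' := fun i e e' =>
    Finsupp.sum_add_index' (by simp) fun f c c' => by rw [map_add, map_add, add_mul]
  let Adm : (MvPolynomial (Fin n) ℂ →₀ ℂ) → Prop := fun e =>
    ∀ f ∈ e.support, Irreducible f ∧ Quot.out (Associates.mk f) = f
  have hAdm : ∀ e e', Adm e → Adm e' → Adm (e + e') := fun e e' h h' f hf => by
    rcases Finset.mem_union.1 (Finsupp.support_add hf) with h1 | h1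
    exacts [h f h1, h' f h1]
  have hpoly : ∀ (c : ℂ) (p : MvPolynomial (Fin n) ℂ), p ≠ 0 → ∃ e, Adm e ∧
      ∀ i, A (C c) * (d i (A p) / A p) = T i e := by
    intro c p
    have hunit : ∀ u : MvPolynomial (Fin n) ℂ, IsUnit u → ∀ i, d i (A u) = 0 := fun u hu i => by
      obtain ⟨r, hr, rfl⟩ := MvPolynomial.isUnit_iff_eq_C_of_isReduced.1 hu
      rw [hφ, pderiv_C, map_zero]
    induction p using WfDvdMonoid.induction_on_irreducible with
    | zero => exact fun h => absurd rfl h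
    | unit u hu =>
      intro _
      refine ⟨0, by simp [Adm], fun i => ?_⟩
      rw [hunit u hu]
      simp [T]
    | mul a p ha hp ih =>
      intro _
      obtain ⟨e, he, h⟩ := ih ha
      -- A fixed representative of each associate class, so that associated factors share one
      -- coefficient. Units are constants and do not change logarithmic derivatives.
      let f := Quot.out (Associates.mk p)
      have hmk : Associates.mk f = Associates.mk p := Quot.out_eq _
      obtain ⟨u, hu⟩ := Associates.mk_eq_mk_iff_associated.1 hmk
      have hf : Irreducible f := (Associates.mk_eq_mk_iff_associated.1 hmk).symm.irreducible hp
      refine ⟨Finsupp.single f c + e, hAdm _ _ (fun g hg => ?_) he, fun i => ?_⟩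
      · obtain rfl := Finset.mem_singleton.1 (Finsupp.support_single_subset hg)
        exact ⟨hf, by rw [hmk]⟩
      · rw [hT, ← h, ← hu]
        have h1 : T i (Finsupp.single f c) = A (C c) * (A (pderiv i f) / A f) :=
          Finsupp.sum_single_index (by simp)
        have h2 := hA0 f hf.ne_zero
        have h3 := hA0 u u.ne_zero
        have h4 := hA0 a ha
        rw [h1, map_mul A (f * ↑u) a, map_mul A f ↑u, Der.leibniz, Der.leibniz, hunit u u.isUnit,
            ← hφ]
        field_simp
        ring
  induction hα using AddSubmonoid.closure_induction with
  | mem α h =>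
    rcases h with ⟨_, ⟨R, rfl⟩, rfl⟩ | ⟨c, hc, _, ⟨a, rfl⟩, ha, rfl⟩
    · exact ⟨R, 0, by simp, fun i => by simp⟩
    · obtain ⟨c, rfl⟩ := hk c hc
      obtain ⟨p, q, hq, rfl⟩ := IsFractionRing.div_surjective (A := MvPolynomial (Fin n) ℂ) a
      have hq0 : q ≠ 0 := nonZeroDivisors.ne_zero hq
      have hp0 : p ≠ 0 := by
        rintro rfl
        exact ha (by rw [map_zero, zero_div, map_zero])
      obtain ⟨e, he, h⟩ := hpoly c p hp0
      obtain ⟨e', he', h'⟩ := hpoly (-c) q hq0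
      refine ⟨0, e + e', hAdm _ _ he he', fun i => ?_⟩
      refine Eq.trans ?_ (congrArg _ (hT i e e').symm)
      beta_reduce
      rw [← h, ← h', map_zero, map_zero, zero_add, map_div₀, hA, hA, Derivation.leibniz_div,
          map_neg,
        map_neg]
      have h1 := hA0 p hp0
      have h2 := hA0 q hq0
      simp only [smul_eq_mul, hA]
      field_simp
      ring
  | zero => exact ⟨0, 0, by simp, fun i => by simp⟩
  | add α β _ _ h1 h2 =>
    obtain ⟨R, e, he, h1⟩ := h1
    obtain ⟨R', e', he', h2⟩ := h2
    refine ⟨R + R', e + e', hAdm _ _ he he', fun i => ?_⟩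
    rw [Pi.add_apply, h1, h2, map_add, map_add]
    have := hT i e e'
    simp only [T] at this
    rw [this]
    ring

end RationalData

/-! ### Assembling the algebraic argument. -/

section AlgebraicPart

open MvPolynomial

theorem mem_fieldRange_of_isAlgebraic {F : Type*} {Ω : Type u} [Field F] [IsAlgClosed F] [Field Ω]
    (f : F →+* Ω) {x : Ω} (hx : IsAlgebraic f.fieldRange x) : x ∈ f.fieldRange := by
  obtain ⟨p, hp, hpx⟩ := hx
  let q : Polynomial F := p.map (RingHom.rangeRestrictFieldEquiv f).symm.toRingHom
  have hq : q.map f = p.map (algebraMap f.fieldRange Ω) := by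
    rw [Polynomial.map_map]
    congr 1
    ext y
    exact congrArg Subtype.val ((RingHom.rangeRestrictFieldEquiv f).apply_symm_apply y)
  have hx : x ∈ (q.map f).roots := by
    rw [hq, Polynomial.mem_roots_map hp]
    exact hpx
  rw [(IsAlgClosed.splits q).roots_map, Multiset.mem_map] at hx
  obtain ⟨y, -, rfl⟩ := hx
  exact ⟨y, rfl⟩

/-- The algebraic part: a Liouvillian integrable system has an inverse integrating form which is the
logarithmic differential of a Darboux function. -/
theorem exists_darboux_form {n : ℕ} {P : Fin n → MvPolynomial (Fin n) ℂ}
    (hP : IsLiouvillianIntegrable.{u} P) {k₀ : Fin n} (hk₀ : P k₀ ≠ 0) :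
    ∃ (g h : MvPolynomial (Fin n) ℂ) (e : MvPolynomial (Fin n) ℂ →₀ ℂ), h ≠ 0 ∧ IsRelPrime g h ∧
      (∀ f ∈ e.support, Irreducible f ∧ Quot.out (Associates.mk f) = f) ∧
      ∑ i, algebraMap (MvPolynomial (Fin n) ℂ) (RatField n) (P i) *
        ((algebraMap _ (RatField n) (pderiv i g) * algebraMap _ (RatField n) h -
          algebraMap _ (RatField n) g * algebraMap _ (RatField n) (pderiv i h)) /
            algebraMap _ (RatField n) h ^ 2 +
          e.sum fun f c => algebraMap (MvPolynomial (Fin n) ℂ) (RatField n) (C c) *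
            (algebraMap _ (RatField n) (pderiv i f) / algebraMap _ (RatField n) f)) =
      -∑ i, algebraMap (MvPolynomial (Fin n) ℂ) (RatField n) (pderiv i (P i)) := by
  classical
  obtain ⟨M, _, _, 𝒟, H, hH, hind⟩ := hP
  have _ : CharZero M := charZero_of_injective_algebraMap (algebraMap (RatField n) M).injective
  let Ω := AlgebraicClosure M
  have _ : CharZero Ω := charZero_of_injective_algebraMap (algebraMap M Ω).injective
  let δ : Fin n → Der M := fun i => Der.ofAddMonoidHom (𝒟.δ i) (𝒟.leibniz i)
  choose d hdδ using fun i => exists_derivation_extension M Ω (δ i)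
  replace hdδ : ∀ i a, d i (algebraMap M Ω a) = algebraMap M Ω (𝒟.δ i a) := hdδ
  -- The commutator is a derivation vanishing on `M`, hence on its algebraic extension.
  have hd : ∀ i j a, d i (d j a) = d j (d i a) := fun i j a => by
    have h1 := map_derivation_of_isAlgebraic (A := M) (RingHom.id Ω) ⁅d i, d j⁆ 0 (fun a => by
      simp only [Derivation.commutator_apply, RingHom.id_apply, Derivation.zero_apply, hdδ,
        𝒟.commute i j, sub_self]) (Algebra.IsAlgebraic.isAlgebraic (R := M) a)
    exact (sub_eq_zero.1 h1.symm)
  let φ : RatField n →+* Ω := (algebraMap M Ω).comp (algebraMap _ M)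
  have hφ : ∀ i (p : MvPolynomial (Fin n) ℂ),
      d i (φ (algebraMap _ _ p)) = φ (algebraMap _ _ (pderiv i p)) := fun i p => by
    show d i (algebraMap M Ω _) = algebraMap M Ω _
    rw [hdδ, 𝒟.extend]
  let A : MvPolynomial (Fin n) ℂ →+* Ω := φ.comp (algebraMap _ _)
  have hA : ∀ p, φ (algebraMap _ _ p) = A p := fun _ => rfl
  let k : Subfield Ω := (A.comp C).fieldRange
  let x : Fin n → Ω := fun i => A (X i)
  have hk : ∀ i, ∀ c ∈ k, d i c = 0 := by
    rintro i _ ⟨c, rfl⟩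
    refine (hφ i (C c)).trans ?_
    rw [pderiv_C, map_zero, map_zero]
  have hkc : ∀ y : Ω, IsAlgebraic k y → y ∈ k := fun y => mem_fieldRange_of_isAlgebraic _
  have hx : ∀ i j, d i (x j) = if i = j then 1 else 0 := fun i j => by
    refine (hφ i (X j)).trans ?_
    rw [pderiv_X, Pi.single_apply]
    split_ifs <;> simp_all
  have hφstable : IsStable d φ.fieldRange := by
    rintro i _ ⟨R, rfl⟩
    obtain ⟨p, q, -, rfl⟩ := IsFractionRing.div_surjective (A := MvPolynomial (Fin n) ℂ) R
    rw [derivation_div hφ]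
    exact ⟨_, rfl⟩
  have htower : ratTower k x n = φ.fieldRange := by
    refine le_antisymm (ratTower_le ?_ fun i _ => ⟨_, rfl⟩) ?_
    · rintro _ ⟨c, rfl⟩
      exact ⟨_, rfl⟩
    · have h1 : ∀ p, A p ∈ ratTower k x n := fun p => by
        induction p using MvPolynomial.induction_on with
        | C c => exact le_ratTower _ ⟨c, rfl⟩
        | add p q h1 h2 =>
          rw [map_add]
          exact add_mem h1 h2
        | mul_X p i h =>
          rw [map_mul]
          exact mul_mem h (mem_ratTower i.2)
      rintro _ ⟨R, rfl⟩
      obtain ⟨p, q, -, rfl⟩ := IsFractionRing.div_surjective (A := MvPolynomial (Fin n) ℂ) R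
      rw [map_div₀]
      exact div_mem (h1 p) (h1 q)
  -- the connection over the algebraic closure of the field of rational functions
  set S₀ := algClosure φ.fieldRange with hS₀
  have hS₀s : IsStable d S₀ := hφstable.algClosure
  have hS₀c : ∀ y : Ω, IsAlgebraic S₀ y → y ∈ S₀ := fun y => algClosure_idem
  have hR : ∀ a, φ a ∈ S₀ := fun a => le_algClosure _ ⟨a, rfl⟩
  have hk₀' : algebraMap (RatField n) M (algebraMap _ _ (P k₀)) ≠ 0 := fun h => hk₀ (by
    have h1 := (map_eq_zero _).1 h
    exact (map_eq_zero_iff _ (IsFractionRing.injective _ (RatField n))).1 h1)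
  obtain ⟨S, hS, hHS⟩ : ∃ S, LiouvilleReachable d S₀ S ∧ ∀ j, algebraMap M Ω (H j) ∈ S := by
    have key : ∀ s : Finset (Fin (n - 1)), ∃ S, LiouvilleReachable d S₀ S ∧
        ∀ j ∈ s, algebraMap M Ω (H j) ∈ S := fun s => by
      induction s using Finset.induction_on with
      | empty => exact ⟨S₀, .base, by simp⟩
      | insert j s _ ih =>
        obtain ⟨S, hS, hmem⟩ := ih
        obtain ⟨S', h1, h2, h3⟩ := hS.exists_of_isLiouvillian hdδ hS₀s hS₀c hR (hH j).1
        refine ⟨S', h1, fun l hl => ?_⟩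
        rcases Finset.mem_insert.1 hl with rfl | h
        exacts [h3, h2 (hmem l h)]
    obtain ⟨S, h1, h2⟩ := key Finset.univ
    exact ⟨S, h1, fun j => h2 j (Finset.mem_univ j)⟩
  have hM := (isTri_of_linearIndependent (d := δ) (H := H) (fun i j a => 𝒟.commute i j a) hk₀'
    (fun a => (hH a).2) hind).map (fun i j a => 𝒟.commute i j a) hd (algebraMap M Ω) hdδ
  have hTri : HasTri d (fun j => A (P j)) k₀ S := ⟨Fin (n - 1), inferInstance, inferInstance, _, _,
      _,
    fun j a b => by rw [map_zero]; exact zero_mem _, hHS, hM⟩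
  obtain ⟨ι, _, _, ρ, B, v, hB, hv, hTri₀⟩ := hS.hasTri hd hS₀s hS₀c (fun j => hR _) hTri
  have hTri₁ := IsTri.restrict hd hS₀s (P := fun j => ⟨A (P j), hR _⟩)
    (B := fun j a b => ⟨B j a b, hB j a b⟩) (h := fun a => ⟨v a, hv a⟩) hTri₀
  obtain ⟨α, hαc, hαP⟩ := hTri₁.exists_form (fun i j a => Subtype.ext (hd i j a)) (fun h0 => hk₀'
      (by
    have h1 : algebraMap M Ω _ = 0 := congrArg Subtype.val h0
    exact (map_eq_zero _).1 h1))
  -- the average is rational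
  obtain ⟨L, T, hZL, hT₁, hT₂, hT₃, -⟩ := exists_average hφstable
    (Finset.univ.image fun i => (α i : Ω)) (fun z hz => by
      obtain ⟨i, _, rfl⟩ := Finset.mem_image.1 hz
      exact mem_algClosure.1 (α i).2)
  have hαL : ∀ i, (α i : Ω) ∈ L := fun i => hZL _ (Finset.mem_image_of_mem _ (Finset.mem_univ i))
  have hTs : ∀ (c : RatField n) y, T (φ c * y) = φ c * T y := fun c y =>
    T.map_smul (⟨φ c, c, rfl⟩ : φ.fieldRange) y
  have hlog : (fun i => T (α i)) ∈ logForms d k φ.fieldRange := by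
    have h1 : (fun i => T (α i)) ∈ logForms d k (ratTower k x n) := by
      refine mem_logForms_of_closed hd hk hkc hx le_rfl (fun i => htower.ge (hT₁ _ (hαL i)))
        (fun i hi => absurd hi (not_le.2 i.2)) fun i j => ?_
      rw [← hT₂ i _ (hαL j), ← hT₂ j _ (hαL i)]
      exact congrArg T (congrArg Subtype.val (hαc i j))
    rwa [htower] at h1
  have hdiv : ∑ i, A (P i) * T (α i) = -∑ i, A (pderiv i (P i)) := by
    have h1 : ∑ i, A (P i) * (α i : Ω) = -∑ i, A (pderiv i (P i)) := by
      have h2 := congrArg Subtype.val hαP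
      push_cast at h2
      refine h2.trans ?_
      congr 1
      exact Finset.sum_congr rfl fun i _ => hφ i (P i)
    have h2 : ∑ i, A (P i) * T (α i) = T (∑ i, A (P i) * (α i : Ω)) := by
      rw [map_sum]
      exact Finset.sum_congr rfl fun i _ => (hTs _ _).symm
    have h3 : -∑ i, A (pderiv i (P i)) =
        φ (-∑ i, algebraMap _ _ (pderiv i (P i))) * 1 := by
      rw [map_neg, map_sum, mul_one]
      rfl
    rw [h2, h1, h3, hTs, hT₃]
  obtain ⟨R, e, he, hαe⟩ := exists_irreducible_form hφ (by
    rintro _ ⟨c, rfl⟩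
    exact ⟨c, rfl⟩) hlog
  have hden : (IsFractionRing.den (MvPolynomial (Fin n) ℂ) R : MvPolynomial (Fin n) ℂ) ≠ 0 :=
    nonZeroDivisors.coe_ne_zero _
  refine ⟨IsFractionRing.num (MvPolynomial (Fin n) ℂ) R, IsFractionRing.den (MvPolynomial (Fin n)
      ℂ) R,
    e, hden, IsFractionRing.num_den_reduced _ _, he, φ.injective ?_⟩
  have hR' : R = algebraMap _ _ (IsFractionRing.num (MvPolynomial (Fin n) ℂ) R) /
      algebraMap (MvPolynomial (Fin n) ℂ) (RatField n) (IsFractionRing.den (MvPolynomial (Fin n) ℂ)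
          R) := by
    rw [← IsFractionRing.mk'_eq_div, IsFractionRing.mk'_num_den]
  rw [map_neg, map_sum, map_sum]
  refine Eq.trans (Finset.sum_congr rfl fun i _ => ?_) hdiv
  rw [hαe, map_mul, map_add, ← derivation_div hφ, ← hR', Finsupp.sum, Finsupp.sum, map_sum]
  simp only [map_mul, map_div₀]
  rfl

end AlgebraicPart

/-! ### Evaluation of rational functions, null sets and branch cuts. -/

section Analytic

open MeasureTheory MvPolynomial

open scoped ContDiff

variable {n : ℕ}

theorem continuous_eval_left (p : MvPolynomial (Fin n) ℂ) :
    Continuous fun x : Fin n → ℂ => eval x p :=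
  MvPolynomial.continuous_eval p

theorem contDiff_eval (p : MvPolynomial (Fin n) ℂ) {m : WithTop ℕ∞} :
    ContDiff ℂ m fun x : Fin n → ℂ => eval x p :=
  (AnalyticOnNhd.eval_mvPolynomial p).contDiff

theorem fderiv_eval (p : MvPolynomial (Fin n) ℂ) (x : Fin n → ℂ) (i : Fin n) :
    fderiv ℂ (fun y : Fin n → ℂ => eval y p) x (Pi.single i 1) = eval x (pderiv i p) := by
  have hd : ∀ q : MvPolynomial (Fin n) ℂ, DifferentiableAt ℂ (fun y : Fin n → ℂ => eval y q) x :=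
    fun q => ((contDiff_eval q (m := 1)).differentiable one_ne_zero).differentiableAt
  induction p using MvPolynomial.induction_on with
  | C c => simp
  | add p q hp hq =>
    simp only [map_add]
    rw [fderiv_fun_add (hd p) (hd q), ← hp, ← hq]
    rfl
  | mul_X p j hp =>
    have h1 : fderiv ℂ (fun y : Fin n → ℂ => y j) x (Pi.single i 1) =
        (Pi.single i 1 : Fin n → ℂ) j := by
      rw [(hasFDerivAt_apply j x).fderiv]
      rfl
    have h2 : DifferentiableAt ℂ (fun y : Fin n → ℂ => y j) x := (hasFDerivAt_apply j
        x).differentiableAt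
    simp only [map_mul, eval_X, Derivation.leibniz, pderiv_X, map_add, smul_eq_mul]
    rw [fderiv_fun_mul (hd p) h2]
    simp only [add_apply, smul_apply, h1, hp, smul_eq_mul]
    simp only [Pi.single_apply]
    split_ifs <;> simp

theorem hasFDerivAt_eval (p : MvPolynomial (Fin n) ℂ) (x : Fin n → ℂ) :
    HasFDerivAt (fun y : Fin n → ℂ => eval y p) (fderiv ℂ (fun y : Fin n → ℂ => eval y p) x) x :=
  ((contDiff_eval p (m := 1)).differentiable one_ne_zero).differentiableAt.hasFDerivAt

/-- By Fubini and induction: where the leading coefficient in the first variable does not vanish,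
which is almost everywhere, the fibre of the zero set is finite. -/
theorem volume_zeroLocus {n : ℕ} {p : MvPolynomial (Fin n) ℂ} (hp : p ≠ 0) :
    volume {x : Fin n → ℂ | eval x p = 0} = 0 := by
  induction n with
  | zero =>
    obtain ⟨c, rfl⟩ := C_surjective (Fin 0) p
    have hc : c ≠ 0 := fun h => hp (by rw [h, map_zero])
    simp [hc]
  | succ n ih =>
    let q := finSuccEquiv ℂ n p
    have hq : q ≠ 0 := fun h => hp ((finSuccEquiv ℂ n).injective (by rw [map_zero]; exact h))
    let s : Set (ℂ × (Fin n → ℂ)) := {z | eval (Fin.cons z.1 z.2 : Fin (n + 1) → ℂ) p = 0}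
    have hcont : Continuous fun z : ℂ × (Fin n → ℂ) => (Fin.cons z.1 z.2 : Fin (n + 1) → ℂ) := by
      refine continuous_pi fun i => ?_
      induction i using Fin.cases with
      | zero => exact continuous_fst
      | succ i => exact (continuous_apply i).comp continuous_snd
    have hs : MeasurableSet s :=
      (isClosed_singleton.preimage ((continuous_eval_left p).comp hcont)).measurableSet
    have h1 := (volume_preserving_piFinSuccAbove (fun _ : Fin (n + 1) => ℂ) 0).measure_preimage
      hs.nullMeasurableSet
    have h2 : (MeasurableEquiv.piFinSuccAbove (fun _ : Fin (n + 1) => ℂ) 0) ⁻¹' s =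
        {x : Fin (n + 1) → ℂ | eval x p = 0} := by
      ext x
      show eval (Fin.cons (x 0) (fun i : Fin n => x (Fin.succAbove 0 i)) : Fin (n + 1) → ℂ) p = 0 ↔
          _
      have h3 : (Fin.cons (x 0) (fun i : Fin n => x (Fin.succAbove 0 i)) : Fin (n + 1) → ℂ) = x :=
          by
        funext i
        induction i using Fin.cases <;> simp
      rw [h3]
      rfl
    rw [← h2, h1]
    show (volume.prod volume) s = 0
    rw [Measure.prod_apply_symm hs, lintegral_eq_zero_iff' (by
      exact (measurable_measure_prodMk_right hs).aemeasurable)]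
    have h3 : ∀ᵐ y : Fin n → ℂ, eval y q.leadingCoeff ≠ 0 := by
      rw [ae_iff]
      simpa using ih (Polynomial.leadingCoeff_ne_zero.2 hq)
    filter_upwards [h3] with y hy
    have h4 : q.map (eval y) ≠ 0 := fun h => hy (by
      rw [Polynomial.leadingCoeff, ← Polynomial.coeff_map, h, Polynomial.coeff_zero])
    refine (((q.map (eval y)).roots.toFinset.finite_toSet).subset fun t ht => ?_).measure_zero
        volume
    have h5 : eval (Fin.cons t y : Fin (n + 1) → ℂ) p = 0 := ht
    rw [eval_eq_eval_mv_eval'] at h5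
    simpa [h4] using h5

/-- The values of a function avoid some ray almost everywhere. -/
theorem exists_mul_mem_slitPlane {X : Type*} [MeasurableSpace X] (μ : Measure X) [SFinite μ]
    {f : X → ℂ} (hf : Measurable f) (h0 : μ {x | f x = 0} = 0) :
    ∃ c : ℂ, c ≠ 0 ∧ μ {x | c * f x ∉ Complex.slitPlane} = 0 := by
  -- These factors have distinct arguments, so a nonzero value is rotated onto the cut by at most
  -- one of them. The bad sets are disjoint, and only countably many can have positive measure.
  let c : ℝ → ℂ := fun t => 1 + t * Complex.I
  have hc : ∀ t, c t ≠ 0 := fun t h => by simpa [c] using congrArg Complex.re h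
  let B : ℝ → Set X := fun t => {x | f x ≠ 0 ∧ c t * f x ∉ Complex.slitPlane}
  have hB : ∀ t, MeasurableSet (B t) := fun t => by
    refine (hf (measurableSet_singleton 0)).compl.inter ?_
    exact ((measurable_const.mul hf) Complex.isOpen_slitPlane.measurableSet).compl
  have hdisj : Pairwise (Function.onFun Disjoint B) := fun s t hst => by
    refine Set.disjoint_left.2 fun x hs ht => hst ?_
    obtain ⟨hx, hs⟩ := hs
    obtain ⟨-, ht⟩ := ht
    rw [Complex.mem_slitPlane_iff, not_or, not_lt, not_not] at hs ht
    simp only [c, Complex.mul_re, Complex.mul_im, Complex.add_re, Complex.add_im, Complex.one_re,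
      Complex.one_im, Complex.ofReal_re, Complex.ofReal_im, Complex.I_re, Complex.I_im,
      mul_zero, add_zero, mul_one, zero_add, one_mul, sub_zero] at hs ht
    have h1 : (s - t) * (f x).re = 0 := by linear_combination hs.2 - ht.2
    rcases mul_eq_zero.1 h1 with h1 | h1
    · exact sub_eq_zero.1 h1
    · refine absurd (Complex.ext h1 ?_) hx
      have h2 := hs.2
      rw [h1, mul_zero, add_zero] at h2
      exact h2
  have hcount := Measure.countable_meas_pos_of_disjoint_iUnion (μ := μ) hB hdisj
  obtain ⟨t, ht⟩ : ∃ t, t ∉ {t | 0 < μ (B t)} := by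
    by_contra! h
    exact Set.not_countable_univ (α := ℝ) ((Set.eq_univ_of_forall h) ▸ hcount)
  refine ⟨c t, hc t, measure_mono_null (t := {x | f x = 0} ∪ B t) (fun x hx => ?_)
    (measure_union_null h0 (by simpa using ht))⟩
  by_cases h : f x = 0
  exacts [Or.inl h, Or.inr ⟨h, hx⟩]

/-- The graph of the evaluation at `x` on the rational functions which are regular at `x`. -/
def evalGraph (x : Fin n → ℂ) : Subring (RatField n × ℂ) where
  carrier := {z | ∃ p q : MvPolynomial (Fin n) ℂ, eval x q ≠ 0 ∧
    z.1 * algebraMap _ _ q = algebraMap _ _ p ∧ z.2 * eval x q = eval x p}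
  mul_mem' := by
    rintro a b ⟨p, q, h1, h2, h3⟩ ⟨p', q', h1', h2', h3'⟩
    refine ⟨p * p', q * q', ?_, ?_, ?_⟩
    · rw [map_mul]
      exact mul_ne_zero h1 h1'
    · rw [map_mul, map_mul, ← h2, ← h2', Prod.fst_mul]
      ring
    · rw [map_mul, map_mul, ← h3, ← h3', Prod.snd_mul]
      ring
  one_mem' := ⟨1, 1, by simp, by simp, by simp⟩
  add_mem' := by
    rintro a b ⟨p, q, h1, h2, h3⟩ ⟨p', q', h1', h2', h3'⟩
    refine ⟨p * q' + p' * q, q * q', ?_, ?_, ?_⟩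
    · rw [map_mul]
      exact mul_ne_zero h1 h1'
    · rw [map_mul, map_add, map_mul, map_mul, ← h2, ← h2', Prod.fst_add]
      ring
    · rw [map_mul, map_add, map_mul, map_mul, ← h3, ← h3', Prod.snd_add]
      ring
  zero_mem' := ⟨0, 1, by simp, by simp, by simp⟩
  neg_mem' := by
    rintro a ⟨p, q, h1, h2, h3⟩
    exact ⟨-p, q, h1, by rw [map_neg, ← h2, Prod.fst_neg, neg_mul],
      by rw [map_neg, ← h3, Prod.snd_neg, neg_mul]⟩

theorem algebraMap_mem_evalGraph (x : Fin n → ℂ) (p : MvPolynomial (Fin n) ℂ) :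
    (algebraMap _ (RatField n) p, eval x p) ∈ evalGraph x :=
  ⟨p, 1, by simp, by simp, by simp⟩

theorem div_mem_evalGraph {x : Fin n → ℂ} {z : RatField n × ℂ} (hz : z ∈ evalGraph x)
    {q : MvPolynomial (Fin n) ℂ} (hq : eval x q ≠ 0) :
    (z.1 / algebraMap _ _ q, z.2 / eval x q) ∈ evalGraph x := by
  have hq' : algebraMap _ (RatField n) q ≠ 0 := fun h => hq (by
    rw [(map_eq_zero_iff _ (IsFractionRing.injective _ (RatField n))).1 h, map_zero])
  have h : ((1 : RatField n) / algebraMap _ _ q, 1 / eval x q) ∈ evalGraph x :=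
    ⟨1, q, hq, by rw [div_mul_cancel₀ _ hq', map_one], by rw [div_mul_cancel₀ _ hq, map_one]⟩
  have h1 := mul_mem hz h
  rwa [← Prod.mk.eta (p := z), Prod.mk_mul_mk, mul_one_div, mul_one_div] at h1

/-- The graph is single-valued at zero; with closure under the field operations this turns an
identity of rational functions into one of values at `x`. -/
theorem eq_zero_of_mem_evalGraph {x : Fin n → ℂ} {v : ℂ}
    (h : ((0 : RatField n), v) ∈ evalGraph x) : v = 0 := by
  obtain ⟨p, q, h1, h2, h3⟩ := h
  have h4 : p = 0 := (map_eq_zero_iff _ (IsFractionRing.injective _ (RatField n))).1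
    (h2.symm.trans (zero_mul _))
  rw [h4, map_zero] at h3
  exact (mul_eq_zero.1 h3).resolve_right h1

theorem sum_mem_evalGraph {x : Fin n → ℂ} {ι : Type*} (s : Finset ι) {a : ι → RatField n}
    {v : ι → ℂ} (h : ∀ i ∈ s, (a i, v i) ∈ evalGraph x) :
    (∑ i ∈ s, a i, ∑ i ∈ s, v i) ∈ evalGraph x := by
  have h1 := sum_mem h
  rwa [show ∑ i ∈ s, (a i, v i) = (∑ i ∈ s, a i, ∑ i ∈ s, v i) from
    Prod.ext Prod.fst_sum Prod.snd_sum] at h1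

end Analytic

/-! ### The Darboux multiplier as a function. -/

section Multiplier

open MeasureTheory MvPolynomial

open scoped ContDiff

variable {n : ℕ}

theorem eval_divergence_form {P : Fin n → MvPolynomial (Fin n) ℂ} {g h : MvPolynomial (Fin n) ℂ}
    {e : MvPolynomial (Fin n) ℂ →₀ ℂ}
    (H : ∑ i, algebraMap (MvPolynomial (Fin n) ℂ) (RatField n) (P i) *
        ((algebraMap _ (RatField n) (pderiv i g) * algebraMap _ (RatField n) h -
          algebraMap _ (RatField n) g * algebraMap _ (RatField n) (pderiv i h)) /
            algebraMap _ (RatField n) h ^ 2 +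
          e.sum fun f c => algebraMap (MvPolynomial (Fin n) ℂ) (RatField n) (C c) *
            (algebraMap _ (RatField n) (pderiv i f) / algebraMap _ (RatField n) f)) =
      -∑ i, algebraMap (MvPolynomial (Fin n) ℂ) (RatField n) (pderiv i (P i)))
    {x : Fin n → ℂ} (hh : eval x h ≠ 0) (hf : ∀ f ∈ e.support, eval x f ≠ 0) :
    ∑ i, eval x (P i) * ((eval x (pderiv i g) * eval x h - eval x g * eval x (pderiv i h)) /
        eval x h ^ 2 + ∑ f ∈ e.support, e f * (eval x (pderiv i f) / eval x f)) +
      ∑ i, eval x (pderiv i (P i)) = 0 := by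
  have hA := algebraMap_mem_evalGraph x
  have hadd : ∀ {a b : RatField n} {v w : ℂ}, (a, v) ∈ evalGraph x → (b, w) ∈ evalGraph x →
      (a + b, v + w) ∈ evalGraph x := fun h1 h2 => add_mem h1 h2
  have hsub : ∀ {a b : RatField n} {v w : ℂ}, (a, v) ∈ evalGraph x → (b, w) ∈ evalGraph x →
      (a - b, v - w) ∈ evalGraph x := fun h1 h2 => sub_mem h1 h2
  have hmul : ∀ {a b : RatField n} {v w : ℂ}, (a, v) ∈ evalGraph x → (b, w) ∈ evalGraph x →
      (a * b, v * w) ∈ evalGraph x := fun h1 h2 => mul_mem h1 h2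
  have h1 := hadd (sum_mem_evalGraph Finset.univ fun i _ => hmul (hA (P i)) (hadd
    (div_mem_evalGraph (hsub (hmul (hA (pderiv i g)) (hA h)) (hmul (hA g) (hA (pderiv i h))))
      (q := h ^ 2) (by rw [map_pow]; exact pow_ne_zero 2 hh))
    (sum_mem_evalGraph e.support fun f hf' => hmul (hA (C (e f)))
      (div_mem_evalGraph (hA (pderiv i f)) (hf f hf')))))
    (sum_mem_evalGraph Finset.univ fun i _ => hA (pderiv i (P i)))
  simp only [Finsupp.sum] at H
  simp only [map_pow, eval_C, H, neg_add_cancel] at h1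
  exact eq_zero_of_mem_evalGraph h1

/-- The logarithm of a Darboux function, with the branch of `log f` obtained by rotating the values
of `f` by `c`. -/
noncomputable def darbouxExponent {r : ℕ} (g h : MvPolynomial (Fin n) ℂ)
    (f : Fin r → MvPolynomial (Fin n) ℂ) (l c : Fin r → ℂ) (x : Fin n → ℂ) : ℂ :=
  eval x g * (eval x h)⁻¹ + ∑ j, l j * (Complex.log (c j * eval x (f j)) - Complex.log (c j))

theorem contDiffAt_darbouxExponent {r : ℕ} {g h : MvPolynomial (Fin n) ℂ}
    {f : Fin r → MvPolynomial (Fin n) ℂ} {l c : Fin r → ℂ} {x : Fin n → ℂ} (hh : eval x h ≠ 0)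
    (hf : ∀ j, c j * eval x (f j) ∈ Complex.slitPlane) {m : WithTop ℕ∞} :
    ContDiffAt ℂ m (darbouxExponent g h f l c) x := by
  refine ((contDiff_eval g).contDiffAt.mul ((contDiff_eval h).contDiffAt.inv hh)).add
    (ContDiffAt.sum fun j _ => contDiffAt_const.mul (ContDiffAt.sub ?_ contDiffAt_const))
  exact (Complex.contDiffAt_log (hf j)).comp x (contDiffAt_const.mul (contDiff_eval (f
      j)).contDiffAt)

theorem fderiv_darbouxExponent {r : ℕ} {g h : MvPolynomial (Fin n) ℂ}
    {f : Fin r → MvPolynomial (Fin n) ℂ} {l c : Fin r → ℂ} {x : Fin n → ℂ} (hh : eval x h ≠ 0)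
    (hf : ∀ j, c j * eval x (f j) ∈ Complex.slitPlane) (i : Fin n) :
    fderiv ℂ (darbouxExponent g h f l c) x (Pi.single i 1) =
      (eval x (pderiv i g) * eval x h - eval x g * eval x (pderiv i h)) / eval x h ^ 2 +
        ∑ j, l j * (eval x (pderiv i (f j)) / eval x (f j)) := by
  have h1 := (hasFDerivAt_eval g x).mul ((hasDerivAt_inv hh).comp_hasFDerivAt x (hasFDerivAt_eval h
      x))
  have h2 : ∀ j, HasFDerivAt (fun y : Fin n → ℂ =>
      l j * (Complex.log (c j * eval y (f j)) - Complex.log (c j))) _ x := fun j =>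
    ((((hasFDerivAt_eval (f j) x).const_mul (c j)).clog (hf j)).sub_const
      (Complex.log (c j))).const_mul (l j)
  have h3 : HasFDerivAt (darbouxExponent g h f l c) _ x :=
    h1.add (HasFDerivAt.fun_sum fun j (_ : j ∈ Finset.univ) => h2 j)
  rw [h3.fderiv]
  simp only [add_apply, smul_apply, sum_apply, fderiv_eval, smul_eq_mul, Function.comp]
  congr 1
  · field_simp
    ring
  · refine Finset.sum_congr rfl fun j _ => ?_
    obtain ⟨h4, h5⟩ := mul_ne_zero_iff.1 (Complex.slitPlane_ne_zero (hf j))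
    field_simp

theorem hasDarbouxJacobianMultiplier_of_form {P : Fin n → MvPolynomial (Fin n) ℂ}
    {g h : MvPolynomial (Fin n) ℂ} {e : MvPolynomial (Fin n) ℂ →₀ ℂ} (hh : h ≠ 0)
    (hgh : IsRelPrime g h)
    (he : ∀ f ∈ e.support, Irreducible f ∧ Quot.out (Associates.mk f) = f)
    (H : ∑ i, algebraMap (MvPolynomial (Fin n) ℂ) (RatField n) (P i) *
        ((algebraMap _ (RatField n) (pderiv i g) * algebraMap _ (RatField n) h -
          algebraMap _ (RatField n) g * algebraMap _ (RatField n) (pderiv i h)) /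
            algebraMap _ (RatField n) h ^ 2 +
          e.sum fun f c => algebraMap (MvPolynomial (Fin n) ℂ) (RatField n) (C c) *
            (algebraMap _ (RatField n) (pderiv i f) / algebraMap _ (RatField n) f)) =
      -∑ i, algebraMap (MvPolynomial (Fin n) ℂ) (RatField n) (pderiv i (P i))) :
    HasDarbouxJacobianMultiplier P := by
  let E := e.support.equivFin
  let f : Fin e.support.card → MvPolynomial (Fin n) ℂ := fun j => E.symm j
  let l : Fin e.support.card → ℂ := fun j => e (f j)
  have hfE : ∀ j, f j ∈ e.support := fun j => (E.symm j).2
  choose c hc₀ hc using fun j => exists_mul_mem_slitPlane (volume : Measure (Fin n → ℂ))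
    (continuous_eval_left (f j)).measurable (volume_zeroLocus (he _ (hfE j)).1.ne_zero)
  let U : Set (Fin n → ℂ) := {x | eval x h ≠ 0 ∧ ∀ j, c j * eval x (f j) ∈ Complex.slitPlane}
  have hU₁ : IsOpen U := by
    have h1 : U = {x | eval x h ≠ 0} ∩ ⋂ j, {x | c j * eval x (f j) ∈ Complex.slitPlane} := by
      ext x
      simp [U]
    rw [h1]
    exact (isOpen_ne.preimage (continuous_eval_left h)).inter (isOpen_iInter_of_finite fun j =>
      Complex.isOpen_slitPlane.preimage (continuous_const.mul (continuous_eval_left (f j))))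
  have hU₂ : volume Uᶜ = 0 := by
    refine measure_mono_null (t := {x | eval x h = 0} ∪
      ⋃ j, {x | c j * eval x (f j) ∉ Complex.slitPlane}) (fun x hx => ?_)
      (measure_union_null (volume_zeroLocus hh) (measure_iUnion_null hc))
    by_contra hx'
    simp only [Set.mem_union, Set.mem_ofPred_eq, Set.mem_iUnion, not_or, not_exists, not_not] at hx'
    exact hx hx'
  have hf₀ : ∀ x ∈ U, ∀ j, eval x (f j) ≠ 0 := fun x hx j =>
    right_ne_zero_of_mul (Complex.slitPlane_ne_zero (hx.2 j))
  -- Subtracting the constant `log (c j)` undoes the rotation, so that `exp ∘ ℓ j` is `f j` itself.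
  let ℓ : Fin e.support.card → (Fin n → ℂ) → ℂ := fun j x =>
    Complex.log (c j * eval x (f j)) - Complex.log (c j)
  refine ⟨U, fun x => Complex.exp (darbouxExponent g h f l c x), hU₁, hU₂,
    ⟨_, g, h, f, l, ℓ, hh, hgh, fun j => (he _ (hfE j)).1, fun i j hij hass => hij ?_,
      fun x hx => hx.1, fun j => ⟨fun x hx => ?_, fun x hx => ?_⟩, fun x _ => ?_⟩,
    fun x hx => ?_, fun x hx => ?_⟩
  · have h1 : f i = f j := by
      rw [← (he _ (hfE i)).2, ← (he _ (hfE j)).2, Associates.mk_eq_mk_iff_associated.2 hass]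
    exact E.symm.injective (Subtype.ext h1)
  · exact (((continuousAt_const.mul (continuous_eval_left (f j)).continuousAt).clog (hx.2 j)).sub
      continuousAt_const).continuousWithinAt
  · rw [Complex.exp_sub, Complex.exp_log (Complex.slitPlane_ne_zero (hx.2 j)),
      Complex.exp_log (hc₀ j), mul_div_cancel_left₀ _ (hc₀ j)]
  · simp only [darbouxExponent]
    rw [Complex.exp_add, Complex.exp_sum, ← div_eq_mul_inv]
  · exact (contDiffAt_darbouxExponent hx.1 hx.2).cexp.contDiffWithinAt
  · have h1 := ((contDiffAt_darbouxExponent (g := g) (l := l) hx.1 hx.2 (m := 1)).differentiableAt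
      one_ne_zero).hasFDerivAt.cexp
    have h2 := eval_divergence_form H hx.1 fun p hp => by
      have h3 := hf₀ x hx (E ⟨p, hp⟩)
      simpa [f] using h3
    calc _ = ∑ i, Complex.exp (darbouxExponent g h f l c x) * (eval x (P i) *
          ((eval x (pderiv i g) * eval x h - eval x g * eval x (pderiv i h)) / eval x h ^ 2 +
            ∑ p ∈ e.support, e p * (eval x (pderiv i p) / eval x p)) + eval x (pderiv i (P i))) :=
                by
          refine Finset.sum_congr rfl fun i _ => ?_
          have h4 : HasFDerivAt (fun y => Complex.exp (darbouxExponent g h f l c y) * eval y (P i))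
              _ x :=
            h1.mul (hasFDerivAt_eval (P i) x)
          have h5 : ∑ j, l j * (eval x (pderiv i (f j)) / eval x (f j)) =
              ∑ p ∈ e.support, e p * (eval x (pderiv i p) / eval x p) := by
            rw [← Finset.sum_coe_sort e.support]
            exact E.symm.sum_comp fun p : e.support =>
              e p * (eval x (pderiv i (p : MvPolynomial (Fin n) ℂ)) / eval x (p : MvPolynomial (Fin
                  n) ℂ))
          rw [h4.fderiv]
          simp only [add_apply, smul_apply, smul_eq_mul, fderiv_eval,
            fderiv_darbouxExponent hx.1 hx.2, h5]
          ring
      _ = 0 := by rw [← Finset.mul_sum, Finset.sum_add_distrib, h2, mul_zero]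

end Multiplier

end LiouvilleDarboux

theorem theorem2 {n : ℕ} (P : Fin n → MvPolynomial (Fin n) ℂ)
    (hP : LiouvilleDarboux.IsLiouvillianIntegrable.{u} P) :
    LiouvilleDarboux.HasDarbouxJacobianMultiplier P := by
  by_cases h : ∃ k, P k ≠ 0
  · obtain ⟨k, hk⟩ := h
    obtain ⟨g, h, e, hh, hgh, he, H⟩ := LiouvilleDarboux.exists_darboux_form hP hk
    exact LiouvilleDarboux.hasDarbouxJacobianMultiplier_of_form hh hgh he H
  -- For the zero system the constant `J = 1` serves; there is no index `k₀` to single out.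
  · push Not at h
    exact LiouvilleDarboux.hasDarbouxJacobianMultiplier_of_form (g := 0) (h := 1) (e := 0)
      one_ne_zero isRelPrime_one_right (by simp) (by simp [h])
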